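/- **Setting.** Let $R=\mathbb{C}[u^{\pm1},v]$, let $d\ge 1$ and $n\ge 0$ be integers, and let $\xi_1,\dots,\xi_d$ be the $d$-th roots of unity in $\mathbb{C}$, in any order. * $\mathcal{H}_m$ ($m\ge0$) is the Iwahori–Hecke algebra of type $A_{m-1}$: the associative unital $R$-algebra with generators $T_1,\dots,T_{m-1}$ and relations $T_iT_j=T_jT_i$ ($|i-j|>1$), $T_iT_{i+1}T_i=T_{i+1}T_iT_{i+1}$, $T_i^2=u^2+vT_i$ (so $\mathcal{H}_0=\mathcal{H}_1=R$). For $w\in\mathfrak{S}_m$ with reduced expression $s_{i_1}\cdots s_{i_r}$ put $\widetilde T_w=u^{-r}T_{i_1}\cdots T_{i_r}$. * $Y_{d,n}$ is the Yokonuma–Hecke algebra: the associative unital $R$-algebra with generators $g_1,\dots,g_{n-1},t_1,\dots,t_n$ and relations $g_ig_j=g_jg_i$ ($|i-j|>1$), $g_ig_{i+1}g_i=g_{i+1}g_ig_{i+1}$, $t_it_j=t_jt_i$, $g_it_j=t_{s_i(j)}g_i$, $t_j^d=1$, $g_i^2=u^2+v\,e_ig_i$, where $e_i=\frac1d\sum_{0\le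 s<d}t_i^st_{i+1}^{-s}$. For $w\in\mathfrak{S}_n$ with reduced expression $s_{i_1}\cdots s_{i_r}$ put $\widetilde g_w=u^{-r}g_{i_1}\cdots g_{i_r}$. * Characters $\chi$ of $(\mathbb{Z}/d)^n=\langle t_1,\dots,t_n\rangle$ are permuted by $w(\chi)(t_i)=\chi(t_{w^{-1}(i)})$, and $E_\chi=\prod_{i=1}^n\bigl(\frac1d\sum_{0\le s<d}\chi(t_i)^st_i^{-s}\bigr)$. * $\operatorname{Comp}_d(n)$ is the set of $\mu=(\mu_1,\dots,\mu_d)\in\mathbb{Z}_{\ge0}^d$ with $\sum_a\mu_a=n$. For such $\mu$ let $\mathfrak{S}^\mu=\mathfrak{S}_{\mu_1}\times\cdots\times\mathfrak{S}_{\mu_d}\subset\mathfrak{S}_n$ be the Young subgroup permuting consecutive blocks of sizes $\mu_1,\dots,\mu_d$, let $\mathcal{H}^\mu=\mathcal{H}_{\mu_1}\otimes_R\cdots\otimes_R\mathcal{H}_{\mu_d}$, and put $\widetilde T_w=\widetilde T_{w_1}\otimes\cdots\otimes\widetilde T_{w_d}$ for $w=(w_1,\dots,w_d)\in\mathfrak{S}^\mu$.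 Let $\chi^\mu_1$ be the character equal to $\xi_a$ on every $t_j$ with $j$ in the $a$-th block, let $\mathcal{O}(\mu)=\{\chi_1^\mu,\dots,\chi_{m_\mu}^\mu\}$ be its $\mathfrak{S}_n$-orbit, and let $\pi_{k,\mu}$ be the element of minimal length with $\pi_{k,\mu}(\chi_1^\mu)=\chi_k^\mu$. **Proposition.** The elements $\widetilde T_w$ and $\widetilde g_w$ do not depend on the reduced expressions. The following linear maps exist and are uniquely determined by the given values: * $\boldsymbol\tau_m:\mathcal{H}_m\to R$ with $\boldsymbol\tau_m(\widetilde T_w)=1$ if $w=1$ and $0$ otherwise ($m\ge0$); * the form $\widetilde{\boldsymbol\rho}_n:Y_{d,n}\to R$ of Chlouveraki and Poulain d'Andecy, with, for $0\le a_1,\dots,a_n\le d-1$, $\widetilde{\boldsymbol\rho}_n(t_1^{a_1}\cdots t_n^{a_n}\widetilde g_w)=d^n$ if $a_1=\dots=a_n=0$ and $w=1$, and $0$ otherwise; * the map $\Psi=\bigoplus_\mu\Psi_\mu:Y_{d,n}\to\bigoplus_{\mu\in\operatorname{Comp}_d(n)}\operatorname{Mat}_{m_\mu}(\mathcal{H}^\mu)$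 sending $E_{\chi_k^\mu}\widetilde g_w$ to $\widetilde T_{\pi_{k,\mu}^{-1}w\pi_{j,\mu}}\,\mathrm{M}_{k,j}$ in the $\mu$-th summand, where $w(\chi_j^\mu)=\chi_k^\mu$ and $\mathrm{M}_{k,j}$ is an elementary matrix; it is an isomorphism of $R$-algebras. The forms $\boldsymbol\tau_m$ and $\widetilde{\boldsymbol\rho}_n$ are symmetrizing: they are trace functions, and $(x,y)\mapsto\boldsymbol\tau_m(xy)$, $(x,y)\mapsto\widetilde{\boldsymbol\rho}_n(xy)$ are perfect pairings over $R$. Put $\boldsymbol\tau^\mu=\boldsymbol\tau_{\mu_1}\otimes\cdots\otimes\boldsymbol\tau_{\mu_d}$ and $\boldsymbol\rho_n=\bigoplus_\mu\boldsymbol\tau^\mu\circ\operatorname{Tr}_{\operatorname{Mat}_{m_\mu}}\circ\Psi_\mu$. Then $$\boldsymbol\rho_n=\widetilde{\boldsymbol\rho}_n ,$$ and for every character $\chi$ and every $w\in\mathfrak{S}_n$ this form takes the value $1$ on $E_\chi\widetilde g_w$ if $w=1$, and $0$ otherwise. **Schur elements.** Let $K$ be a field containing $R$ over which $\mathcal{H}_0,\dots,\mathcal{H}_n$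 are split (every endomorphism of a simple $K\mathcal{H}_m$-module, $m\le n$, is a scalar), and for $m\le n$ let $(M_\lambda)_{\lambda\in\Lambda_m}$ be a complete list without repetition, indexed by a finite set $\Lambda_m$ (for instance the partitions of $m$), of the simple $K\mathcal{H}_m$-modules up to isomorphism. Then $K\mathcal{H}_m$ ($m\le n$) and $KY_{d,n}$ are semisimple. There are unique nonzero $s_\lambda\in K$, integral over $R$, with $\boldsymbol\tau_m=\sum_{\lambda\in\Lambda_m}\frac1{s_\lambda}\chi_{M_\lambda}$, where $\chi_M$ is the character of $M$; these are the Schur elements of $\boldsymbol\tau_m$. The modules $$N_{\boldsymbol\lambda}=(M_{\lambda^1}\otimes\cdots\otimes M_{\lambda^d})^{m_\mu},\qquad \mu\in\operatorname{Comp}_d(n),\quad \boldsymbol\lambda=(\lambda^1,\dots,\lambda^d)\in\Lambda_{\mu_1}\times\cdots\times\Lambda_{\mu_d},$$ on which $Y_{d,n}$ acts through $\Psi_\mu$, form a complete list without repetition of the simple $KY_{d,n}$-modules, and every endomorphism of each of them is a scalar. The Schur elements of $\widetilde{\boldsymbol\rho}_n$, that is, the unique nonzero $s_{\boldsymbol\lambda}\in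 K$ integral over $R$ with $\widetilde{\boldsymbol\rho}_n=\sum_{\boldsymbol\lambda}\frac1{s_{\boldsymbol\lambda}}\chi_{N_{\boldsymbol\lambda}}$, are $$s_{\boldsymbol\lambda}=s_{\lambda^1}\cdots s_{\lambda^d}.$$ -/

import Mathlib

open scoped TensorProduct

namespace YokonumaHecke

noncomputable section

/-! ### The ground ring `ℂ[u^{±1}, v]` -/

/-- The ground ring `ℂ[u^{±1}, v]`: polynomials in `v` over Laurent polynomials in `u`. -/
def GroundRing : Type := Polynomial (LaurentPolynomial ℂ)

instance : CommRing GroundRing := inferInstanceAs (CommRing (Polynomial (LaurentPolynomial ℂ)))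

instance : Algebra ℂ GroundRing :=
  inferInstanceAs (Algebra ℂ (Polynomial (LaurentPolynomial ℂ)))

/-- The indeterminate `u`. -/
def u : GroundRing := (Polynomial.C (LaurentPolynomial.T 1) : Polynomial (LaurentPolynomial ℂ))

/-- The inverse `u⁻¹` of the indeterminate `u`. -/
def uInv : GroundRing :=
  (Polynomial.C (LaurentPolynomial.T (-1)) : Polynomial (LaurentPolynomial ℂ))

/-- The indeterminate `v`. -/
def v : GroundRing := (Polynomial.X : Polynomial (LaurentPolynomial ℂ))

/-- Complex constants in the ground ring. -/
def const (c : ℂ) : GroundRing := algebraMap ℂ GroundRing c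

/-! ### The symmetric group: reduced words and lengths

The symmetric group is `Equiv.Perm (Fin n)`; positions and generators are numbered from `0`. -/

/-- The adjacent transposition `s_i = (i, i+1)`, for `i = 0, …, n - 2`. -/
def adjSwap {n : ℕ} (i : Fin (n - 1)) : Equiv.Perm (Fin n) :=
  Equiv.swap ⟨i.1, by omega⟩ ⟨i.1 + 1, by omega⟩

/-- The permutation represented by a word in the adjacent transpositions. -/
def wordProd {n : ℕ} (l : List (Fin (n - 1))) : Equiv.Perm (Fin n) :=
  (l.map adjSwap).prod

/-- A word is a reduced expression if no shorter word represents the same permutation. -/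
def IsReducedWord {n : ℕ} (l : List (Fin (n - 1))) : Prop :=
  ∀ l' : List (Fin (n - 1)), wordProd l' = wordProd l → l.length ≤ l'.length

theorem exists_wordProd {n : ℕ} (w : Equiv.Perm (Fin n)) :
    ∃ l : List (Fin (n - 1)), wordProd l = w := by
  cases n with
  | zero => exact ⟨[], Subsingleton.elim _ _⟩
  | succ m =>
    have h : w ∈ Submonoid.closure
        (Set.range fun i : Fin m ↦ Equiv.swap i.castSucc i.succ) := by
      rw [Equiv.Perm.mclosure_swap_castSucc_succ]; trivial
    induction h using Submonoid.closure_induction with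
    | mem x hx =>
      obtain ⟨i, rfl⟩ := hx
      refine ⟨[i], ?_⟩
      simp only [wordProd, List.map_cons, List.map_nil, List.prod_cons, List.prod_nil, mul_one]
      rfl
    | one => exact ⟨[], rfl⟩
    | mul x y _ _ hx hy =>
      obtain ⟨l₁, rfl⟩ := hx
      obtain ⟨l₂, rfl⟩ := hy
      exact ⟨l₁ ++ l₂, by simp [wordProd]⟩

theorem exists_reduced {n : ℕ} (w : Equiv.Perm (Fin n)) :
    ∃ l : List (Fin (n - 1)), wordProd l = w ∧ IsReducedWord l := by
  obtain ⟨l, hl, hmin⟩ := (measure (List.length (α := Fin (n - 1)))).wf.has_min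
    {l | wordProd l = w} (exists_wordProd w)
  exact ⟨l, hl, fun l' hl' ↦ not_lt.mp (hmin l' (hl'.trans hl))⟩

/-- A chosen reduced expression of a permutation. -/
def redWord {n : ℕ} (w : Equiv.Perm (Fin n)) : List (Fin (n - 1)) :=
  (exists_reduced w).choose

/-- The length of a permutation. -/
def len {n : ℕ} (w : Equiv.Perm (Fin n)) : ℕ := (redWord w).length

/-! ### The Iwahori--Hecke algebra of type `A` -/

/-- The defining relations of the Iwahori--Hecke algebra with generators `T_i`. -/
inductive HeckeRel (m : ℕ) :
    FreeAlgebra GroundRing (Fin (m - 1)) → FreeAlgebra GroundRing (Fin (m - 1)) → Prop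
  | comm (i j : Fin (m - 1)) (h : i.1 + 1 < j.1 ∨ j.1 + 1 < i.1) :
      HeckeRel m (FreeAlgebra.ι GroundRing i * FreeAlgebra.ι GroundRing j)
        (FreeAlgebra.ι GroundRing j * FreeAlgebra.ι GroundRing i)
  | braid (i j : Fin (m - 1)) (h : i.1 + 1 = j.1) :
      HeckeRel m
        (FreeAlgebra.ι GroundRing i * FreeAlgebra.ι GroundRing j * FreeAlgebra.ι GroundRing i)
        (FreeAlgebra.ι GroundRing j * FreeAlgebra.ι GroundRing i * FreeAlgebra.ι GroundRing j)
  | quad (i : Fin (m - 1)) :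
      HeckeRel m (FreeAlgebra.ι GroundRing i * FreeAlgebra.ι GroundRing i)
        (algebraMap GroundRing _ (u ^ 2) + v • FreeAlgebra.ι GroundRing i)

/-- The Iwahori--Hecke algebra `H_m` of type `A_{m-1}`; `H_0 = H_1` is the ground ring. -/
def Hecke (m : ℕ) : Type := RingQuot (HeckeRel m)

instance (m : ℕ) : Ring (Hecke m) := inferInstanceAs (Ring (RingQuot (HeckeRel m)))

instance (m : ℕ) : Algebra GroundRing (Hecke m) :=
  inferInstanceAs (Algebra GroundRing (RingQuot (HeckeRel m)))

/-- The projection of the free algebra onto the Iwahori--Hecke algebra. -/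
def heckeMk (m : ℕ) : FreeAlgebra GroundRing (Fin (m - 1)) →ₐ[GroundRing] Hecke m :=
  RingQuot.mkAlgHom GroundRing (HeckeRel m)

/-- The generator `T_i`. -/
def heckeT {m : ℕ} (i : Fin (m - 1)) : Hecke m :=
  heckeMk m (FreeAlgebra.ι GroundRing i)

/-- The product of the elements `u⁻¹ T_i` along a word. -/
def heckeWord {m : ℕ} (l : List (Fin (m - 1))) : Hecke m :=
  (l.map fun i ↦ uInv • heckeT i).prod

/-- The normalized standard basis element `u^{-ℓ(w)} T_w`. -/
def heckeTilde {m : ℕ} (w : Equiv.Perm (Fin m)) : Hecke m := heckeWord (redWord w)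

/-! ### The Yokonuma--Hecke algebra -/

/-- The generators of the Yokonuma--Hecke algebra: `g_1, …, g_{n-1}` and `t_1, …, t_n`. -/
inductive YGen (n : ℕ) : Type
  | g (i : Fin (n - 1)) : YGen n
  | t (j : Fin n) : YGen n

/-- The generator `g_i` in the free algebra. -/
def freeG {n : ℕ} (i : Fin (n - 1)) : FreeAlgebra GroundRing (YGen n) :=
  FreeAlgebra.ι GroundRing (YGen.g i)

/-- The generator `t_j` in the free algebra. -/
def freeT {n : ℕ} (j : Fin n) : FreeAlgebra GroundRing (YGen n) :=
  FreeAlgebra.ι GroundRing (YGen.t j)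

/-- The element `e_i = (1/d) ∑_{0 ≤ s < d} t_i^s t_{i+1}^{-s}`, where `t_{i+1}⁻¹` is written
as `t_{i+1}^{d-1}`. -/
def freeE (d : ℕ) {n : ℕ} (i : Fin (n - 1)) : FreeAlgebra GroundRing (YGen n) :=
  const (1 / (d : ℂ)) • ∑ s ∈ Finset.range d,
    freeT (n := n) ⟨i.1, by omega⟩ ^ s * (freeT (n := n) ⟨i.1 + 1, by omega⟩ ^ (d - 1)) ^ s

/-- The defining relations of the Yokonuma--Hecke algebra. -/
inductive YRel (d n : ℕ) :
    FreeAlgebra GroundRing (YGen n) → FreeAlgebra GroundRing (YGen n) → Prop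
  | comm (i j : Fin (n - 1)) (h : i.1 + 1 < j.1 ∨ j.1 + 1 < i.1) :
      YRel d n (freeG i * freeG j) (freeG j * freeG i)
  | braid (i j : Fin (n - 1)) (h : i.1 + 1 = j.1) :
      YRel d n (freeG i * freeG j * freeG i) (freeG j * freeG i * freeG j)
  | t_comm (i j : Fin n) : YRel d n (freeT i * freeT j) (freeT j * freeT i)
  | g_t (i : Fin (n - 1)) (j : Fin n) :
      YRel d n (freeG i * freeT j) (freeT (adjSwap i j) * freeG i)
  | t_pow (j : Fin n) : YRel d n (freeT j ^ d) 1
  | quad (i : Fin (n - 1)) :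
      YRel d n (freeG i * freeG i)
        (algebraMap GroundRing _ (u ^ 2) + v • (freeE d i * freeG i))

/-- The Yokonuma--Hecke algebra `Y_{d,n}`. -/
def Yokonuma (d n : ℕ) : Type := RingQuot (YRel d n)

instance (d n : ℕ) : Ring (Yokonuma d n) := inferInstanceAs (Ring (RingQuot (YRel d n)))

instance (d n : ℕ) : Algebra GroundRing (Yokonuma d n) :=
  inferInstanceAs (Algebra GroundRing (RingQuot (YRel d n)))

/-- The projection of the free algebra onto the Yokonuma--Hecke algebra. -/
def yMk (d n : ℕ) : FreeAlgebra GroundRing (YGen n) →ₐ[GroundRing] Yokonuma d n :=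
  RingQuot.mkAlgHom GroundRing (YRel d n)

/-- The generator `g_i` of `Y_{d,n}`. -/
def yG (d : ℕ) {n : ℕ} (i : Fin (n - 1)) : Yokonuma d n :=
  yMk d n (freeG i)

/-- The generator `t_j` of `Y_{d,n}`. -/
def yT (d : ℕ) {n : ℕ} (j : Fin n) : Yokonuma d n :=
  yMk d n (freeT j)

/-- The product of the elements `u⁻¹ g_i` along a word. -/
def yWord (d : ℕ) {n : ℕ} (l : List (Fin (n - 1))) : Yokonuma d n :=
  (l.map fun i ↦ uInv • yG d i).prod

/-- The element `u^{-ℓ(w)} g_w`. -/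
def gTilde (d : ℕ) {n : ℕ} (w : Equiv.Perm (Fin n)) : Yokonuma d n := yWord d (redWord w)

/-- The monomial `t_1^{k_1} ⋯ t_n^{k_n}`. -/
def tMonomial (d : ℕ) {n : ℕ} (k : Fin n → Fin d) : Yokonuma d n :=
  (List.ofFn fun j ↦ yT d j ^ (k j).1).prod

/-! ### Characters of `(ℤ/d)^n`, compositions and Young subgroups

Given an enumeration `ξ_1, …, ξ_d` of the `d`-th roots of unity, a map `χ : Fin n → Fin d` stands
for the character with `t_j ↦ ξ (χ j)`. -/

/-- The primitive idempotent `E_χ = ∏_j (1/d) ∑_{0 ≤ s < d} χ(t_j)^s t_j^{-s}`, where `t_j⁻¹` is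
written as `t_j^{d-1}`. -/
def idem {d n : ℕ} (ξ : Fin d → ℂ) (χ : Fin n → Fin d) : Yokonuma d n :=
  (List.ofFn fun j ↦ const (1 / (d : ℂ)) • ∑ s ∈ Finset.range d,
    const (ξ (χ j) ^ s) • (yT d j ^ (d - 1)) ^ s).prod

/-- The action of the symmetric group on characters: `w(χ)(t_j) = χ(t_{w⁻¹(j)})`. -/
def act {d n : ℕ} (w : Equiv.Perm (Fin n)) (χ : Fin n → Fin d) : Fin n → Fin d :=
  fun j ↦ χ (w⁻¹ j)

/-- Compositions of `n` with `d` parts, zero parts being allowed. -/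
abbrev Comp (d n : ℕ) : Type := {μ : Fin d → ℕ // ∑ a, μ a = n}

instance (d n : ℕ) : Fintype (Comp d n) :=
  Fintype.subtype (Finset.piAntidiag Finset.univ n) (by intro x; simp)

/-- The orbit of characters taking the value `ξ_a` exactly `μ_a` times for every `a`. -/
abbrev Orb {d n : ℕ} (μ : Comp d n) : Type :=
  {χ : Fin n → Fin d // ∀ a, Fintype.card {j // χ j = a} = μ.1 a}

/-- The identification of `{1, …, n}` with consecutive blocks of sizes `μ_1, …, μ_d`. -/
def blockEquiv {d n : ℕ} (μ : Comp d n) : (Σ a, Fin (μ.1 a)) ≃ Fin n :=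
  finSigmaFinEquiv.trans (finCongr μ.2)

/-- The distinguished character `χ_1^μ`: it takes the value `ξ_a` on the `a`-th block. -/
def firstChar {d n : ℕ} (μ : Comp d n) : Fin n → Fin d := fun j ↦ ((blockEquiv μ).symm j).1

/-- The inclusion of the Young subgroup `S_{μ_1} × ⋯ × S_{μ_d}` in the symmetric group. -/
def young {d n : ℕ} (μ : Comp d n) (x : ∀ a, Equiv.Perm (Fin (μ.1 a))) : Equiv.Perm (Fin n) :=
  (blockEquiv μ).permCongr (Equiv.Perm.sigmaCongrRight x)

theorem exists_act {d n : ℕ} {μ : Comp d n} (χ : Orb μ) :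
    ∃ w : Equiv.Perm (Fin n), act w (firstChar μ) = χ.1 := by
  let e : Fin n ≃ Fin n := ((Equiv.sigmaFiberEquiv χ.1).symm.trans
    (Equiv.sigmaCongrRight fun a ↦ Fintype.equivFinOfCardEq (χ.2 a))).trans (blockEquiv μ)
  refine ⟨e.symm, funext fun j ↦ ?_⟩
  change ((blockEquiv μ).symm (e j)).1 = χ.1 j
  simp only [e, Equiv.trans_apply, Equiv.symm_apply_apply]
  rfl

theorem exists_minRep {d n : ℕ} {μ : Comp d n} (χ : Orb μ) :
    ∃ w : Equiv.Perm (Fin n), act w (firstChar μ) = χ.1 ∧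
      ∀ w' : Equiv.Perm (Fin n), act w' (firstChar μ) = χ.1 → len w ≤ len w' := by
  obtain ⟨w, hw, hmin⟩ := (measure (len (n := n))).wf.has_min
    {w | act w (firstChar μ) = χ.1} (exists_act χ)
  exact ⟨w, hw, fun w' hw' ↦ not_lt.mp (hmin w' hw')⟩

/-- The element `π` of minimal length with `π(χ_1^μ) = χ`, that is, the distinguished
representative of a left coset of the Young subgroup. -/
def minRep {d n : ℕ} {μ : Comp d n} (χ : Orb μ) : Equiv.Perm (Fin n) :=
  (exists_minRep χ).choose

/-! ### The direct sum of matrix algebras -/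

/-- The algebra `H^μ = H_{μ_1} ⊗ ⋯ ⊗ H_{μ_d}`. -/
def HeckeTensor {d n : ℕ} (μ : Comp d n) : Type := ⨂[GroundRing] a, Hecke (μ.1 a)

instance {d n : ℕ} (μ : Comp d n) : Ring (HeckeTensor μ) :=
  inferInstanceAs (Ring (⨂[GroundRing] a, Hecke (μ.1 a)))

instance {d n : ℕ} (μ : Comp d n) : Algebra GroundRing (HeckeTensor μ) :=
  inferInstanceAs (Algebra GroundRing (⨂[GroundRing] a, Hecke (μ.1 a)))

/-- The basis element `T̃_{x_1} ⊗ ⋯ ⊗ T̃_{x_d}` of `H^μ`. -/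
def tensorTilde {d n : ℕ} (μ : Comp d n) (x : ∀ a, Equiv.Perm (Fin (μ.1 a))) : HeckeTensor μ :=
  (⨂ₜ[GroundRing] a, heckeTilde (x a) : ⨂[GroundRing] a, Hecke (μ.1 a))

/-- The algebra `⊕_μ Mat_{m_μ}(H^μ)`, the rows and columns of the `μ`-th block being indexed by
the orbit of `μ`, which has `m_μ` elements. -/
abbrev BlockAlgebra (d n : ℕ) : Type :=
  ∀ μ : Comp d n, Matrix (Orb μ) (Orb μ) (HeckeTensor μ)

/-- The defining property of the map `Ψ_n = ⊕_μ Ψ_μ`. For characters `χ, χ'` in the orbit of `μ`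
and `w` with `w(χ') = χ`, it sends `E_χ g̃_w` to `T̃_{π⁻¹ w π'} M_{χ,χ'}`, with `π, π'` the
distinguished representatives attached to `χ, χ'`; the permutation `π⁻¹ w π'` lies in the Young
subgroup, and if it is `x = (x_1, …, x_d)` then `T̃_x = T̃_{x_1} ⊗ ⋯ ⊗ T̃_{x_d}`. -/
def IsPsi {d n : ℕ} (ξ : Fin d → ℂ) (F : Yokonuma d n → BlockAlgebra d n) : Prop :=
  ∀ (μ : Comp d n) (χ χ' : Orb μ) (w : Equiv.Perm (Fin n)), act w χ'.1 = χ.1 →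
    ∀ x : (∀ a, Equiv.Perm (Fin (μ.1 a))), young μ x = (minRep χ)⁻¹ * w * minRep χ' →
      F (idem ξ χ.1 * gTilde d w) =
        Pi.single μ (Matrix.single χ χ' (tensorTilde μ x))

/-! ### Symmetrizing forms -/

/-- The defining values of the canonical form `τ_m` on `H_m`. -/
def IsCanonicalForm {m : ℕ} (f : Hecke m →ₗ[GroundRing] GroundRing) : Prop :=
  ∀ w : Equiv.Perm (Fin m), f (heckeTilde w) = if w = 1 then 1 else 0

/-- The defining values of the form of Chlouveraki and Poulain d'Andecy on `Y_{d,n}`. -/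
def IsCPAForm {d n : ℕ} (f : Yokonuma d n →ₗ[GroundRing] GroundRing) : Prop :=
  ∀ (k : Fin n → Fin d) (w : Equiv.Perm (Fin n)),
    f (tMonomial d k * gTilde d w) = if (∀ j, (k j).1 = 0) ∧ w = 1 then (d : GroundRing) ^ n else 0

/-- A symmetrizing form on an `R`-algebra: a trace function such that `(x, y) ↦ f (x y)` is a
non-degenerate (perfect) pairing over `R`. -/
def IsSymmetrizing {R A : Type*} [CommRing R] [Ring A] [Algebra R A] (f : A →ₗ[R] R) : Prop :=
  (∀ x y, f (x * y) = f (y * x)) ∧ ((LinearMap.mul R A).compr₂ f).IsPerfPair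

/-- The form `τ^μ = τ_{μ_1} ⊗ ⋯ ⊗ τ_{μ_d}` on `H^μ`. -/
def tensorForm {d n : ℕ} (τ : ∀ m, Hecke m →ₗ[GroundRing] GroundRing) (μ : Comp d n) :
    HeckeTensor μ →ₗ[GroundRing] GroundRing :=
  show (⨂[GroundRing] a, Hecke (μ.1 a)) →ₗ[GroundRing] GroundRing from PiTensorProduct.lift
    ((MultilinearMap.mkPiAlgebra GroundRing (Fin d) GroundRing).compLinearMap fun a ↦ τ (μ.1 a))

/-- The form `ρ_n = ⊕_μ τ^μ ∘ Tr ∘ Ψ_μ` on `Y_{d,n}`. -/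
def rho {d n : ℕ} (τ : ∀ m, Hecke m →ₗ[GroundRing] GroundRing)
    (Ψ : Yokonuma d n ≃ₐ[GroundRing] BlockAlgebra d n) (y : Yokonuma d n) : GroundRing :=
  ∑ μ, tensorForm τ μ (Matrix.trace (Ψ y μ))

/-! ### Simple modules and Schur elements

Let `A` be an `R`-algebra and `K` a field over `R`. A finite-dimensional module over `K ⊗_R A`,
with a basis indexed by `ι`, is given by a homomorphism of `R`-algebras from `A` to the `K`-valued
matrices indexed by `ι`. -/

section Schur

variable {R A K : Type*} [CommRing R] [Ring A] [Algebra R A] [Field K] [Algebra R K]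

/-- The module given by a matrix representation is simple. -/
def IsIrreducible {ι : Type*} [Fintype ι] [DecidableEq ι] (φ : A →ₐ[R] Matrix ι ι K) : Prop :=
  Nonempty ι ∧ ∀ W : Submodule K (ι → K),
    (∀ a, ∀ x ∈ W, (φ a).mulVec x ∈ W) → W = ⊥ ∨ W = ⊤

/-- The modules given by two matrix representations are isomorphic. -/
def IsEquivalent {ι κ : Type*} [Fintype ι] [DecidableEq ι] [Fintype κ] [DecidableEq κ]
    (φ : A →ₐ[R] Matrix ι ι K) (ψ : A →ₐ[R] Matrix κ κ K) : Prop :=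
  ∃ e : (ι → K) ≃ₗ[K] (κ → K), ∀ a x, e ((φ a).mulVec x) = (ψ a).mulVec (e x)

/-- The family `φ` is a complete list, without repetition up to isomorphism, of the simple modules
of `K ⊗_R A`, and `K` is a splitting field: each endomorphism of each of them is a scalar. -/
structure IsSplitIrrList {I : Type*} {ι : I → Type*} [∀ i, Fintype (ι i)]
    [∀ i, DecidableEq (ι i)] (φ : ∀ i, A →ₐ[R] Matrix (ι i) (ι i) K) : Prop where
  irreducible : ∀ i, IsIrreducible (φ i)
  irredundant : ∀ i j, IsEquivalent (φ i) (φ j) → i = j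
  complete : ∀ (k : ℕ) (ψ : A →ₐ[R] Matrix (Fin k) (Fin k) K), IsIrreducible ψ →
    ∃ i, IsEquivalent (φ i) ψ
  split : ∀ i, ∀ f : (ι i → K) →ₗ[K] (ι i → K),
    (∀ a x, f ((φ i a).mulVec x) = (φ i a).mulVec (f x)) → ∃ c : K, ∀ x, f x = c • x

/-- The Schur elements `s_i` associated to the form `f` and to the list `φ` of the simple modules:
elements of the integral closure of `R` in `K` with `f = ∑_i (1 / s_i) χ_i`, where `χ_i` is the
character of the `i`-th simple module. (By `K`-linearity it is enough to evaluate the extended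
form and the characters on `A`.) -/
structure IsSchurFamily {I : Type*} [Fintype I] {ι : I → Type*} [∀ i, Fintype (ι i)]
    [∀ i, DecidableEq (ι i)] (f : A →ₗ[R] R) (φ : ∀ i, A →ₐ[R] Matrix (ι i) (ι i) K)
    (s : I → K) : Prop where
  integral : ∀ i, IsIntegral R (s i)
  ne_zero : ∀ i, s i ≠ 0
  expansion : ∀ a : A, algebraMap R K (f a) = ∑ i, (s i)⁻¹ * Matrix.trace (φ i a)

end Schur

section Modules

variable {R K : Type*} [CommRing R] [Field K] [Algebra R K]

/-- The tensor product `M_1 ⊗ ⋯ ⊗ M_d` of modules given by matrix representations `φ_a` of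
algebras `B_a`, as a matrix representation of `B_1 ⊗ ⋯ ⊗ B_d`. -/
def tensorRep {d : ℕ} {B : Fin d → Type*} [∀ a, Ring (B a)] [∀ a, Algebra R (B a)]
    {ι : Fin d → Type*} [∀ a, Fintype (ι a)] [∀ a, DecidableEq (ι a)]
    (φ : ∀ a, B a →ₐ[R] Matrix (ι a) (ι a) K) :
    (⨂[R] a, B a) →ₐ[R] Matrix (∀ a, ι a) (∀ a, ι a) K :=
  PiTensorProduct.liftAlgHom
    { toFun := fun b ↦ Matrix.of fun p q ↦ ∏ a, φ a (b a) (p a) (q a)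
      map_update_add' := by
        intro _ b a x y
        ext p q
        have key : ∀ z : B a, ∏ c, φ c (Function.update b a z c) (p c) (q c) =
            φ a z (p a) (q a) * ∏ c ∈ Finset.univ.erase a, φ c (b c) (p c) (q c) := by
          intro z
          rw [← Finset.mul_prod_erase _ _ (Finset.mem_univ a)]
          congr 1
          · simp
          · refine Finset.prod_congr rfl fun c hc ↦ ?_
            rw [Function.update_of_ne (Finset.ne_of_mem_erase hc)]
        have e : (‹DecidableEq (Fin d)› : DecidableEq (Fin d)) = instDecidableEqFin d :=
          Subsingleton.elim _ _
        subst e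
        simp only [Matrix.of_apply, Matrix.add_apply, key, map_add, add_mul]
      map_update_smul' := by
        intro _ b a r x
        ext p q
        have key : ∀ z : B a, ∏ c, φ c (Function.update b a z c) (p c) (q c) =
            φ a z (p a) (q a) * ∏ c ∈ Finset.univ.erase a, φ c (b c) (p c) (q c) := by
          intro z
          rw [← Finset.mul_prod_erase _ _ (Finset.mem_univ a)]
          congr 1
          · simp
          · refine Finset.prod_congr rfl fun c hc ↦ ?_
            rw [Function.update_of_ne (Finset.ne_of_mem_erase hc)]
        have e : (‹DecidableEq (Fin d)› : DecidableEq (Fin d)) = instDecidableEqFin d :=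
          Subsingleton.elim _ _
        subst e
        simp only [Matrix.of_apply, Matrix.smul_apply, key, map_smul, smul_mul_assoc] }
    (by
      ext p q
      simp only [MultilinearMap.coe_mk, Pi.one_apply, map_one, Matrix.of_apply, Matrix.one_apply]
      rw [Finset.prod_ite_zero]
      simp [funext_iff])
    (by
      intro x y
      ext p q
      simp only [MultilinearMap.coe_mk, Pi.mul_apply, map_mul, Matrix.of_apply, Matrix.mul_apply]
      rw [Finset.prod_univ_sum, Fintype.piFinset_univ]
      exact Finset.sum_congr rfl fun r _ ↦ Finset.prod_mul_distrib)

end Modules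

/-- The module `M_1 ⊗ ⋯ ⊗ M_d` of `H^μ`. -/
def heckeTensorRep {d n : ℕ} {K : Type*} [Field K] [Algebra GroundRing K] (μ : Comp d n)
    {ι : Fin d → Type*} [∀ a, Fintype (ι a)] [∀ a, DecidableEq (ι a)]
    (φ : ∀ a, Hecke (μ.1 a) →ₐ[GroundRing] Matrix (ι a) (ι a) K) :
    HeckeTensor μ →ₐ[GroundRing] Matrix (∀ a, ι a) (∀ a, ι a) K :=
  tensorRep φ

/-- The projection of the direct sum of matrix algebras onto its `μ`-th block. -/
def blockProj {d n : ℕ} (μ : Comp d n) :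
    BlockAlgebra d n →ₐ[GroundRing] Matrix (Orb μ) (Orb μ) (HeckeTensor μ) :=
  Pi.evalAlgHom GroundRing (fun ν : Comp d n ↦ Matrix (Orb ν) (Orb ν) (HeckeTensor ν)) μ

/-- The module `(M_1 ⊗ ⋯ ⊗ M_d)^{m_μ}` of `Y_{d,n}` over `K`: the algebra acts through the
isomorphism `Ψ` with the direct sum of matrix algebras, whose `μ`-th block `Mat_{m_μ}(H^μ)` acts on
columns of length `m_μ` with entries in the module `M_1 ⊗ ⋯ ⊗ M_d` of `H^μ`. -/
def yokonumaRep {d n : ℕ} {K : Type*} [Field K] [Algebra GroundRing K]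
    (Ψ : Yokonuma d n ≃ₐ[GroundRing] BlockAlgebra d n) (μ : Comp d n)
    {ι : Fin d → Type*} [∀ a, Fintype (ι a)] [∀ a, DecidableEq (ι a)]
    (φ : ∀ a, Hecke (μ.1 a) →ₐ[GroundRing] Matrix (ι a) (ι a) K) :
    Yokonuma d n →ₐ[GroundRing] Matrix (Orb μ × ∀ a, ι a) (Orb μ × ∀ a, ι a) K :=
  (Matrix.compAlgEquiv (Orb μ) (∀ a, ι a) K GroundRing).toAlgHom.comp
    ((heckeTensorRep μ φ).mapMatrix.comp ((blockProj μ).comp Ψ.toAlgHom))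

end

end YokonumaHecke

open YokonumaHecke

/-!
The first half of the argument concerns bases. By Matsumoto's theorem
(`prod_map_eq_of_isReducedWord`), the products of normalized generators along a reduced expression
of `w` depend on `w` only. Linear operators acting on a family indexed by the symmetric group as
left multiplication by `s_i`, deformed only at the descents where a colouring of the positions takes
equal values, satisfy the commutation and braid relations and a quadratic relation whose linear term
is switched on by the colouring (`ActsAs.comm`, `ActsAs.braid`, `ActsAs.quad`). With a constant
colouring this gives the regular representation of the Hecke algebra, hence the form `τ_m` and the
dual bases `(T̃_w)`, `(T̃_{w⁻¹})`. With the colouring `χ` it shows that explicit elements of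
`⊕ Mat(H^μ)` satisfy the relations of `Y_{d,n}`: the distinguished representatives of the cosets of
a Young subgroup cut out of each `w` a component `youngPart w χ` in that subgroup, and left
multiplication by `s_i` either leaves this component alone or multiplies it by an adjacent
transposition of a block (`psiGen_mul_blockElem`). This yields the homomorphism `psi`. It carries
the spanning family `g̃_w E_χ` of `Y_{d,n}` to the standard basis of the target without repetition,
hence is the isomorphism `Ψ`. The form `⊕ τ^μ ∘ Tr` transported along `Ψ` takes the value `1` or `0`
on `E_χ g̃_w`, and Fourier inversion on `(ℤ/d)^n` turns these values into those of the form of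
Chlouveraki and Poulain d'Andecy.

The second half is the theory of symmetric algebras, set up for a pair of dual families
(`IsSymmDual`). Where the Casimir element `∑ b_i b'_i` is invertible, averaging projections gives
semisimplicity (`IsSymmDual.isSemisimpleRing`), and Schur's lemma gives orthogonality of matrix
coefficients with nonzero constants (`IsSchurOrthogonal`). These constants are integral, because the
Casimir element is and acts on a simple module by a multiple of the constant, and they are the Schur
elements. Conversely, orthogonal representations whose characters expand the form are a complete
list of split simple modules (`IsSchurOrthogonal.isSplitIrrList`). For the Hecke algebra the Casimir
element is generically invertible, since it becomes `m!` at `u = 1`, `v = 0`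
(`exists_casimir_mul_eq`). Dual families, invertibility of the Casimir element, orthogonality and
expansions all pass to outer tensor products (where the constants multiply), to matrix algebras
(where they do not change), to direct products and along isomorphisms. Applied to `Ψ` this gives the
simple modules of `Y_{d,n}` and their Schur elements `s_{λ^1} ⋯ s_{λ^d}`.
-/

namespace YokonumaHecke

noncomputable section

/-! ### Reduced words in the symmetric group -/

section Combinatorics

variable {n : ℕ}

/-- The position `i` moved by the adjacent transposition `s_i = (i, i+1)`. -/
def lo (i : Fin (n - 1)) : Fin n := ⟨i.1, by omega⟩

/-- The position `i + 1` moved by the adjacent transposition `s_i = (i, i+1)`. -/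
def hi (i : Fin (n - 1)) : Fin n := ⟨i.1 + 1, by omega⟩

theorem lo_lt_hi (i : Fin (n - 1)) : lo i < hi i := Nat.lt_succ_self i.1

theorem lo_ne_hi (i : Fin (n - 1)) : lo i ≠ hi i := (lo_lt_hi i).ne

theorem adjSwap_lo (i : Fin (n - 1)) : adjSwap i (lo i) = hi i := Equiv.swap_apply_left _ _

theorem adjSwap_hi (i : Fin (n - 1)) : adjSwap i (hi i) = lo i := Equiv.swap_apply_right _ _

theorem adjSwap_of_ne {i : Fin (n - 1)} {a : Fin n} (h₁ : a ≠ lo i) (h₂ : a ≠ hi i) :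
    adjSwap i a = a := Equiv.swap_apply_of_ne_of_ne h₁ h₂

@[simp] theorem adjSwap_inv (i : Fin (n - 1)) : (adjSwap i)⁻¹ = adjSwap i := Equiv.swap_inv _ _

@[simp] theorem adjSwap_mul_self (i : Fin (n - 1)) : adjSwap i * adjSwap i = 1 :=
  Equiv.swap_mul_self _ _

@[simp] theorem adjSwap_mul_cancel (i : Fin (n - 1)) (w : Equiv.Perm (Fin n)) :
    adjSwap i * (adjSwap i * w) = w := by rw [← mul_assoc, adjSwap_mul_self, one_mul]

@[simp] theorem adjSwap_adjSwap (i : Fin (n - 1)) (a : Fin n) : adjSwap i (adjSwap i a) = a := by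
  rw [← Equiv.Perm.mul_apply, adjSwap_mul_self, Equiv.Perm.one_apply]

theorem inv_adjSwap_mul (i : Fin (n - 1)) (w : Equiv.Perm (Fin n)) (a : Fin n) :
    (adjSwap i * w)⁻¹ a = w⁻¹ (adjSwap i a) := by
  rw [mul_inv_rev, adjSwap_inv, Equiv.Perm.mul_apply]

theorem adjSwap_val (i : Fin (n - 1)) (a : Fin n) :
    (adjSwap i a).1 = if a.1 = i.1 then i.1 + 1 else if a.1 = i.1 + 1 then i.1 else a.1 := by
  rw [adjSwap, Equiv.swap_apply_def]
  simp only [Fin.ext_iff]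
  split_ifs <;> rfl

/-- `s_i` reverses the order of the pair `(i, i+1)` only. -/
theorem adjSwap_lt {i : Fin (n - 1)} {a b : Fin n} (hab : a < b) (h : ¬(a = lo i ∧ b = hi i)) :
    adjSwap i a < adjSwap i b := by
  rw [Fin.lt_def, adjSwap_val, adjSwap_val]
  simp only [Fin.ext_iff, lo, hi, Fin.lt_def] at *
  split_ifs <;> omega

theorem adjSwap_comm {i j : Fin (n - 1)} (h : i.1 + 1 < j.1 ∨ j.1 + 1 < i.1) :
    adjSwap i * adjSwap j = adjSwap j * adjSwap i := by
  ext a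
  simp only [Equiv.Perm.mul_apply, adjSwap_val]
  split_ifs <;> omega

theorem adjSwap_braid {i j : Fin (n - 1)} (h : i.1 + 1 = j.1) :
    adjSwap i * adjSwap j * adjSwap i = adjSwap j * adjSwap i * adjSwap j := by
  have hlj : lo j = hi i := Fin.ext h.symm
  have hj : adjSwap j = Equiv.swap (hi i) (hi j) := congrArg (Equiv.swap · (hi j)) hlj
  have hi' : adjSwap i = Equiv.swap (lo i) (hi i) := rfl
  have h₁ : lo i ≠ hi i := lo_ne_hi i
  have h₂ : hi j ≠ hi i := by rw [← hlj]; exact (lo_ne_hi j).symm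
  have h₃ : lo i ≠ hi j := ((lo_lt_hi i).trans (hlj ▸ lo_lt_hi j)).ne
  rw [hj, hi', Equiv.swap_mul_swap_mul_swap h₁ h₃, Equiv.swap_comm (hi j) (lo i),
    ← Equiv.swap_mul_swap_mul_swap h₂ h₃.symm, Equiv.swap_comm (hi j), Equiv.swap_comm (lo i)]

/-- `i` is a (left) descent of `w`: the entries `i` and `i + 1` are in the wrong order in the
one-line notation of `w`. -/
def IsDesc (i : Fin (n - 1)) (w : Equiv.Perm (Fin n)) : Prop := w⁻¹ (hi i) < w⁻¹ (lo i)

instance (i : Fin (n - 1)) (w : Equiv.Perm (Fin n)) : Decidable (IsDesc i w) :=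
  inferInstanceAs (Decidable (_ < _))

theorem not_isDesc_iff {i : Fin (n - 1)} {w : Equiv.Perm (Fin n)} :
    ¬IsDesc i w ↔ w⁻¹ (lo i) < w⁻¹ (hi i) := by
  have : w⁻¹ (lo i) ≠ w⁻¹ (hi i) := fun h ↦ lo_ne_hi i (w⁻¹.injective h)
  rw [IsDesc, not_lt, le_iff_lt_or_eq]
  tauto

theorem isDesc_adjSwap_mul {i : Fin (n - 1)} {w : Equiv.Perm (Fin n)} :
    IsDesc i (adjSwap i * w) ↔ ¬IsDesc i w := by
  rw [not_isDesc_iff, IsDesc, inv_adjSwap_mul, inv_adjSwap_mul, adjSwap_lo, adjSwap_hi]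

/-- The pairs of values in the wrong order in the one-line notation of `w`. -/
def inversions (w : Equiv.Perm (Fin n)) : Finset (Fin n × Fin n) :=
  {p | p.1 < p.2 ∧ w⁻¹ p.2 < w⁻¹ p.1}

theorem mem_inversions {w : Equiv.Perm (Fin n)} {p : Fin n × Fin n} :
    p ∈ inversions w ↔ p.1 < p.2 ∧ w⁻¹ p.2 < w⁻¹ p.1 := by
  simp [inversions]

theorem inversions_erase_adjSwap_mul (i : Fin (n - 1)) (w : Equiv.Perm (Fin n)) :
    (inversions (adjSwap i * w)).erase (lo i, hi i) =
      ((inversions w).erase (lo i, hi i)).map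
        ((adjSwap i).prodCongr (adjSwap i)).toEmbedding := by
  have key : ∀ a b : Fin n, (a < b ∧ ¬(a = lo i ∧ b = hi i)) →
      (adjSwap i a < adjSwap i b ∧ ¬(adjSwap i a = lo i ∧ adjSwap i b = hi i)) := by
    rintro a b ⟨hab, h⟩
    refine ⟨adjSwap_lt hab h, ?_⟩
    rintro ⟨h₁, h₂⟩
    have ha : a = hi i := by rw [← adjSwap_adjSwap i a, h₁, adjSwap_lo]
    have hb : b = lo i := by rw [← adjSwap_adjSwap i b, h₂, adjSwap_hi]
    subst ha hb
    exact lt_asymm hab (lo_lt_hi i)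
  ext ⟨a, b⟩
  simp only [Finset.mem_erase, Finset.mem_map_equiv, mem_inversions, inv_adjSwap_mul, ne_eq,
    Prod.mk.injEq, Equiv.prodCongr_symm, Equiv.prodCongr_apply, Prod.map_apply]
  have hs : (adjSwap i).symm = adjSwap i := adjSwap_inv i
  rw [hs]
  constructor
  · rintro ⟨h, hab, h'⟩
    have := key a b ⟨hab, h⟩
    exact ⟨this.2, this.1, h'⟩
  · rintro ⟨h, hab, h'⟩
    have := key _ _ ⟨hab, h⟩
    rw [adjSwap_adjSwap, adjSwap_adjSwap] at this
    exact ⟨this.2, this.1, h'⟩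

/-- Multiplication by `s_i` moves the inversions other than `(i, i+1)` bijectively, so the number of
inversions changes by one. -/
theorem card_inversions_of_not_isDesc {i : Fin (n - 1)} {w : Equiv.Perm (Fin n)}
    (h : ¬IsDesc i w) :
    (inversions (adjSwap i * w)).card = (inversions w).card + 1 := by
  have hmem : (lo i, hi i) ∈ inversions (adjSwap i * w) :=
    mem_inversions.2 ⟨lo_lt_hi i, isDesc_adjSwap_mul.2 h⟩
  have hnot : (lo i, hi i) ∉ inversions w := fun hm ↦ h (mem_inversions.1 hm).2
  rw [← Finset.card_erase_add_one hmem, inversions_erase_adjSwap_mul, Finset.card_map,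
    Finset.erase_eq_of_notMem hnot]

theorem card_inversions_of_isDesc {i : Fin (n - 1)} {w : Equiv.Perm (Fin n)}
    (h : IsDesc i w) :
    (inversions (adjSwap i * w)).card + 1 = (inversions w).card := by
  have h' : ¬IsDesc i (adjSwap i * w) := by rw [isDesc_adjSwap_mul, not_not]; exact h
  rw [← card_inversions_of_not_isDesc h', adjSwap_mul_cancel]

theorem perm_eq_one_of_strictMono {k : ℕ} {σ : Equiv.Perm (Fin k)} (h : StrictMono σ) : σ = 1 := by
  ext a
  have h' : h.orderIsoOfSurjective _ σ.surjective = OrderIso.refl _ := Subsingleton.elim _ _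
  exact congrArg Fin.val (DFunLike.congr_fun h' a)

theorem strictMono_of_lt_succ {k : ℕ} {α : Type*} [Preorder α] {f : Fin k → α}
    (h : ∀ b : Fin (k - 1), f (lo b) < f (hi b)) : StrictMono f := by
  cases k with
  | zero => exact fun a ↦ a.elim0
  | succ k => exact Fin.strictMono_iff_lt_succ.2 h

theorem exists_isDesc {w : Equiv.Perm (Fin n)} (hw : w ≠ 1) : ∃ i, IsDesc i w := by
  by_contra! hcon
  apply hw
  exact inv_eq_one.1 (perm_eq_one_of_strictMono
    (strictMono_of_lt_succ fun i ↦ not_isDesc_iff.1 (hcon i)))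

@[simp] theorem wordProd_nil : wordProd ([] : List (Fin (n - 1))) = 1 := rfl

@[simp] theorem wordProd_cons (i : Fin (n - 1)) (l : List (Fin (n - 1))) :
    wordProd (i :: l) = adjSwap i * wordProd l := by simp [wordProd]

theorem wordProd_append (l l' : List (Fin (n - 1))) :
    wordProd (l ++ l') = wordProd l * wordProd l' := by simp [wordProd]

theorem wordProd_reverse (l : List (Fin (n - 1))) : wordProd l.reverse = (wordProd l)⁻¹ := by
  induction l with
  | nil => simp
  | cons i l ih => simp [wordProd_append, ih]

theorem card_inversions_wordProd_le (l : List (Fin (n - 1))) :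
    (inversions (wordProd l)).card ≤ l.length := by
  induction l with
  | nil =>
    simp only [wordProd_nil, List.length_nil, nonpos_iff_eq_zero, Finset.card_eq_zero,
      Finset.eq_empty_iff_forall_notMem, mem_inversions]
    rintro p ⟨h, h'⟩
    exact lt_asymm h h'
  | cons i l ih =>
    rw [wordProd_cons, List.length_cons]
    by_cases h : IsDesc i (wordProd l)
    · have := card_inversions_of_isDesc h
      omega
    · have := card_inversions_of_not_isDesc h
      omega

theorem exists_word_length_eq (w : Equiv.Perm (Fin n)) :
    ∃ l : List (Fin (n - 1)), wordProd l = w ∧ l.length = (inversions w).card := by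
  induction hN : (inversions w).card generalizing w with
  | zero =>
    refine ⟨[], ?_, rfl⟩
    by_contra hw
    obtain ⟨i, hi⟩ := exists_isDesc (Ne.symm hw)
    have := card_inversions_of_isDesc hi
    omega
  | succ N ih =>
    have hw : w ≠ 1 := by
      rintro rfl
      have := card_inversions_wordProd_le ([] : List (Fin (n - 1)))
      rw [wordProd_nil, hN, List.length_nil] at this
      omega
    obtain ⟨i, hi⟩ := exists_isDesc hw
    have := card_inversions_of_isDesc hi
    obtain ⟨l, hl, hlen⟩ := ih (adjSwap i * w) (by omega)
    exact ⟨i :: l, by rw [wordProd_cons, hl, adjSwap_mul_cancel], by rw [List.length_cons, hlen]⟩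

/-- The length of a permutation is its number of inversions. -/
theorem isReducedWord_iff {l : List (Fin (n - 1))} :
    IsReducedWord l ↔ l.length = (inversions (wordProd l)).card := by
  constructor
  · intro h
    obtain ⟨l', hl', hlen⟩ := exists_word_length_eq (wordProd l)
    exact le_antisymm ((h l' hl').trans hlen.le) (card_inversions_wordProd_le l)
  · intro h l' hl'
    rw [h, ← hl']
    exact card_inversions_wordProd_le l'

theorem wordProd_redWord (w : Equiv.Perm (Fin n)) : wordProd (redWord w) = w :=
  (exists_reduced w).choose_spec.1

theorem isReducedWord_redWord (w : Equiv.Perm (Fin n)) : IsReducedWord (redWord w) :=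
  (exists_reduced w).choose_spec.2

theorem len_eq (w : Equiv.Perm (Fin n)) : len w = (inversions w).card := by
  rw [len, isReducedWord_iff.1 (isReducedWord_redWord w), wordProd_redWord]

theorem isReducedWord_iff_len {l : List (Fin (n - 1))} :
    IsReducedWord l ↔ l.length = len (wordProd l) := by
  rw [isReducedWord_iff, len_eq]

theorem len_of_not_isDesc {i : Fin (n - 1)} {w : Equiv.Perm (Fin n)} (h : ¬IsDesc i w) :
    len (adjSwap i * w) = len w + 1 := by
  rw [len_eq, len_eq, card_inversions_of_not_isDesc h]

theorem len_of_isDesc {i : Fin (n - 1)} {w : Equiv.Perm (Fin n)} (h : IsDesc i w) :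
    len (adjSwap i * w) + 1 = len w := by
  rw [len_eq, len_eq, card_inversions_of_isDesc h]

theorem len_inv (w : Equiv.Perm (Fin n)) : len w⁻¹ = len w := by
  have key : ∀ w : Equiv.Perm (Fin n), len w⁻¹ ≤ len w := by
    intro w
    have h := card_inversions_wordProd_le (redWord w).reverse
    rwa [wordProd_reverse, wordProd_redWord, List.length_reverse, ← len_eq] at h
  refine le_antisymm (key w) ?_
  simpa using key w⁻¹

/-- Induction on the length of a permutation, from the left. -/
theorem perm_induction {P : Equiv.Perm (Fin n) → Prop} (one : P 1)
    (step : ∀ i w, ¬IsDesc i w → P w → P (adjSwap i * w)) (w : Equiv.Perm (Fin n)) : P w := by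
  induction hN : len w generalizing w with
  | zero =>
    by_cases hw : w = 1
    · rwa [hw]
    · obtain ⟨i, hi⟩ := exists_isDesc hw
      have := len_of_isDesc hi
      omega
  | succ N ih =>
    by_cases hw : w = 1
    · rwa [hw]
    · obtain ⟨i, hi⟩ := exists_isDesc hw
      have hlen := len_of_isDesc hi
      have := step i (adjSwap i * w) (by rw [isDesc_adjSwap_mul, not_not]; exact hi)
        (ih _ (by omega))
      rwa [adjSwap_mul_cancel] at this

theorem isReducedWord_cons {i : Fin (n - 1)} {l : List (Fin (n - 1))} (h : IsReducedWord (i :: l)) :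
    IsReducedWord l ∧ IsDesc i (adjSwap i * wordProd l) := by
  rw [isReducedWord_iff_len, List.length_cons, wordProd_cons] at h
  have hle := card_inversions_wordProd_le l
  rw [← len_eq] at hle
  rw [isReducedWord_iff_len, isDesc_adjSwap_mul]
  by_cases hd : IsDesc i (wordProd l)
  · have := len_of_isDesc hd
    omega
  · have := len_of_not_isDesc hd
    exact ⟨by omega, hd⟩

theorem IsReducedWord.cons {i : Fin (n - 1)} {l : List (Fin (n - 1))} (h : IsReducedWord l)
    (hd : ¬IsDesc i (wordProd l)) : IsReducedWord (i :: l) := by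
  rw [isReducedWord_iff_len] at h ⊢
  rw [List.length_cons, wordProd_cons, len_of_not_isDesc hd, h]

/-! ### Matsumoto's theorem -/

variable {M : Type*} [Monoid M] {f : Fin (n - 1) → M}

/-- If two reduced words begin with the letters `i < j`, both can be joined to words beginning with
the longest element of the parabolic subgroup generated by `s_i` and `s_j`. -/
theorem prod_map_eq_of_lt
    (hcomm : ∀ i j : Fin (n - 1), i.1 + 1 < j.1 → f i * f j = f j * f i)
    (hbraid : ∀ i j : Fin (n - 1), i.1 + 1 = j.1 → f i * f j * f i = f j * f i * f j)
    {a b : List (Fin (n - 1))} {i j : Fin (n - 1)} (hij : i < j)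
    (ha : IsReducedWord (i :: a)) (hb : IsReducedWord (j :: b))
    (hw : wordProd (i :: a) = wordProd (j :: b))
    (iha : ∀ c, IsReducedWord c → wordProd c = wordProd a → (c.map f).prod = (a.map f).prod)
    (ihb : ∀ c, IsReducedWord c → wordProd c = wordProd b → (c.map f).prod = (b.map f).prod) :
    ((i :: a).map f).prod = ((j :: b).map f).prod := by
  obtain ⟨-, hdi⟩ := isReducedWord_cons ha
  obtain ⟨-, hdj⟩ := isReducedWord_cons hb
  rw [wordProd_cons, wordProd_cons] at hw
  rw [← hw] at hdj
  have hij' : i.1 < j.1 := hij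
  have ha' : wordProd a = adjSwap i * (adjSwap i * wordProd a) := by rw [adjSwap_mul_cancel]
  have hb' : wordProd b = adjSwap j * (adjSwap i * wordProd a) := by rw [hw, adjSwap_mul_cancel]
  generalize adjSwap i * wordProd a = w at *
  clear hw
  by_cases h : i.1 + 1 = j.1
  · have hlj : lo j = hi i := Fin.ext h.symm
    have h₁ : adjSwap i (hi j) = hi j :=
      adjSwap_of_ne (by simp [Fin.ext_iff, lo, hi]; omega) (by simp [Fin.ext_iff, hi]; omega)
    have h₂ : adjSwap j (lo i) = lo i :=
      adjSwap_of_ne (by simp [Fin.ext_iff, lo]; omega) (by simp [Fin.ext_iff, lo, hi]; omega)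
    have hbr := congrArg (· * w) (adjSwap_braid h)
    simp only [mul_assoc] at hbr
    set c := redWord (adjSwap i * (adjSwap j * (adjSwap i * w))) with hc
    have hcw : wordProd c = adjSwap i * (adjSwap j * (adjSwap i * w)) := wordProd_redWord _
    have hcr : IsReducedWord c := isReducedWord_redWord _
    have hlt : w⁻¹ (hi j) < w⁻¹ (lo i) := by
      simp only [IsDesc, hlj] at hdi hdj
      exact hdj.trans hdi
    have r₁ : IsReducedWord (i :: c) := hcr.cons (by
      rw [hcw, isDesc_adjSwap_mul, not_not, IsDesc, inv_adjSwap_mul, inv_adjSwap_mul,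
        inv_adjSwap_mul, inv_adjSwap_mul, ← hlj, adjSwap_lo, h₁, h₂, adjSwap_lo, ← hlj]
      exact hdj)
    have r₂ : IsReducedWord (j :: c) := hcr.cons (by
      rw [hcw, hbr, isDesc_adjSwap_mul, not_not, IsDesc, inv_adjSwap_mul, inv_adjSwap_mul,
        inv_adjSwap_mul, inv_adjSwap_mul, hlj, adjSwap_hi, h₁, h₂, adjSwap_hi, hlj]
      exact hdi)
    have r₃ : IsReducedWord (j :: i :: c) := r₁.cons (by
      rw [wordProd_cons, hcw, adjSwap_mul_cancel, isDesc_adjSwap_mul, not_not, IsDesc,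
        inv_adjSwap_mul, inv_adjSwap_mul, h₁, hlj, adjSwap_hi]
      exact hlt)
    have r₄ : IsReducedWord (i :: j :: c) := r₂.cons (by
      rw [wordProd_cons, hcw, hbr, adjSwap_mul_cancel, isDesc_adjSwap_mul, not_not, IsDesc,
        inv_adjSwap_mul, inv_adjSwap_mul, h₂, ← hlj, adjSwap_lo]
      exact hlt)
    have e₁ := iha _ r₃ (by
      rw [wordProd_cons, wordProd_cons, hcw, adjSwap_mul_cancel, adjSwap_mul_cancel, ha'])
    have e₂ := ihb _ r₄ (by
      rw [wordProd_cons, wordProd_cons, hcw, hbr, adjSwap_mul_cancel, adjSwap_mul_cancel, hb'])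
    simp only [List.map_cons, List.prod_cons] at e₁ e₂ ⊢
    rw [← e₁, ← e₂, ← mul_assoc, ← mul_assoc, ← mul_assoc, ← mul_assoc, hbraid i j h]
  · have h₁ : adjSwap i (hi j) = hi j :=
      adjSwap_of_ne (by simp [Fin.ext_iff, lo, hi]; omega) (by simp [Fin.ext_iff, hi]; omega)
    have h₂ : adjSwap i (lo j) = lo j :=
      adjSwap_of_ne (by simp [Fin.ext_iff, lo]; omega) (by simp [Fin.ext_iff, lo, hi]; omega)
    have h₃ : adjSwap j (lo i) = lo i :=
      adjSwap_of_ne (by simp [Fin.ext_iff, lo]; omega) (by simp [Fin.ext_iff, lo, hi]; omega)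
    have h₄ : adjSwap j (hi i) = hi i :=
      adjSwap_of_ne (by simp [Fin.ext_iff, lo, hi]; omega) (by simp [Fin.ext_iff, hi]; omega)
    have hlt : i.1 + 1 < j.1 := by omega
    have hbr := congrArg (· * w) (adjSwap_comm (i := i) (j := j) (Or.inl hlt))
    simp only [mul_assoc] at hbr
    set c := redWord (adjSwap j * (adjSwap i * w)) with hc
    have hcw : wordProd c = adjSwap j * (adjSwap i * w) := wordProd_redWord _
    have hcr : IsReducedWord c := isReducedWord_redWord _
    have r₁ : IsReducedWord (j :: c) := hcr.cons (by
      rw [hcw, isDesc_adjSwap_mul, not_not, IsDesc, inv_adjSwap_mul, inv_adjSwap_mul, h₁, h₂]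
      exact hdj)
    have r₂ : IsReducedWord (i :: c) := hcr.cons (by
      rw [hcw, ← hbr, isDesc_adjSwap_mul, not_not, IsDesc, inv_adjSwap_mul, inv_adjSwap_mul, h₃, h₄]
      exact hdi)
    have e₁ := iha _ r₁ (by rw [wordProd_cons, hcw, adjSwap_mul_cancel, ha'])
    have e₂ := ihb _ r₂ (by rw [wordProd_cons, hcw, ← hbr, adjSwap_mul_cancel, hb'])
    simp only [List.map_cons, List.prod_cons] at e₁ e₂ ⊢
    rw [← e₁, ← e₂, ← mul_assoc, ← mul_assoc, hcomm i j hlt]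

/-- **Matsumoto's theorem** for the symmetric group: products satisfying the braid relations agree
along all reduced words of a permutation. -/
theorem prod_map_eq_of_isReducedWord
    (hcomm : ∀ i j : Fin (n - 1), i.1 + 1 < j.1 → f i * f j = f j * f i)
    (hbraid : ∀ i j : Fin (n - 1), i.1 + 1 = j.1 → f i * f j * f i = f j * f i * f j)
    {l l' : List (Fin (n - 1))} (hl : IsReducedWord l) (hl' : IsReducedWord l')
    (h : wordProd l = wordProd l') : (l.map f).prod = (l'.map f).prod := by
  induction hN : l.length generalizing l l' with
  | zero =>
    have h0 : l'.length = 0 := by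
      rw [isReducedWord_iff.1 hl', ← h, ← isReducedWord_iff.1 hl, hN]
    rw [List.length_eq_zero_iff.1 hN, List.length_eq_zero_iff.1 h0]
  | succ N ih =>
    have hN' : l'.length = N + 1 := by
      rw [isReducedWord_iff.1 hl', ← h, ← isReducedWord_iff.1 hl, hN]
    obtain ⟨i, a, rfl⟩ := List.exists_cons_of_length_eq_add_one hN
    obtain ⟨j, b, rfl⟩ := List.exists_cons_of_length_eq_add_one hN'
    have ra := (isReducedWord_cons hl).1
    have rb := (isReducedWord_cons hl').1
    have la : a.length = N := by simpa using hN
    have lb : b.length = N := by simpa using hN'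
    have iha : ∀ c, IsReducedWord c → wordProd c = wordProd a → (c.map f).prod = (a.map f).prod :=
      fun c hc hca ↦ (ih ra hc hca.symm la).symm
    have ihb : ∀ c, IsReducedWord c → wordProd c = wordProd b → (c.map f).prod = (b.map f).prod :=
      fun c hc hcb ↦ (ih rb hc hcb.symm lb).symm
    rcases lt_trichotomy i j with hij | rfl | hij
    · exact prod_map_eq_of_lt hcomm hbraid hij hl hl' h iha ihb
    · rw [List.map_cons, List.map_cons, List.prod_cons, List.prod_cons]
      rw [wordProd_cons, wordProd_cons] at h
      rw [ihb a ra (mul_left_cancel h)]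
    · exact (prod_map_eq_of_lt hcomm hbraid hij hl' hl h.symm ihb iha).symm

/-- A family of elements of a monoid indexed by the adjacent transpositions and satisfying the
braid relations. -/
structure IsBraided (f : Fin (n - 1) → M) : Prop where
  comm : ∀ i j : Fin (n - 1), i.1 + 1 < j.1 → f i * f j = f j * f i
  braid : ∀ i j : Fin (n - 1), i.1 + 1 = j.1 → f i * f j * f i = f j * f i * f j

/-- The product of a family of elements of a monoid along the chosen reduced word of `w`. -/
def braidLift (f : Fin (n - 1) → M) (w : Equiv.Perm (Fin n)) : M := ((redWord w).map f).prod

namespace IsBraided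

theorem prod_eq (hf : IsBraided f) {l : List (Fin (n - 1))} (hl : IsReducedWord l) :
    (l.map f).prod = braidLift f (wordProd l) :=
  prod_map_eq_of_isReducedWord hf.comm hf.braid hl (isReducedWord_redWord _)
    (wordProd_redWord _).symm

theorem braidLift_one (hf : IsBraided f) : braidLift f 1 = 1 := by
  have := hf.prod_eq (l := []) (fun l' _ ↦ Nat.zero_le _)
  simpa using this.symm

theorem mul_braidLift (hf : IsBraided f) {i : Fin (n - 1)} {w : Equiv.Perm (Fin n)}
    (h : ¬IsDesc i w) : f i * braidLift f w = braidLift f (adjSwap i * w) := by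
  have := hf.prod_eq (l := i :: redWord w)
    ((isReducedWord_redWord w).cons (by rwa [wordProd_redWord]))
  rw [wordProd_cons, wordProd_redWord, List.map_cons, List.prod_cons] at this
  exact this

theorem braidLift_mul (hf : IsBraided f) {i : Fin (n - 1)} {w : Equiv.Perm (Fin n)}
    (h : ¬IsDesc i w⁻¹) : braidLift f w * f i = braidLift f (w * adjSwap i) := by
  have hp : wordProd (redWord w ++ [i]) = w * adjSwap i := by
    rw [wordProd_append, wordProd_redWord, wordProd_cons, wordProd_nil, mul_one]
  have := hf.prod_eq (l := redWord w ++ [i]) (by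
    rw [isReducedWord_iff_len, hp, List.length_append, ← len_inv (w * adjSwap i), mul_inv_rev,
      adjSwap_inv, len_of_not_isDesc h, len_inv]
    rfl)
  rw [hp, List.map_append, List.prod_append, List.map_singleton, List.prod_singleton] at this
  exact this

end IsBraided

/-! ### Modules on which adjacent transpositions act by a deformation of left multiplication -/

section Deformed

variable {R V C : Type*} [CommRing R] [AddCommGroup V] [Module R V] [DecidableEq C]

/-- The coefficient by which the action of `T̃_i` on the basis element of `w` deviates from left
multiplication by `s_i`: it is `q` if `i` is a descent of `w` and the entries `i` and `i + 1` of
`w` stand at positions of the same colour, and `0` otherwise. -/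
def descCoeff (q : R) (c : Fin n → C) (a b : Fin n) : R := if b < a ∧ c a = c b then q else 0

/-- The linear map `L` acts on the family `e` as the `i`-th generator of the Hecke algebra acts on
the standard basis, the quadratic relation being deformed only where the colours agree. -/
def ActsAs (q : R) (c : Fin n → C) (e : Equiv.Perm (Fin n) → V) (i : Fin (n - 1)) (L : V →ₗ[R] V) :
    Prop :=
  ∀ w, L (e w) = e (adjSwap i * w) + descCoeff q c (w⁻¹ (lo i)) (w⁻¹ (hi i)) • e w

variable {q : R} {c : Fin n → C} {e : Equiv.Perm (Fin n) → V}

theorem ActsAs.comm {i j : Fin (n - 1)} (h : i.1 + 1 < j.1) {L L' : V →ₗ[R] V}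
    (hL : ActsAs q c e i L) (hL' : ActsAs q c e j L') (w : Equiv.Perm (Fin n)) :
    L (L' (e w)) = L' (L (e w)) := by
  have h₁ : adjSwap i (hi j) = hi j :=
    adjSwap_of_ne (by simp [Fin.ext_iff, lo, hi]; omega) (by simp [Fin.ext_iff, hi]; omega)
  have h₂ : adjSwap i (lo j) = lo j :=
    adjSwap_of_ne (by simp [Fin.ext_iff, lo]; omega) (by simp [Fin.ext_iff, lo, hi]; omega)
  have h₃ : adjSwap j (lo i) = lo i :=
    adjSwap_of_ne (by simp [Fin.ext_iff, lo]; omega) (by simp [Fin.ext_iff, lo, hi]; omega)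
  have h₄ : adjSwap j (hi i) = hi i :=
    adjSwap_of_ne (by simp [Fin.ext_iff, lo, hi]; omega) (by simp [Fin.ext_iff, hi]; omega)
  rw [hL' w, hL w, map_add, map_add, map_smul, map_smul, hL, hL', hL, hL']
  simp only [inv_adjSwap_mul, h₁, h₂, h₃, h₄, ← mul_assoc, adjSwap_comm (Or.inl h)]
  module

/-- The identities between the coefficients for three distinct positions on which the braid relation
rests, in any commutative ring of parameters and for any colouring. -/
theorem descCoeff_identity (q : R) (c : Fin n → C) {x y z : Fin n} (hxy : x ≠ y) (hyz : y ≠ z)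
    (hxz : x ≠ z) :
    descCoeff q c x z * descCoeff q c y x + descCoeff q c x y * descCoeff q c y z =
      descCoeff q c y z * descCoeff q c x z ∧
    descCoeff q c x y * descCoeff q c x z =
      descCoeff q c x z * descCoeff q c z y + descCoeff q c y z * descCoeff q c x y ∧
    descCoeff q c x y * descCoeff q c y z * descCoeff q c x y =
      descCoeff q c y z * descCoeff q c x y * descCoeff q c y z := by
  simp only [descCoeff]
  generalize c x = X, c y = Y, c z = Z
  rcases lt_or_gt_of_ne hxy with a | a <;> rcases lt_or_gt_of_ne hyz with b | b <;>
    rcases lt_or_gt_of_ne hxz with d | d <;>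
    first
    | exact absurd d (a.trans b).not_gt
    | exact absurd d (b.trans a).not_gt
    | (simp only [a, b, d, a.not_gt, b.not_gt, d.not_gt, true_and, false_and, if_false]
       by_cases h₁ : X = Y
       · subst h₁
         by_cases h₂ : X = Z
         · subst h₂; simp
         · simp [h₂, Ne.symm h₂]
       · by_cases h₂ : Y = Z
         · subst h₂; simp [h₁, Ne.symm h₁]
         · simp [h₁, h₂, Ne.symm h₁, Ne.symm h₂])

theorem ActsAs.braid {i j : Fin (n - 1)} (h : i.1 + 1 = j.1) {L L' : V →ₗ[R] V}
    (hL : ActsAs q c e i L) (hL' : ActsAs q c e j L') (w : Equiv.Perm (Fin n)) :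
    L (L' (L (e w))) = L' (L (L' (e w))) := by
  have hlj : lo j = hi i := Fin.ext h.symm
  have h₁ : adjSwap i (hi j) = hi j :=
    adjSwap_of_ne (by simp [Fin.ext_iff, lo, hi]; omega) (by simp [Fin.ext_iff, hi]; omega)
  have h₂ : adjSwap j (lo i) = lo i :=
    adjSwap_of_ne (by simp [Fin.ext_iff, lo]; omega) (by simp [Fin.ext_iff, lo, hi]; omega)
  have h₃ : adjSwap j (hi i) = hi j := by rw [← hlj, adjSwap_lo]
  have h₄ : adjSwap j (hi j) = hi i := by rw [← hlj, adjSwap_hi]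
  have hbr := congrArg (· * w) (adjSwap_braid h)
  simp only [mul_assoc] at hbr
  have hxy : w⁻¹ (lo i) ≠ w⁻¹ (hi i) := fun h' ↦ lo_ne_hi i (w⁻¹.injective h')
  have hyz : w⁻¹ (hi i) ≠ w⁻¹ (hi j) := fun h' ↦ lo_ne_hi j (hlj.trans (w⁻¹.injective h'))
  have hxz : w⁻¹ (lo i) ≠ w⁻¹ (hi j) := fun h' ↦ by
    have := congrArg Fin.val (w⁻¹.injective h')
    simp only [lo, hi] at this
    omega
  -- the two sides are compared at the basis elements of `s_i w`, `s_j w` and `w`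
  obtain ⟨k₁, k₂, k₃⟩ := descCoeff_identity q c hxy hyz hxz
  unfold ActsAs at hL hL'
  simp only [hL, hL', map_add, map_smul, inv_adjSwap_mul, h₁, h₂, h₃, h₄, hlj, adjSwap_lo,
    adjSwap_hi, hbr, adjSwap_mul_cancel]
  generalize descCoeff q c (w⁻¹ (lo i)) (w⁻¹ (hi i)) = dxy at *
  generalize descCoeff q c (w⁻¹ (hi i)) (w⁻¹ (lo i)) = dyx at *
  generalize descCoeff q c (w⁻¹ (lo i)) (w⁻¹ (hi j)) = dxz at *
  generalize descCoeff q c (w⁻¹ (hi i)) (w⁻¹ (hi j)) = dyz at *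
  generalize descCoeff q c (w⁻¹ (hi j)) (w⁻¹ (hi i)) = dzy at *
  linear_combination (norm := module) k₁ • e (adjSwap i * w) + k₂ • e (adjSwap j * w) + k₃ • e w

/-- The quadratic relation; its linear term is present only where the colours agree. -/
theorem ActsAs.quad {i : Fin (n - 1)} {L : V →ₗ[R] V} (hL : ActsAs q c e i L)
    (w : Equiv.Perm (Fin n)) :
    L (L (e w)) = e w +
      (if c (w⁻¹ (lo i)) = c (w⁻¹ (hi i)) then q else 0) • L (e w) := by
  have hxy : w⁻¹ (lo i) ≠ w⁻¹ (hi i) := fun h' ↦ lo_ne_hi i (w⁻¹.injective h')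
  unfold ActsAs at hL
  simp only [hL, map_add, map_smul, inv_adjSwap_mul, adjSwap_lo, adjSwap_hi, adjSwap_mul_cancel,
    descCoeff]
  generalize w⁻¹ (lo i) = x, w⁻¹ (hi i) = y at *
  by_cases hc : c x = c y
  · rcases lt_or_gt_of_ne hxy with h | h
    · simp [hc, h, h.not_gt]
    · simp [hc, h, h.not_gt]
  · simp [hc, Ne.symm hc]

end Deformed

end Combinatorics

/-! ### Symmetric algebras: dual bases and the Casimir element -/

section Symmetric

variable {R A : Type*} [CommRing R] [Ring A] [Algebra R A]
variable {X : Type*} [Fintype X]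

/-- The families `b` and `b'` are dual to each other for the trace function `f`. The identity
`x = ∑ f (x b'_i) b_i` replaces the requirement that `b` be a basis: it passes to tensor products,
matrix algebras and direct products without any linear independence being checked. -/
structure IsSymmDual (f : A →ₗ[R] R) (b b' : X → A) : Prop where
  trace : ∀ x y, f (x * y) = f (y * x)
  sum_left : ∀ x, ∑ i, f (x * b' i) • b i = x

/-- The Casimir element `∑ b_i b'_i` of a pair of dual families. -/
def casimir (b b' : X → A) : A := ∑ i, b i * b' i

/-- A trace function for which a spanning family and another family are orthonormal to each
other. -/
theorem IsSymmDual.of_span [DecidableEq X] {f : A →ₗ[R] R} {b b' : X → A}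
    (hspan : Submodule.span R (Set.range b) = ⊤) (htrace : ∀ i j, f (b i * b j) = f (b j * b i))
    (h : ∀ i j, f (b i * b' j) = if i = j then 1 else 0) : IsSymmDual f b b' where
  trace x y := by
    have e : (LinearMap.mul R A).compr₂ f = ((LinearMap.mul R A).compr₂ f).flip := by
      refine LinearMap.ext_on hspan ?_
      rintro _ ⟨i, rfl⟩
      refine LinearMap.ext_on hspan ?_
      rintro _ ⟨j, rfl⟩
      exact htrace i j
    exact LinearMap.congr_fun₂ e x y
  sum_left x := by
    have e : ∑ i, ((f.comp (LinearMap.mulRight R (b' i))).smulRight (b i)) = LinearMap.id := by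
      refine LinearMap.ext_on hspan ?_
      rintro _ ⟨j, rfl⟩
      simp [h]
    simpa using LinearMap.congr_fun e x

namespace IsSymmDual

variable {f : A →ₗ[R] R} {b b' : X → A} (h : IsSymmDual f b b')
include h

theorem ext_left {x y : A} (hxy : ∀ z, f (x * z) = f (y * z)) : x = y := by
  rw [← h.sum_left x, ← h.sum_left y]
  simp only [hxy]

theorem sum_right (y : A) : ∑ i, f (b i * y) • b' i = y := by
  refine h.ext_left fun x ↦ ?_
  rw [h.trace, h.trace y]
  conv_rhs => rw [← h.sum_left x]
  simp only [Finset.mul_sum, Finset.sum_mul, map_sum, mul_smul_comm, smul_mul_assoc, map_smul,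
    smul_eq_mul]
  exact Finset.sum_congr rfl fun i _ ↦ mul_comm _ _

theorem isSymmetrizing : IsSymmetrizing f := by
  refine ⟨h.trace, LinearMap.IsPerfPair.mk ⟨?_, ?_⟩ ⟨?_, ?_⟩⟩
  · intro x y hxy
    exact h.ext_left fun z ↦ LinearMap.congr_fun hxy z
  · intro g
    refine ⟨∑ i, g (b' i) • b i, LinearMap.ext fun y ↦ ?_⟩
    conv_rhs => rw [← h.sum_right y]
    simp [mul_comm]
  · intro x y hxy
    refine h.ext_left fun z ↦ ?_
    rw [h.trace, h.trace y]
    exact LinearMap.congr_fun hxy z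
  · intro g
    refine ⟨∑ i, g (b i) • b' i, LinearMap.ext fun y ↦ ?_⟩
    conv_rhs => rw [← h.sum_left y]
    simp [mul_comm]

/-- The Casimir tensor `∑ b_i ⊗ b'_i` commutes with `A`, tested on an arbitrary bilinear map. -/
theorem sum_mul_comm {N : Type*} [AddCommGroup N] [Module R N] (F : A →ₗ[R] A →ₗ[R] N) (a : A) :
    ∑ i, F (a * b i) (b' i) = ∑ i, F (b i) (b' i * a) := by
  have e₁ : ∀ i, F (a * b i) (b' i) = ∑ j, f (b' j * a * b i) • F (b j) (b' i) := by
    intro i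
    conv_lhs => rw [← h.sum_left (a * b i)]
    simp only [map_sum, map_smul, LinearMap.sum_apply, LinearMap.smul_apply]
    refine Finset.sum_congr rfl fun j _ ↦ ?_
    rw [h.trace, mul_assoc]
  have e₂ : ∀ j, F (b j) (b' j * a) = ∑ i, f (b' j * a * b i) • F (b j) (b' i) := by
    intro j
    conv_lhs => rw [← h.sum_right (b' j * a)]
    simp only [map_sum, map_smul]
    refine Finset.sum_congr rfl fun i _ ↦ ?_
    rw [h.trace]
  simp only [e₁, e₂]
  exact Finset.sum_comm

/-- The Casimir tensor `∑ b_i ⊗ b'_i` is symmetric, because the form is a trace function. -/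
theorem sum_swap {N : Type*} [AddCommGroup N] [Module R N] (F : A →ₗ[R] A →ₗ[R] N) :
    ∑ i, F (b i) (b' i) = ∑ i, F (b' i) (b i) := by
  have e₁ : ∀ i, F (b' i) (b i) = ∑ j, f (b' i * b' j) • F (b j) (b i) := by
    intro i
    conv_lhs => rw [← h.sum_left (b' i)]
    simp only [map_sum, map_smul, LinearMap.sum_apply, LinearMap.smul_apply]
  have e₂ : ∀ j, F (b j) (b' j) = ∑ i, f (b' i * b' j) • F (b j) (b i) := by
    intro j
    conv_lhs => rw [← h.sum_left (b' j)]
    simp only [map_sum, map_smul]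
    refine Finset.sum_congr rfl fun i _ ↦ ?_
    rw [h.trace]
  simp only [e₁, e₂]
  exact Finset.sum_comm

theorem casimir_comm (a : A) : a * casimir b b' = casimir b b' * a := by
  have := h.sum_mul_comm (LinearMap.mul R A) a
  simpa [casimir, Finset.mul_sum, Finset.sum_mul, mul_assoc] using this

theorem finite : Module.Finite R A := by
  classical
  refine ⟨⟨Finset.univ.image b, ?_⟩⟩
  rw [Finset.coe_image, Finset.coe_univ, Set.image_univ, eq_top_iff]
  rintro x -
  rw [← h.sum_left x]
  exact Submodule.sum_mem _ fun i _ ↦ Submodule.smul_mem _ _ (Submodule.subset_span ⟨i, rfl⟩)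

end IsSymmDual

end Symmetric

/-! ### Semisimplicity over a field inverting the Casimir element -/

section Semisimple

variable {R A K : Type*} [CommRing R] [Ring A] [Algebra R A] [Field K] [Algebra R K]
variable {X : Type*} [Fintype X] {f : A →ₗ[R] R} {b b' : X → A}

variable (R K) in
/-- The Casimir element becomes invertible over the field `K`. -/
def CasimirInvertible (b b' : X → A) : Prop :=
  ∃ (z' : A) (r : R), algebraMap R K r ≠ 0 ∧ casimir b b' * z' = r • 1

/-- A projection onto a submodule, averaged over the dual bases, has the Casimir element in place
of the identity on that submodule; hence its kernel is a complement as soon as the Casimir element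
is invertible. -/
theorem IsSymmDual.isSemisimpleRing (h : IsSymmDual f b b') (hz : CasimirInvertible R K b b') :
    IsSemisimpleRing (K ⊗[R] A) := by
  obtain ⟨z', r, hr, hz⟩ := hz
  let inc : A →ₐ[R] K ⊗[R] A := Algebra.TensorProduct.includeRight
  have hinc : ∀ (k : K) (a : A), k ⊗ₜ[R] a = k • inc a := fun k a ↦ by
    simp [inc, TensorProduct.smul_tmul']
  let ζ : K ⊗[R] A := (algebraMap R K r)⁻¹ • inc z'
  have hζ : ζ * inc (casimir b b') = 1 := by
    rw [smul_mul_assoc, ← map_mul, h.casimir_comm, hz, map_smul, map_one,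
      ← algebraMap_smul K r (1 : K ⊗[R] A), smul_smul, inv_mul_cancel₀ hr, one_smul]
  rw [IsSemisimpleRing, isSemisimpleModule_iff]
  refine ⟨fun N ↦ ?_⟩
  obtain ⟨p, hp⟩ := (N.restrictScalars K).subtype.exists_leftInverse_of_injective
    (LinearMap.ker_eq_bot.2 (N.restrictScalars K).injective_subtype)
  -- a `K`-linear projection onto `N`, to be averaged
  let p' : K ⊗[R] A →ₗ[K] K ⊗[R] A := (N.restrictScalars K).subtype ∘ₗ p
  have hp' : ∀ x ∈ N, p' x = x := fun x hx ↦
    congrArg Subtype.val (LinearMap.congr_fun hp ⟨x, hx⟩)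
  have hp'N : ∀ x, p' x ∈ N := fun x ↦ (p x).2
  let P₀ : K ⊗[R] A →ₗ[K] K ⊗[R] A := ∑ i,
    LinearMap.mulLeft K (inc (b i)) ∘ₗ p' ∘ₗ LinearMap.mulLeft K (inc (b' i))
  have hP₀ : ∀ x, P₀ x = ∑ i, inc (b i) * p' (inc (b' i) * x) := fun x ↦ by
    simp [P₀]
  have hinv : ∀ (a : A) x, P₀ (inc a * x) = inc a * P₀ x := by
    intro a x
    let F : A →ₗ[R] A →ₗ[R] K ⊗[R] A := LinearMap.mk₂ R
      (fun y z ↦ inc y * p' (inc z * x)) (by simp [add_mul]) (by simp) (by simp [mul_add, add_mul])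
      (by
        intro c y z
        rw [map_smul, smul_mul_assoc, LinearMap.map_smul_of_tower, mul_smul_comm])
    have := h.sum_mul_comm F a
    simp only [F, LinearMap.mk₂_apply, map_mul] at this
    rw [hP₀, hP₀, Finset.mul_sum]
    simp only [mul_assoc] at this ⊢
    exact this.symm
  have hB : ∀ y x, P₀ (y * x) = y * P₀ x := by
    intro y x
    induction y with
    | zero => simp
    | tmul k a => rw [hinc, smul_mul_assoc, map_smul, hinv, smul_mul_assoc]
    | add y₁ y₂ h₁ h₂ => rw [add_mul, map_add, h₁, h₂, add_mul]
  let P : K ⊗[R] A →ₗ[K ⊗[R] A] K ⊗[R] A :=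
    { toFun := P₀, map_add' := map_add P₀, map_smul' := hB }
  have hPN : ∀ x, P x ∈ N := fun x ↦ by
    change P₀ x ∈ N
    rw [hP₀]
    exact Submodule.sum_mem _ fun i _ ↦ N.smul_mem _ (hp'N _)
  have hPz : ∀ x ∈ N, P x = inc (casimir b b') * x := fun x hx ↦ by
    change P₀ x = _
    rw [hP₀, casimir, map_sum, Finset.sum_mul]
    refine Finset.sum_congr rfl fun i _ ↦ ?_
    have hbx : inc (b' i) * x ∈ N := N.smul_mem (inc (b' i)) hx
    rw [hp' _ hbx, map_mul, mul_assoc]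
  refine ⟨LinearMap.ker P, ?_, ?_⟩
  · rw [Submodule.disjoint_def]
    intro x hx hx'
    have := hPz x hx
    rw [LinearMap.mem_ker.1 hx'] at this
    rw [← one_mul x, ← hζ, mul_assoc, ← this, mul_zero]
  · rw [codisjoint_iff, eq_top_iff]
    rintro x -
    rw [Submodule.mem_sup]
    refine ⟨ζ * P x, N.smul_mem _ (hPN x), x - ζ * P x, ?_, by abel⟩
    have e : P (ζ * P x) = P x := by
      rw [← smul_eq_mul, map_smul, hPz _ (hPN x), smul_eq_mul, ← mul_assoc, hζ, one_mul]
    rw [LinearMap.mem_ker, map_sub, e, sub_self]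

/-- In a finite-dimensional semisimple algebra `K ⊗ A`, an element acting by zero on every simple
module is zero. -/
theorem eq_zero_of_irreducible [Module.Finite R A] [IsSemisimpleRing (K ⊗[R] A)] {x : K ⊗[R] A}
    (hx : ∀ (k : ℕ) (Φ : K ⊗[R] A →ₐ[K] Matrix (Fin k) (Fin k) K),
      IsIrreducible ((Φ.restrictScalars R).comp
        (Algebra.TensorProduct.includeRight : A →ₐ[R] K ⊗[R] A)) → Φ x = 0) : x = 0 := by
  have hS : ∀ S : Submodule (K ⊗[R] A) (K ⊗[R] A), IsSimpleModule (K ⊗[R] A) S →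
      ∀ y ∈ S, x * y = 0 := by
    intro S hS y hy
    have : Module.Finite K S := inferInstanceAs (Module.Finite K (S.restrictScalars K))
    let B := Module.finBasis K S
    let Φ : K ⊗[R] A →ₐ[K] Matrix _ _ K :=
      (LinearMap.toMatrixAlgEquiv B).toAlgHom.comp (Algebra.lsmul K K S)
    have hΦ : ∀ c s, (Φ c).mulVec (B.equivFun s) = B.equivFun (c • s) := by
      intro c s
      exact LinearMap.toMatrix_mulVec_repr B B _ s
    have hirr : IsIrreducible ((Φ.restrictScalars R).comp
        (Algebra.TensorProduct.includeRight : A →ₐ[R] K ⊗[R] A)) := by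
      constructor
      · rw [← Fin.pos_iff_nonempty]
        have := IsSimpleModule.nontrivial (K ⊗[R] A) S
        exact Module.finrank_pos
      · intro W hW
        let W' : Submodule (K ⊗[R] A) S :=
          { carrier := {s | B.equivFun s ∈ W}
            add_mem' := fun {s t} hs ht ↦ by
              simp only [Set.mem_ofPred_eq, map_add] at *
              exact W.add_mem hs ht
            zero_mem' := by simp
            smul_mem' := fun c s hs ↦ by
              simp only [Set.mem_ofPred_eq] at *
              rw [← hΦ]
              induction c with
              | zero => simp
              | tmul k a =>
                have e : k ⊗ₜ[R] a = k • (1 : K) ⊗ₜ[R] a := by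
                  simp [TensorProduct.smul_tmul']
                rw [e, map_smul, Matrix.smul_mulVec]
                exact W.smul_mem _ (hW a _ hs)
              | add c₁ c₂ h₁ h₂ =>
                rw [map_add, Matrix.add_mulVec]
                exact W.add_mem h₁ h₂ }
        have hmem : ∀ t, t ∈ W ↔ B.equivFun.symm t ∈ W' := fun t ↦ by
          change _ ↔ B.equivFun _ ∈ W
          rw [LinearEquiv.apply_symm_apply]
        rcases eq_bot_or_eq_top W' with h | h
        · left
          ext t
          rw [hmem, h, Submodule.mem_bot, Submodule.mem_bot, LinearEquiv.map_eq_zero_iff]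
        · right
          ext t
          rw [hmem, h]
          simp
    have h0 : B.equivFun (x • ⟨y, hy⟩) = 0 := by rw [← hΦ, hx _ Φ hirr, Matrix.zero_mulVec]
    rw [LinearEquiv.map_eq_zero_iff] at h0
    exact congrArg Subtype.val h0
  -- the elements `y` with `x A y = 0` form a left ideal containing all the minimal ones
  let N : Submodule (K ⊗[R] A) (K ⊗[R] A) :=
    { carrier := {y | ∀ c, x * (c * y) = 0}
      add_mem' := fun {y z} hy hz c ↦ by rw [mul_add, mul_add, hy, hz, add_zero]
      zero_mem' := fun c ↦ by simp
      smul_mem' := fun c y hy c' ↦ by rw [smul_eq_mul, ← mul_assoc c']; exact hy _ }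
  have hN : N = ⊤ := by
    rw [eq_top_iff, ← IsSemisimpleModule.sSup_simples_eq_top (K ⊗[R] A) (K ⊗[R] A)]
    exact sSup_le fun S hS' y hy c ↦ hS S hS' _ (S.smul_mem c hy)
  have : (1 : K ⊗[R] A) ∈ N := hN ▸ Submodule.mem_top
  simpa using this 1

end Semisimple

/-! ### Schur orthogonality and Schur elements -/

section SchurElements

variable {R A K : Type*} [CommRing R] [Ring A] [Algebra R A] [Field K] [Algebra R K]
variable {X : Type*} [Fintype X] {f : A →ₗ[R] R} {b b' : X → A}

/-- Schur's lemma: an operator intertwining two inequivalent simple modules vanishes. -/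
theorem eq_zero_of_intertwining {ι κ : Type*} [Fintype ι] [DecidableEq ι] [Fintype κ]
    [DecidableEq κ] {φ : A →ₐ[R] Matrix ι ι K} {ψ : A →ₐ[R] Matrix κ κ K} (hφ : IsIrreducible φ)
    (hψ : IsIrreducible ψ) (hne : ¬IsEquivalent φ ψ) {P : Matrix κ ι K}
    (hP : ∀ a, ψ a * P = P * φ a) : P = 0 := by
  have hP' : ∀ a x, (ψ a).mulVec (P.mulVec x) = P.mulVec ((φ a).mulVec x) := fun a x ↦ by
    rw [Matrix.mulVec_mulVec, Matrix.mulVec_mulVec, hP]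
  rcases hφ.2 (LinearMap.ker P.mulVecLin) (fun a x hx ↦ by
    simp only [LinearMap.mem_ker, Matrix.mulVecLin_apply] at *
    rw [← hP', hx, Matrix.mulVec_zero]) with h | h
  · rcases hψ.2 (LinearMap.range P.mulVecLin) (fun a x hx ↦ by
      obtain ⟨y, rfl⟩ := hx
      exact ⟨(φ a).mulVec y, (hP' a y).symm⟩) with h' | h'
    · rw [LinearMap.range_eq_bot] at h'
      exact Matrix.toLin'.injective (h'.trans Matrix.mulVecLin_zero.symm)
    · exact absurd ⟨LinearEquiv.ofBijective P.mulVecLin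
        ⟨LinearMap.ker_eq_bot.1 h, LinearMap.range_eq_top.1 h'⟩, fun a x ↦ (hP' a x).symm⟩ hne
  · rw [LinearMap.ker_eq_top] at h
    exact Matrix.toLin'.injective (h.trans Matrix.mulVecLin_zero.symm)

/-- The operator `∑ φ(b_i) X ψ(b'_i)` intertwines the two modules. -/
theorem IsSymmDual.intertwining {ι κ : Type*} [Fintype ι] [DecidableEq ι] [Fintype κ]
    [DecidableEq κ] (h : IsSymmDual f b b') (φ : A →ₐ[R] Matrix ι ι K) (ψ : A →ₐ[R] Matrix κ κ K)
    (Y : Matrix ι κ K) (a : A) :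
    φ a * ∑ i, φ (b i) * Y * ψ (b' i) = (∑ i, φ (b i) * Y * ψ (b' i)) * ψ a := by
  let F : A →ₗ[R] A →ₗ[R] Matrix ι κ K := LinearMap.mk₂ R (fun x y ↦ φ x * Y * ψ y)
    (by simp [Matrix.add_mul]) (by simp) (by simp [Matrix.mul_add]) (by simp)
  have := h.sum_mul_comm F a
  simp only [F, LinearMap.mk₂_apply, map_mul] at this
  simpa only [Matrix.mul_sum, Matrix.sum_mul, Matrix.mul_assoc] using this

theorem sum_mul_single_mul_apply {ι κ : Type*} [Fintype ι] [DecidableEq ι] [Fintype κ]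
    [DecidableEq κ] (φ : A →ₐ[R] Matrix ι ι K) (ψ : A →ₐ[R] Matrix κ κ K) (p q : ι) (r s : κ) :
    (∑ i, φ (b i) * Matrix.single q r (1 : K) * ψ (b' i)) p s = ∑ i, φ (b i) p q * ψ (b' i) r s := by
  simp [Matrix.sum_apply, Matrix.mul_apply, Matrix.single_apply, ite_and]

variable {I : Type*} {ι : I → Type*} [∀ k, Fintype (ι k)] [∀ k, DecidableEq (ι k)]
variable {φ : ∀ k, A →ₐ[R] Matrix (ι k) (ι k) K} {c : I → K}

/-- The Schur orthogonality relations between the matrix coefficients of the representations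
`φ_k`, with constants `c_k`. -/
structure IsSchurOrthogonal (b b' : X → A) (φ : ∀ k, A →ₐ[R] Matrix (ι k) (ι k) K) (c : I → K) :
    Prop where
  same : ∀ k p q r s, ∑ i, φ k (b i) p q * φ k (b' i) r s = if p = s ∧ q = r then c k else 0
  diff : ∀ k l, k ≠ l → ∀ p q r s, ∑ i, φ k (b i) p q * φ l (b' i) r s = 0

theorem IsSymmDual.sum_eq_zero {ι κ : Type*} [Fintype ι] [DecidableEq ι] [Fintype κ]
    [DecidableEq κ] (h : IsSymmDual f b b') {φ : A →ₐ[R] Matrix ι ι K}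
    {ψ : A →ₐ[R] Matrix κ κ K} (hφ : IsIrreducible φ)
    (hψ : IsIrreducible ψ) (hne : ¬IsEquivalent ψ φ) (p q : ι) (r s : κ) :
    ∑ i, φ (b i) p q * ψ (b' i) r s = 0 := by
  rw [← sum_mul_single_mul_apply, eq_zero_of_intertwining hψ hφ hne (h.intertwining φ ψ _),
    Matrix.zero_apply]

/-- Schur's lemma for a split simple module: the operator `∑ φ(b_i) X φ(b'_i)` is a scalar. -/
theorem IsSymmDual.exists_schur {ι : Type*} [Fintype ι] [DecidableEq ι]
    (h : IsSymmDual f b b') {φ : A →ₐ[R] Matrix ι ι K} (hne : Nonempty ι)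
    (hsplit : ∀ f : (ι → K) →ₗ[K] (ι → K),
      (∀ a x, f ((φ a).mulVec x) = (φ a).mulVec (f x)) → ∃ c : K, ∀ x, f x = c • x) :
    ∃ c : K, ∀ p q r s, ∑ i, φ (b i) p q * φ (b' i) r s = if p = s ∧ q = r then c else 0 := by
  have key : ∀ q r, ∃ l : K, ∀ p s,
      ∑ i, φ (b i) p q * φ (b' i) r s = if p = s then l else 0 := by
    intro q r
    have hP := h.intertwining φ φ (Matrix.single q r 1)
    have hPe := fun p s ↦ sum_mul_single_mul_apply (b := b) (b' := b') φ φ p q r s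
    generalize ∑ i, φ (b i) * Matrix.single q r (1 : K) * φ (b' i) = P at hP hPe
    obtain ⟨l, hl⟩ := hsplit P.mulVecLin (fun a x ↦ by
      simp only [Matrix.mulVecLin_apply, Matrix.mulVec_mulVec, hP])
    refine ⟨l, fun p s ↦ ?_⟩
    rw [← hPe]
    have := congrFun (hl (Pi.single s 1)) p
    simpa [Pi.single_apply] using this
  choose l hl using key
  -- symmetry of the Casimir tensor makes the scalar `l q r` vanish for `q ≠ r`
  have hswap : ∀ p q r s, ∑ i, φ (b i) p q * φ (b' i) r s = ∑ i, φ (b i) r s * φ (b' i) p q := by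
    intro p q r s
    let F : A →ₗ[R] A →ₗ[R] K := LinearMap.mk₂ R (fun x y ↦ φ x p q * φ y r s)
      (by simp [add_mul]) (by simp) (by simp [mul_add]) (by simp)
    have := h.sum_swap F
    simp only [F, LinearMap.mk₂_apply] at this
    rw [this]
    exact Finset.sum_congr rfl fun i _ ↦ mul_comm _ _
  have hl' : ∀ p q r s, (if p = s then l q r else 0) = if r = q then l s p else 0 := by
    intro p q r s
    rw [← hl, ← hl, hswap]
  obtain ⟨p₀⟩ := hne
  refine ⟨l p₀ p₀, fun p q r s ↦ ?_⟩
  rw [hl]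
  by_cases hps : p = s
  · by_cases hqr : q = r
    · have := hl' p₀ q r p₀
      simp only [if_true, hqr] at this
      simp [hps, hqr, this]
    · have := hl' p₀ q r p₀
      simp only [if_true, Ne.symm hqr, if_false] at this
      simp [hqr, this]
  · simp [hps]

theorem IsSymmDual.exists_isSchurOrthogonal (h : IsSymmDual f b b') (hφ : IsSplitIrrList φ) :
    ∃ c, IsSchurOrthogonal b b' φ c := by
  choose c hc using fun k ↦ h.exists_schur (hφ.irreducible k).1 (hφ.split k)
  exact ⟨c, hc, fun k l hkl ↦ h.sum_eq_zero (hφ.irreducible k) (hφ.irreducible l)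
    fun he ↦ hkl (hφ.irredundant l k he).symm⟩

theorem IsSchurOrthogonal.map_casimir (ho : IsSchurOrthogonal b b' φ c) (k : I) :
    φ k (casimir b b') = (Fintype.card (ι k) * c k) • 1 := by
  ext p s
  simp only [casimir, map_sum, map_mul, Matrix.sum_apply, Matrix.mul_apply]
  rw [Finset.sum_comm]
  simp only [ho.same]
  by_cases hps : p = s <;> simp [hps]

theorem IsSchurOrthogonal.ne_zero (ho : IsSchurOrthogonal b b' φ c) (hne : ∀ k, Nonempty (ι k))
    (hz : CasimirInvertible R K b b') (k : I) : c k ≠ 0 := by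
  obtain ⟨z', r, hr, hz⟩ := hz
  intro hc
  have := congrArg (φ k) hz
  rw [map_mul, ho.map_casimir, hc, mul_zero, zero_smul, zero_mul, map_smul, map_one] at this
  obtain ⟨p⟩ := hne k
  have e := congrFun (congrFun this p) p
  rw [Matrix.zero_apply, Matrix.smul_apply, Matrix.one_apply_eq, Algebra.smul_def, mul_one] at e
  exact hr e.symm

/-- The Casimir element is integral and acts on a simple module as its degree times the Schur
constant; hence the latter is integral when the degrees are invertible. -/
theorem IsSchurOrthogonal.isIntegral [Algebra ℚ R] (h : IsSymmDual f b b')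
    (ho : IsSchurOrthogonal b b' φ c) (hne : ∀ k, Nonempty (ι k)) (k : I) :
    IsIntegral R (c k) := by
  have := h.finite
  have h₁ : IsIntegral R (casimir b b') := IsIntegral.of_finite R _
  have h₂ := h₁.map (φ k)
  rw [ho.map_casimir, ← Algebra.algebraMap_eq_smul_one] at h₂
  obtain ⟨p⟩ := hne k
  have : Nonempty (ι k) := ⟨p⟩
  have h₃ : IsIntegral R ((Fintype.card (ι k) : K) * c k) := by
    refine (isIntegral_algHom_iff (IsScalarTower.toAlgHom R K (Matrix (ι k) (ι k) K)) ?_).1 h₂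
    exact (algebraMap K (Matrix (ι k) (ι k) K)).injective
  have h₄ := h₃.smul (algebraMap ℚ R (Fintype.card (ι k) : ℚ)⁻¹)
  convert h₄ using 1
  have hcard : (Fintype.card (ι k) : ℚ) ≠ 0 := by exact_mod_cast Fintype.card_ne_zero
  rw [Algebra.smul_def, ← mul_assoc, ← map_natCast (algebraMap R K),
    ← map_natCast (algebraMap ℚ R), ← map_mul, ← map_mul, inv_mul_cancel₀ hcard, map_one, map_one,
    one_mul]

/-- The elementary matrices lie in the `K`-span of the image of a representation satisfying the
orthogonality relations. -/
theorem IsSchurOrthogonal.sum_smul (ho : IsSchurOrthogonal b b' φ c) (k : I) (r s : ι k) :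
    ∑ i, φ k (b' i) r s • φ k (b i) = c k • Matrix.single s r 1 := by
  ext p q
  have := ho.same k p q r s
  simp only [Matrix.sum_apply, Matrix.smul_apply, smul_eq_mul, Matrix.single_apply]
  rw [mul_ite, mul_one, mul_zero]
  simp only [eq_comm (a := s), eq_comm (a := r)]
  rw [← this]
  exact Finset.sum_congr rfl fun i _ ↦ mul_comm _ _

/-- The dual basis identity for `1`, under a matrix representation. -/
theorem IsSymmDual.sum_form_mul_apply {κ : Type*} [Fintype κ] [DecidableEq κ]
    (h : IsSymmDual f b b') (ψ : A →ₐ[R] Matrix κ κ K) (p q : κ) :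
    ∑ i, algebraMap R K (f (b i)) * ψ (b' i) p q = (1 : Matrix κ κ K) p q := by
  have := congrArg ψ (h.sum_right 1)
  rw [map_one] at this
  rw [← this]
  simp only [mul_one, map_sum, map_smul, Matrix.sum_apply, Matrix.smul_apply]
  exact Finset.sum_congr rfl fun i _ ↦ (Algebra.smul_def _ _).symm

variable [Fintype I]

/-- A list of simple modules satisfying the orthogonality relations with nonzero constants expands
the form: the defect is dual to an element of `K ⊗ A` which acts by zero on every simple module. -/
theorem IsSchurOrthogonal.expansion [IsSemisimpleRing (K ⊗[R] A)] (h : IsSymmDual f b b')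
    (hφ : IsSplitIrrList φ) (ho : IsSchurOrthogonal b b' φ c) (hc : ∀ k, c k ≠ 0) (a : A) :
    algebraMap R K (f a) = ∑ k, (c k)⁻¹ * Matrix.trace (φ k a) := by
  classical
  have := h.finite
  let g : A →ₗ[R] K := (Algebra.linearMap R K).comp f -
    ∑ k, (c k)⁻¹ • ((Matrix.traceLinearMap (ι k) R K).comp (φ k).toLinearMap)
  have hg : ∀ a, g a = algebraMap R K (f a) - ∑ k, (c k)⁻¹ * Matrix.trace (φ k a) := fun a ↦ by
    simp [g]
  have hsum : ∀ l r s, ∑ i, g (b i) * φ l (b' i) r s = 0 := by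
    intro l r s
    have e₁ := h.sum_form_mul_apply (φ l) r s
    have e₂ : ∀ k, ∑ i, Matrix.trace (φ k (b i)) * φ l (b' i) r s =
        if k = l then c k * (1 : Matrix (ι l) (ι l) K) r s else 0 := by
      intro k
      simp only [Matrix.trace, Matrix.diag_apply, Finset.sum_mul]
      rw [Finset.sum_comm]
      split_ifs with hkl
      · subst hkl
        simp only [ho.same]
        by_cases hrs : r = s
        · subst hrs
          simp
        · rw [Matrix.one_apply_ne hrs, mul_zero]
          exact Finset.sum_eq_zero fun p _ ↦ if_neg fun hp ↦ hrs (hp.2.symm.trans hp.1)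
      · simp only [ho.diff k l hkl, Finset.sum_const_zero]
    simp only [hg, sub_mul, Finset.sum_sub_distrib, e₁, Finset.sum_mul]
    rw [Finset.sum_comm]
    simp only [mul_assoc, ← Finset.mul_sum, e₂]
    simp [hc]
  -- `g` is the defect of the expansion, and the element dual to it is zero
  have he : ∑ i, g (b i) ⊗ₜ[R] b' i = 0 := by
    refine eq_zero_of_irreducible fun k Φ hΦ ↦ ?_
    obtain ⟨l, E, hE⟩ := hφ.complete k _ hΦ
    have e₀ : ∀ i, Φ (g (b i) ⊗ₜ[R] b' i) = g (b i) • ((Φ.restrictScalars R).comp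
        (Algebra.TensorProduct.includeRight : A →ₐ[R] K ⊗[R] A)) (b' i) := by
      intro i
      have : g (b i) ⊗ₜ[R] b' i = g (b i) • (1 : K) ⊗ₜ[R] b' i := by
        simp [TensorProduct.smul_tmul']
      rw [this, map_smul]
      rfl
    have e₁ : ∑ i, g (b i) • φ l (b' i) = 0 := by
      ext r s
      simpa [Matrix.sum_apply] using hsum l r s
    apply Matrix.toLin'.injective
    refine LinearMap.ext fun x ↦ ?_
    obtain ⟨y, rfl⟩ := E.surjective x
    have e₂ := congrArg (fun M ↦ E (Matrix.mulVec M y)) e₁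
    simp only [Matrix.sum_mulVec, Matrix.smul_mulVec, map_sum, map_smul, hE, Matrix.zero_mulVec,
      map_zero] at e₂
    simp only [map_sum Φ, e₀, Matrix.toLin'_apply, Matrix.sum_mulVec, Matrix.smul_mulVec, e₂,
      Matrix.zero_mulVec]
  let G : K ⊗[R] A →ₗ[R] K := TensorProduct.lift
    ((LinearMap.mul R K).compl₂ ((Algebra.linearMap R K).comp (f.comp (LinearMap.mulRight R a))))
  have h0 := congrArg G he
  simp only [map_sum, map_zero, G, TensorProduct.lift.tmul, LinearMap.compl₂_apply,
    LinearMap.mul_apply', LinearMap.comp_apply, LinearMap.mulRight_apply,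
    Algebra.linearMap_apply] at h0
  have h₁ : g a = 0 := by
    rw [← h0]
    conv_lhs => rw [← h.sum_left a]
    simp only [map_sum, map_smul]
    refine Finset.sum_congr rfl fun i _ ↦ ?_
    rw [h.trace, Algebra.smul_def, mul_comm]
  rw [hg, sub_eq_zero] at h₁
  exact h₁

theorem IsSchurOrthogonal.sum_form_mul (ho : IsSchurOrthogonal b b' φ c) {s : I → K}
    (hexp : ∀ a, algebraMap R K (f a) = ∑ k, (s k)⁻¹ * Matrix.trace (φ k a)) (l : I) (p : ι l) :
    ∑ i, algebraMap R K (f (b i)) * φ l (b' i) p p = (s l)⁻¹ * c l := by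
  classical
  simp only [hexp, Finset.sum_mul, Matrix.trace, Matrix.diag_apply, Finset.mul_sum]
  rw [Finset.sum_comm, Finset.sum_eq_single l]
  · rw [Finset.sum_comm]
    simp only [mul_assoc, ← Finset.mul_sum, ho.same]
    simp
  · intro k _ hk
    rw [Finset.sum_comm]
    simp only [mul_assoc, ← Finset.mul_sum, ho.diff k l hk]
    simp
  · simp

/-- The coefficients of the expansion of the form are the inverses of the Schur constants. -/
theorem IsSchurOrthogonal.eq_of_expansion (h : IsSymmDual f b b')
    (ho : IsSchurOrthogonal b b' φ c) (hne : ∀ k, Nonempty (ι k)) {s : I → K}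
    (hs : ∀ k, s k ≠ 0)
    (hexp : ∀ a, algebraMap R K (f a) = ∑ k, (s k)⁻¹ * Matrix.trace (φ k a)) : s = c := by
  funext l
  obtain ⟨p⟩ := hne l
  have e₁ := h.sum_form_mul_apply (φ l) p p
  rw [Matrix.one_apply_eq, ho.sum_form_mul hexp, inv_mul_eq_one₀ (hs l)] at e₁
  exact e₁

theorem IsSymmDual.existsUnique_schurFamily [Algebra ℚ R] (h : IsSymmDual f b b')
    (hz : CasimirInvertible R K b b') (hφ : IsSplitIrrList φ) : ∃! s : I → K, IsSchurFamily f φ s := by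
  obtain ⟨c, ho⟩ := h.exists_isSchurOrthogonal hφ
  have hne := fun k ↦ (hφ.irreducible k).1
  have := h.isSemisimpleRing hz
  refine ⟨c, ⟨ho.isIntegral h hne, ho.ne_zero hne hz,
    ho.expansion h hφ (ho.ne_zero hne hz)⟩, fun s hs ↦ ?_⟩
  exact ho.eq_of_expansion h hne hs.ne_zero hs.expansion

/-- Representations whose matrix coefficients are orthogonal with nonzero constants, and whose
characters expand the form, are a complete list of the simple modules, all of them split. -/
theorem IsSchurOrthogonal.isSplitIrrList (h : IsSymmDual f b b')
    (ho : IsSchurOrthogonal b b' φ c) (hne : ∀ k, Nonempty (ι k)) (hc : ∀ k, c k ≠ 0)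
    (hexp : ∀ a, algebraMap R K (f a) = ∑ k, (c k)⁻¹ * Matrix.trace (φ k a)) :
    IsSplitIrrList φ := by
  have hel := ho.sum_smul
  have hirr : ∀ k, IsIrreducible (φ k) := by
    refine fun k ↦ ⟨hne k, fun W hW ↦ ?_⟩
    have hsing : ∀ (r s : ι k), ∀ x ∈ W, x r • Pi.single s 1 ∈ W := by
      intro r s x hx
      have h₁ : (∑ i, φ k (b' i) r s • φ k (b i)).mulVec x ∈ W := by
        rw [Matrix.sum_mulVec]
        refine Submodule.sum_mem _ fun i _ ↦ ?_
        rw [Matrix.smul_mulVec]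
        exact W.smul_mem _ (hW _ _ hx)
      rw [hel, Matrix.smul_mulVec] at h₁
      have h₂ := W.smul_mem (c k)⁻¹ h₁
      rw [smul_smul, inv_mul_cancel₀ (hc k), one_smul] at h₂
      convert h₂ using 1
      ext p
      simp [Matrix.mulVec, dotProduct, Matrix.single_apply, Pi.single_apply, ite_and, eq_comm]
    by_cases hW0 : W = ⊥
    · exact Or.inl hW0
    · right
      obtain ⟨x, hx, hx0⟩ := (Submodule.ne_bot_iff W).1 hW0
      obtain ⟨r, hr⟩ := Function.ne_iff.1 hx0
      rw [eq_top_iff]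
      rintro y -
      rw [pi_eq_sum_univ' y]
      refine Submodule.sum_mem _ fun s _ ↦ W.smul_mem _ ?_
      have h₁ := W.smul_mem (x r)⁻¹ (hsing r s x hx)
      rw [smul_smul, inv_mul_cancel₀ hr, one_smul] at h₁
      convert h₁ using 1
  refine ⟨hirr, ?_, ?_, ?_⟩
  · rintro k l ⟨E, hE⟩
    by_contra hkl
    obtain ⟨r⟩ := hne k
    have h₁ : ∑ i, φ k (b' i) r r • φ l (b i) = 0 := by
      ext p q
      have := ho.diff l k (Ne.symm hkl) p q r r
      simp only [Matrix.sum_apply, Matrix.smul_apply, smul_eq_mul, Matrix.zero_apply]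
      rw [← this]
      exact Finset.sum_congr rfl fun i _ ↦ mul_comm _ _
    have h₂ := congrArg (fun M ↦ E (Matrix.mulVec M (Pi.single r 1))) (hel k r r)
    simp only [Matrix.sum_mulVec, Matrix.smul_mulVec, map_sum, map_smul, hE] at h₂
    simp only [← Matrix.smul_mulVec, ← Matrix.sum_mulVec, h₁, Matrix.zero_mulVec] at h₂
    have h₃ := (smul_eq_zero.1 h₂.symm).resolve_left (hc k)
    rw [LinearEquiv.map_eq_zero_iff] at h₃
    have h₄ := congrFun h₃ r
    simp at h₄
  · -- a simple module missing from the list would make the dual basis identity read `1 = 0`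
    intro m ψ hψ
    by_contra! hcon
    obtain ⟨p⟩ := hψ.1
    have h₁ := h.sum_form_mul_apply ψ p p
    rw [Matrix.one_apply_eq] at h₁
    have h₂ : ∀ k (q : ι k), ∑ i, φ k (b i) q q * ψ (b' i) p p = 0 := fun k q ↦
      h.sum_eq_zero (hirr k) hψ (fun ⟨E, hE⟩ ↦ hcon k ⟨E.symm, fun a x ↦ by
        rw [LinearEquiv.symm_apply_eq, hE, LinearEquiv.apply_symm_apply]⟩) q q p p
    refine one_ne_zero (α := K) (h₁.symm.trans ?_)
    simp only [hexp, Finset.sum_mul, Matrix.trace, Matrix.diag_apply, Finset.mul_sum]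
    rw [Finset.sum_comm]
    refine Finset.sum_eq_zero fun k _ ↦ ?_
    rw [Finset.sum_comm]
    simp only [mul_assoc, ← Finset.mul_sum, h₂]
    simp
  · intro k g hg
    have hg' : ∀ (r s : ι k) x, g ((Matrix.single s r (1 : K)).mulVec x) =
        (Matrix.single s r (1 : K)).mulVec (g x) := by
      intro r s x
      have h₁ := congrArg (fun M ↦ g (Matrix.mulVec M x)) (hel k r s)
      have h₂ := congrArg (fun M ↦ Matrix.mulVec M (g x)) (hel k r s)
      simp only [Matrix.sum_mulVec, Matrix.smul_mulVec, map_sum, map_smul, hg] at h₁ h₂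
      rw [h₁] at h₂
      exact smul_right_injective _ (hc k) h₂
    obtain ⟨r⟩ := hne k
    refine ⟨g (Pi.single r 1) r, fun x ↦ ?_⟩
    have key : ∀ s, g (Pi.single s 1) = g (Pi.single r 1) r • Pi.single s 1 := by
      intro s
      have h₁ := hg' r s (Pi.single r 1)
      rw [Matrix.single_mulVec, Matrix.single_mulVec] at h₁
      rw [← Pi.single_smul, smul_eq_mul, mul_one]
      simpa [Pi.single] using h₁
    rw [pi_eq_sum_univ' x]
    simp only [map_sum, map_smul, Finset.smul_sum]
    refine Finset.sum_congr rfl fun s _ ↦ ?_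
    rw [key s, smul_comm]

end SchurElements

/-! ### The standard basis and the canonical form of the Iwahori--Hecke algebra -/

/-- The parameter `u⁻¹ v` of the quadratic relation of the normalized generators `u⁻¹ T_i`. -/
def qParam : GroundRing := uInv * v

theorem uInv_mul_u : uInv * u = 1 := by
  have h : (Polynomial.C (LaurentPolynomial.T (-1)) * Polynomial.C (LaurentPolynomial.T 1) :
      Polynomial (LaurentPolynomial ℂ)) = 1 := by
    rw [← map_mul, ← LaurentPolynomial.T_add, neg_add_cancel, LaurentPolynomial.T_zero, map_one]
  exact h

/-- The quadratic relation for the normalized generators, from the one for the generators. -/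
theorem normalized_quad {R A : Type*} [CommRing R] [Ring A] [Algebra R A] {u u' v : R}
    (hu : u' * u = 1) {x e : A} (hx : x * x = algebraMap R A (u ^ 2) + v • (e * x)) :
    (u' • x) * (u' • x) = 1 + (u' * v) • (e * u' • x) := by
  rw [smul_mul_smul_comm, hx, smul_add, Algebra.algebraMap_eq_smul_one, smul_smul, pow_two,
    mul_mul_mul_comm, hu, one_mul, one_smul, mul_smul_comm, smul_smul, smul_smul]
  congr 2
  ring

/-- The quadratic relation for the generators, from the one for the normalized generators. -/
theorem unnormalized_quad {R A : Type*} [CommRing R] [Ring A] [Algebra R A] {u u' v : R}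
    (hu : u' * u = 1) {x e : A} (hx : x * x = 1 + (u' * v) • (e * x)) :
    (u • x) * (u • x) = algebraMap R A (u ^ 2) + v • (e * u • x) := by
  rw [smul_mul_smul_comm, hx, smul_add, Algebra.algebraMap_eq_smul_one, pow_two, mul_smul_comm,
    smul_smul, smul_smul]
  congr 2
  linear_combination u * v * hu

/-- A submodule stable under left multiplication by the generators of an algebra is stable under
left multiplication by the whole algebra. -/
theorem mul_mem_of_generators {R X A : Type*} [CommRing R] [Ring A] [Algebra R A]
    {π : FreeAlgebra R X →ₐ[R] A} (hπ : Function.Surjective π) {N : Submodule R A}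
    (hN : ∀ x, ∀ a ∈ N, π (FreeAlgebra.ι R x) * a ∈ N) (y : A) : ∀ a ∈ N, y * a ∈ N := by
  obtain ⟨y, rfl⟩ := hπ y
  induction y using FreeAlgebra.induction with
  | grade0 r =>
    intro a ha
    rw [AlgHom.commutes, ← Algebra.smul_def]
    exact N.smul_mem r ha
  | grade1 x => exact hN x
  | mul y z hy hz =>
    intro a ha
    rw [map_mul, mul_assoc]
    exact hy _ (hz _ ha)
  | add y z hy hz =>
    intro a ha
    rw [map_add, add_mul]
    exact N.add_mem (hy _ ha) (hz _ ha)

section Hecke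

variable {m : ℕ}

theorem heckeMk_surjective (m : ℕ) : Function.Surjective (heckeMk m) :=
  RingQuot.mkAlgHom_surjective GroundRing (HeckeRel m)

/-- The normalized generator `u⁻¹ T_i`. -/
def heckeGen (i : Fin (m - 1)) : Hecke m := uInv • heckeT i

theorem heckeT_eq (i : Fin (m - 1)) : heckeT i = u • heckeGen i := by
  rw [heckeGen, smul_smul, mul_comm, uInv_mul_u, one_smul]

theorem isBraided_heckeGen : IsBraided (heckeGen (m := m)) where
  comm i j h := by
    have := RingQuot.mkAlgHom_rel GroundRing (HeckeRel.comm i j (Or.inl h))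
    rw [map_mul, map_mul] at this
    simp only [heckeGen, smul_mul_smul_comm]
    exact congrArg _ this
  braid i j h := by
    have := RingQuot.mkAlgHom_rel GroundRing (HeckeRel.braid i j h)
    simp only [map_mul] at this
    simp only [heckeGen, smul_mul_smul_comm]
    exact congrArg _ this

theorem heckeGen_mul_self (i : Fin (m - 1)) :
    heckeGen i * heckeGen i = 1 + qParam • heckeGen i := by
  have h := RingQuot.mkAlgHom_rel GroundRing (HeckeRel.quad i)
  rw [map_mul, map_add, map_smul, AlgHom.commutes] at h
  have h' : heckeT i * heckeT i = algebraMap GroundRing _ (u ^ 2) + v • (1 * heckeT i) := by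
    rw [one_mul]
    exact h
  have := normalized_quad uInv_mul_u h'
  rwa [one_mul] at this

theorem heckeTilde_eq (w : Equiv.Perm (Fin m)) : heckeTilde w = braidLift heckeGen w := rfl

theorem heckeWord_eq {l : List (Fin (m - 1))} (hl : IsReducedWord l) :
    heckeWord l = heckeTilde (wordProd l) := isBraided_heckeGen.prod_eq hl

@[simp] theorem heckeTilde_one : heckeTilde (1 : Equiv.Perm (Fin m)) = 1 :=
  isBraided_heckeGen.braidLift_one

theorem heckeGen_mul_heckeTilde (i : Fin (m - 1)) (w : Equiv.Perm (Fin m)) :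
    heckeGen i * heckeTilde w =
      heckeTilde (adjSwap i * w) + (if IsDesc i w then qParam else 0) • heckeTilde w := by
  by_cases h : IsDesc i w
  · have h' : ¬IsDesc i (adjSwap i * w) := by rw [isDesc_adjSwap_mul, not_not]; exact h
    have e : heckeGen i * heckeTilde (adjSwap i * w) = heckeTilde w := by
      rw [heckeTilde_eq, isBraided_heckeGen.mul_braidLift h', adjSwap_mul_cancel, heckeTilde_eq]
    rw [if_pos h, ← e, ← mul_assoc, heckeGen_mul_self, add_mul, one_mul, smul_mul_assoc, e]
  · rw [if_neg h, zero_smul, add_zero, heckeTilde_eq, isBraided_heckeGen.mul_braidLift h,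
      heckeTilde_eq]

theorem heckeTilde_adjSwap (i : Fin (m - 1)) : heckeTilde (adjSwap i) = heckeGen i := by
  have h : ¬IsDesc i (1 : Equiv.Perm (Fin m)) := not_isDesc_iff.2 (lo_lt_hi i)
  have := heckeGen_mul_heckeTilde i 1
  rwa [if_neg h, heckeTilde_one, mul_one, mul_one, zero_smul, add_zero, eq_comm] at this

theorem span_heckeTilde : Submodule.span GroundRing (Set.range (heckeTilde (m := m))) = ⊤ := by
  rw [eq_top_iff]
  rintro x -
  rw [← mul_one x]
  refine mul_mem_of_generators (heckeMk_surjective m) ?_ x 1 ?_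
  · intro i a ha
    change heckeT i * a ∈ _
    rw [heckeT_eq, smul_mul_assoc]
    refine Submodule.smul_mem _ _ ?_
    induction ha using Submodule.span_induction with
    | mem a ha =>
      obtain ⟨w, rfl⟩ := ha
      rw [heckeGen_mul_heckeTilde]
      exact Submodule.add_mem _ (Submodule.subset_span ⟨_, rfl⟩)
        (Submodule.smul_mem _ _ (Submodule.subset_span ⟨_, rfl⟩))
    | zero => rw [mul_zero]; exact Submodule.zero_mem _
    | add a b _ _ ha hb => rw [mul_add]; exact Submodule.add_mem _ ha hb
    | smul r a _ ha => rw [mul_smul_comm]; exact Submodule.smul_mem _ _ ha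
  · exact Submodule.subset_span ⟨1, heckeTilde_one⟩

/-- The operator by which the normalized generator acts in the regular representation; all
positions have the same colour. -/
def regOp (i : Fin (m - 1)) : Module.End GroundRing (Equiv.Perm (Fin m) → GroundRing) :=
  (Pi.basisFun GroundRing _).constr GroundRing fun w ↦ Pi.single (adjSwap i * w) 1 +
    descCoeff qParam (fun _ ↦ ()) (w⁻¹ (lo i)) (w⁻¹ (hi i)) • Pi.single w 1

theorem regOp_actsAs (i : Fin (m - 1)) :
    ActsAs qParam (fun _ ↦ ()) (fun w : Equiv.Perm (Fin m) ↦ Pi.single w (1 : GroundRing)) i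
      (regOp i) := by
  intro w
  have := (Pi.basisFun GroundRing (Equiv.Perm (Fin m))).constr_basis GroundRing (fun w ↦
    Pi.single (M := fun _ ↦ GroundRing) (adjSwap i * w) 1 +
    descCoeff qParam (fun _ ↦ ()) (w⁻¹ (lo i)) (w⁻¹ (hi i)) • Pi.single w 1) w
  rwa [Pi.basisFun_apply] at this

theorem end_ext {f g : Module.End GroundRing (Equiv.Perm (Fin m) → GroundRing)}
    (h : ∀ w, f (Pi.single w 1) = g (Pi.single w 1)) : f = g := by
  refine (Pi.basisFun GroundRing (Equiv.Perm (Fin m))).ext fun w ↦ ?_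
  rw [Pi.basisFun_apply]
  exact h w

theorem regOp_rel {x y : FreeAlgebra GroundRing (Fin (m - 1))} (h : HeckeRel m x y) :
    FreeAlgebra.lift GroundRing (fun i ↦ u • regOp i) x =
      FreeAlgebra.lift GroundRing (fun i ↦ u • regOp i) y := by
  induction h with
  | comm i j h =>
    simp only [map_mul, FreeAlgebra.lift_ι_apply, smul_mul_smul_comm]
    have : regOp i * regOp j = regOp j * regOp i := end_ext fun w ↦ by
      rcases h with h | h
      · exact (regOp_actsAs i).comm h (regOp_actsAs j) w
      · exact ((regOp_actsAs j).comm h (regOp_actsAs i) w).symm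
    rw [this]
  | braid i j h =>
    simp only [map_mul, FreeAlgebra.lift_ι_apply, smul_mul_smul_comm]
    have : regOp i * regOp j * regOp i = regOp j * regOp i * regOp j := end_ext fun w ↦
      (regOp_actsAs i).braid h (regOp_actsAs j) w
    rw [this]
  | quad i =>
    have h : regOp i * regOp i = 1 + (uInv * v) • (1 * regOp i) := by
      refine end_ext fun w ↦ ?_
      have := (regOp_actsAs i).quad w
      rw [if_pos rfl] at this
      rw [one_mul]
      exact this
    have h' := unnormalized_quad uInv_mul_u h
    rw [one_mul] at h'
    rw [map_mul, map_add, map_smul, AlgHom.commutes, FreeAlgebra.lift_ι_apply]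
    exact h'

/-- The regular representation of the Iwahori--Hecke algebra, on the functions on the symmetric
group. -/
def regRep (m : ℕ) :
    Hecke m →ₐ[GroundRing] Module.End GroundRing (Equiv.Perm (Fin m) → GroundRing) :=
  RingQuot.liftAlgHom GroundRing ⟨FreeAlgebra.lift GroundRing fun i ↦ u • regOp i,
    fun _ _ ↦ regOp_rel⟩

theorem regRep_heckeGen (i : Fin (m - 1)) : regRep m (heckeGen i) = regOp i := by
  have : regRep m (heckeT i) = u • regOp i := by
    refine (RingQuot.liftAlgHom_mkAlgHom_apply GroundRing _ _ _).trans ?_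
    exact FreeAlgebra.lift_ι_apply _ _
  rw [heckeGen, map_smul, this, smul_smul, uInv_mul_u, one_smul]

theorem regRep_heckeTilde (w : Equiv.Perm (Fin m)) :
    regRep m (heckeTilde w) (Pi.single 1 1) = Pi.single w 1 := by
  induction w using perm_induction with
  | one => rw [heckeTilde_one, map_one, Module.End.one_apply]
  | step i w h ih =>
    rw [heckeTilde_eq, ← isBraided_heckeGen.mul_braidLift h, map_mul, Module.End.mul_apply,
      ← heckeTilde_eq, ih, regRep_heckeGen, regOp_actsAs i w, descCoeff,
      if_neg fun hd ↦ h hd.1, zero_smul, add_zero]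

/-- The canonical form `τ_m`: the coefficient of `1` in the standard basis. -/
def canonicalForm (m : ℕ) : Hecke m →ₗ[GroundRing] GroundRing :=
  (LinearMap.proj 1).comp ((LinearMap.applyₗ (Pi.single 1 1)).comp (regRep m).toLinearMap)

theorem canonicalForm_heckeTilde (w : Equiv.Perm (Fin m)) :
    canonicalForm m (heckeTilde w) = if w = 1 then 1 else 0 := by
  change regRep m (heckeTilde w) (Pi.single 1 1) 1 = _
  rw [regRep_heckeTilde, Pi.single_apply]
  simp only [eq_comm]

/-- The form is moved along a reduced expression of `x`, from the left factor to the right one. -/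
theorem canonicalForm_mul (x y : Equiv.Perm (Fin m)) :
    canonicalForm m (heckeTilde x⁻¹ * heckeTilde y) = if x = y then 1 else 0 := by
  induction x using perm_induction generalizing y with
  | one =>
    rw [inv_one, heckeTilde_one, one_mul, canonicalForm_heckeTilde]
    simp only [eq_comm]
  | step i x h ih =>
    rw [mul_inv_rev, adjSwap_inv, heckeTilde_eq (x⁻¹ * adjSwap i),
      ← isBraided_heckeGen.braidLift_mul (by rwa [inv_inv]), ← heckeTilde_eq, mul_assoc,
      heckeGen_mul_heckeTilde, mul_add, map_add, mul_smul_comm, map_smul, ih, ih]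
    -- the second term vanishes: `i` cannot be a descent of `y = x`
    have h₁ : (if IsDesc i y then qParam else 0) • (if x = y then (1 : GroundRing) else 0) = 0 := by
      by_cases hxy : x = y
      · subst hxy
        rw [if_neg h, zero_smul]
      · rw [if_neg hxy, smul_zero]
    have h₂ : x = adjSwap i * y ↔ adjSwap i * x = y := by
      constructor
      · rintro rfl; rw [adjSwap_mul_cancel]
      · rintro rfl; rw [adjSwap_mul_cancel]
    rw [h₁, add_zero]
    simp only [h₂]

/-- `(T̃_w)` and `(T̃_{w⁻¹})` are dual bases for the canonical form. -/
theorem isSymmDual_canonicalForm (m : ℕ) :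
    IsSymmDual (canonicalForm m) heckeTilde (fun w ↦ heckeTilde w⁻¹) := by
  have key : ∀ x y : Equiv.Perm (Fin m),
      canonicalForm m (heckeTilde x * heckeTilde y) = if x⁻¹ = y then 1 else 0 := by
    intro x y
    simpa using canonicalForm_mul x⁻¹ y
  refine IsSymmDual.of_span span_heckeTilde ?_ ?_
  · intro x y
    rw [key, key]
    simp only [inv_eq_iff_eq_inv, eq_comm (a := y)]
  · intro x y
    rw [key]
    simp only [inv_inj]

theorem isCanonicalForm_iff (f : Hecke m →ₗ[GroundRing] GroundRing) :
    IsCanonicalForm f ↔ f = canonicalForm m := by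
  constructor
  · intro h
    refine LinearMap.ext_on span_heckeTilde ?_
    rintro _ ⟨w, rfl⟩
    rw [h, canonicalForm_heckeTilde]
  · rintro rfl
    exact canonicalForm_heckeTilde

/-! ### The Casimir element of the Iwahori--Hecke algebra is generically invertible -/

/-- The specialization `u ↦ 1`, `v ↦ 0` of the ground ring. -/
def specialize : GroundRing →+* ℂ :=
  ((LaurentPolynomial.eval₂ (RingHom.id ℂ) 1).comp (Polynomial.evalRingHom 0) :
    Polynomial (LaurentPolynomial ℂ) →+* ℂ)

theorem specialize_u : specialize u = 1 := by
  change LaurentPolynomial.eval₂ (RingHom.id ℂ) 1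
    (Polynomial.eval 0 (Polynomial.C (LaurentPolynomial.T 1))) = 1
  rw [Polynomial.eval_C, LaurentPolynomial.eval₂_T, zpow_one, Units.val_one]

theorem specialize_v : specialize v = 0 := by
  change LaurentPolynomial.eval₂ (RingHom.id ℂ) 1 (Polynomial.eval 0 Polynomial.X) = 0
  rw [Polynomial.eval_X, map_zero]

/-- At `u = 1`, `v = 0` the Iwahori--Hecke algebra becomes the group algebra of the symmetric group,
the standard basis becoming the group elements. -/
theorem exists_specialization (m : ℕ) :
    ∃ θ : Hecke m →+* MonoidAlgebra ℂ (Equiv.Perm (Fin m)),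
      (∀ r x, θ (r • x) = specialize r • θ x) ∧
        ∀ w, θ (heckeTilde w) = MonoidAlgebra.single w 1 := by
  let _ : Algebra GroundRing ℂ := specialize.toAlgebra
  have halg : ∀ r : GroundRing, algebraMap GroundRing ℂ r = specialize r := fun _ ↦ rfl
  let θ : Hecke m →ₐ[GroundRing] MonoidAlgebra ℂ (Equiv.Perm (Fin m)) :=
    RingQuot.liftAlgHom GroundRing
      ⟨FreeAlgebra.lift GroundRing fun i ↦ MonoidAlgebra.single (adjSwap i) (1 : ℂ), by
    intro x y h
    induction h with
    | comm i j h =>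
      simp only [map_mul, FreeAlgebra.lift_ι_apply, MonoidAlgebra.single_mul_single,
        adjSwap_comm h]
    | braid i j h =>
      simp only [map_mul, FreeAlgebra.lift_ι_apply, MonoidAlgebra.single_mul_single,
        adjSwap_braid h]
    | quad i =>
      have hv : ∀ x : MonoidAlgebra ℂ (Equiv.Perm (Fin m)), v • x = 0 := fun x ↦ by
        rw [← algebraMap_smul ℂ v x, halg, specialize_v, zero_smul]
      have hu : algebraMap GroundRing (MonoidAlgebra ℂ (Equiv.Perm (Fin m))) (u ^ 2) = 1 := by
        rw [IsScalarTower.algebraMap_apply GroundRing ℂ, halg, map_pow, specialize_u, one_pow,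
          map_one]
      simp only [map_mul, map_add, map_smul, FreeAlgebra.lift_ι_apply,
        MonoidAlgebra.single_mul_single, adjSwap_mul_self, AlgHom.commutes, hv, hu, add_zero,
        mul_one]
      rfl⟩
  have hT : ∀ i : Fin (m - 1), θ (heckeT i) = MonoidAlgebra.single (adjSwap i) 1 := fun i ↦ by
    refine (RingQuot.liftAlgHom_mkAlgHom_apply GroundRing _ _ _).trans ?_
    exact FreeAlgebra.lift_ι_apply _ _
  have hsmul : ∀ r x, θ (r • x) = specialize r • θ x := fun r x ↦ by
    rw [map_smul, ← algebraMap_smul ℂ r (θ x), halg]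
  have hgen : ∀ i : Fin (m - 1), θ (heckeGen i) = MonoidAlgebra.single (adjSwap i) 1 := fun i ↦ by
    have h₁ : specialize uInv = 1 := by
      have := congrArg specialize uInv_mul_u
      rwa [map_mul, specialize_u, mul_one, map_one] at this
    rw [heckeGen, hsmul, hT, h₁, one_smul]
  refine ⟨θ.toRingHom, hsmul, fun w ↦ ?_⟩
  change θ _ = _
  induction w using perm_induction with
  | one => rw [heckeTilde_one, map_one]; rfl
  | step i w h ih =>
    rw [heckeTilde_eq, ← isBraided_heckeGen.mul_braidLift h, map_mul, ← heckeTilde_eq, ih, hgen,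
      MonoidAlgebra.single_mul_single, mul_one]

/-- The matrix of the multiplication by the Casimir element in the standard basis specializes to
the scalar `m!`; its determinant is therefore nonzero. -/
theorem exists_casimir_mul_eq (m : ℕ) : ∃ (z' : Hecke m) (r : GroundRing), r ≠ 0 ∧
    casimir heckeTilde (fun w ↦ heckeTilde w⁻¹) * z' = r • 1 := by
  obtain ⟨θ, hθ, hθw⟩ := exists_specialization m
  let τ := canonicalForm m
  have hd := isSymmDual_canonicalForm m
  let z : Hecke m := casimir heckeTilde (fun w ↦ heckeTilde w⁻¹)
  let Z : Matrix (Equiv.Perm (Fin m)) (Equiv.Perm (Fin m)) GroundRing :=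
    Matrix.of fun w y ↦ τ (z * heckeTilde y * heckeTilde w⁻¹)
  have hZ : ∀ y, z * heckeTilde y = ∑ w, Z w y • heckeTilde w := fun y ↦
    (hd.sum_left (z * heckeTilde y)).symm
  have hθz : θ z = ((Nat.factorial m : ℕ) : ℂ) • 1 := by
    have h1 : ∀ w : Equiv.Perm (Fin m), θ (heckeTilde w * heckeTilde w⁻¹) = 1 := fun w ↦ by
      rw [map_mul, hθw, hθw, MonoidAlgebra.single_mul_single, mul_inv_cancel, mul_one]
      rfl
    simp only [z, casimir, map_sum, h1, Finset.sum_const, Finset.card_univ, Fintype.card_perm,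
      Fintype.card_fin]
    rw [Nat.cast_smul_eq_nsmul]
  have hmap : specialize.mapMatrix Z = ((Nat.factorial m : ℕ) : ℂ) • 1 := by
    ext w y
    have h := congrArg θ (hZ y)
    rw [map_mul, hθz, map_sum, hθw, smul_mul_assoc, one_mul] at h
    simp only [hθ, hθw] at h
    have h' := congrArg (fun t ↦ MonoidAlgebra.coeff t w) h
    simp only [MonoidAlgebra.coeff_sum, MonoidAlgebra.coeff_smul, MonoidAlgebra.coeff_single] at h'
    simp [Finsupp.single_apply] at h'
    simp [Matrix.one_apply, ← h', eq_comm]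
  -- by Cramer's rule the first column of the adjugate matrix inverts the Casimir element up to `det`
  refine ⟨∑ w, Z.adjugate w 1 • heckeTilde w, Z.det, ?_, ?_⟩
  · intro h0
    have h := RingHom.map_det specialize Z
    rw [h0, map_zero, hmap, Matrix.det_smul, Matrix.det_one, mul_one] at h
    exact pow_ne_zero _ (Nat.cast_ne_zero.2 (Nat.factorial_ne_zero m)) h.symm
  · have h := Matrix.mul_adjugate Z
    change z * _ = _
    simp only [Finset.mul_sum, mul_smul_comm, hZ, Finset.smul_sum, smul_smul]
    rw [Finset.sum_comm]
    have h₁ : ∀ w, ∑ y, Z.adjugate y 1 * Z w y = (Z.det •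
        (1 : Matrix (Equiv.Perm (Fin m)) (Equiv.Perm (Fin m)) GroundRing)) w 1 := by
      intro w
      rw [← h, Matrix.mul_apply]
      exact Finset.sum_congr rfl fun y _ ↦ mul_comm _ _
    simp only [← Finset.sum_smul, h₁, Matrix.smul_apply, Matrix.one_apply]
    simp

end Hecke

/-! ### Young subgroups and distinguished coset representatives -/

section Young

variable {d n : ℕ}

theorem perm_inv_apply_self {α : Type*} (w : Equiv.Perm α) (a : α) : w⁻¹ (w a) = a :=
  w.symm_apply_apply a

theorem perm_apply_inv_self {α : Type*} (w : Equiv.Perm α) (a : α) : w (w⁻¹ a) = a :=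
  w.apply_symm_apply a

theorem act_mul (v w : Equiv.Perm (Fin n)) (χ : Fin n → Fin d) :
    act (v * w) χ = act v (act w χ) := by
  funext j
  simp only [act, mul_inv_rev, Equiv.Perm.mul_apply]

@[simp] theorem act_one (χ : Fin n → Fin d) : act 1 χ = χ := rfl

theorem act_apply_apply (w : Equiv.Perm (Fin n)) (χ : Fin n → Fin d) (j : Fin n) :
    act w χ (w j) = χ j := by
  rw [act, perm_inv_apply_self]

theorem act_adjSwap (i : Fin (n - 1)) (χ : Fin n → Fin d) (j : Fin n) :
    act (adjSwap i) χ j = χ (adjSwap i j) := by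
  rw [act, adjSwap_inv]

theorem act_adjSwap_of_eq {i : Fin (n - 1)} {χ : Fin n → Fin d} (h : χ (lo i) = χ (hi i)) :
    act (adjSwap i) χ = χ := by
  funext j
  rw [act_adjSwap]
  by_cases h₁ : j = lo i
  · rw [h₁, adjSwap_lo, h]
  · by_cases h₂ : j = hi i
    · rw [h₂, adjSwap_hi, h]
    · rw [adjSwap_of_ne h₁ h₂]

/-- The composition counting how often a character takes each value. -/
def charComp (χ : Fin n → Fin d) : Comp d n :=
  ⟨fun a ↦ Fintype.card {j // χ j = a}, by
    rw [← Fintype.card_sigma, Fintype.card_congr (Equiv.sigmaFiberEquiv χ), Fintype.card_fin]⟩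

variable {μ : Comp d n}

/-- The action of the symmetric group on the orbit of a composition. -/
def actOrb (w : Equiv.Perm (Fin n)) (χ : Orb μ) : Orb μ :=
  ⟨act w χ.1, fun a ↦ by
    rw [← χ.2 a]
    refine Fintype.card_congr (Equiv.subtypeEquiv w⁻¹ fun j ↦ Iff.rfl)⟩

theorem actOrb_mul (v w : Equiv.Perm (Fin n)) (χ : Orb μ) :
    actOrb (v * w) χ = actOrb v (actOrb w χ) := Subtype.ext (act_mul v w χ.1)

@[simp] theorem actOrb_one (χ : Orb μ) : actOrb 1 χ = χ := rfl

theorem actOrb_adjSwap_of_eq {i : Fin (n - 1)} {χ : Orb μ} (h : χ.1 (lo i) = χ.1 (hi i)) :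
    actOrb (adjSwap i) χ = χ := Subtype.ext (act_adjSwap_of_eq h)

theorem blockEquiv_val_lo_hi {a : Fin d} (b : Fin (μ.1 a - 1)) :
    (blockEquiv μ ⟨a, hi b⟩).1 = (blockEquiv μ ⟨a, lo b⟩).1 + 1 := by
  change (finSigmaFinEquiv _).1 = (finSigmaFinEquiv _).1 + 1
  rw [finSigmaFinEquiv_apply, finSigmaFinEquiv_apply]
  rfl

theorem firstChar_blockEquiv (a : Fin d) (b : Fin (μ.1 a)) :
    firstChar μ (blockEquiv μ ⟨a, b⟩) = a := by
  rw [firstChar, Equiv.symm_apply_apply]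

instance : Nonempty (Orb μ) :=
  ⟨⟨firstChar μ, fun a ↦ by
    have e : {j // firstChar μ j = a} ≃ {p : Σ a, Fin (μ.1 a) // p.1 = a} :=
      (blockEquiv μ).symm.subtypeEquiv fun j ↦ Iff.rfl
    rw [Fintype.card_congr e, Fintype.card_congr (Equiv.sigmaSubtype a), Fintype.card_fin]⟩⟩

theorem young_blockEquiv (x : ∀ a, Equiv.Perm (Fin (μ.1 a))) (a : Fin d) (b : Fin (μ.1 a)) :
    young μ x (blockEquiv μ ⟨a, b⟩) = blockEquiv μ ⟨a, x a b⟩ := by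
  simp only [young, Equiv.permCongr_apply, Equiv.symm_apply_apply]
  rfl

theorem perm_ext_block {v w : Equiv.Perm (Fin n)}
    (h : ∀ a b, v (blockEquiv μ ⟨a, b⟩) = w (blockEquiv μ ⟨a, b⟩)) : v = w := by
  refine Equiv.ext fun j ↦ ?_
  obtain ⟨⟨a, b⟩, rfl⟩ := (blockEquiv μ).surjective j
  exact h a b

theorem young_mul (x y : ∀ a, Equiv.Perm (Fin (μ.1 a))) :
    young μ (x * y) = young μ x * young μ y :=
  perm_ext_block (μ := μ) fun a b ↦ by
    rw [Equiv.Perm.mul_apply, young_blockEquiv, young_blockEquiv, young_blockEquiv]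
    rfl

theorem young_injective : Function.Injective (young μ) := by
  intro x y h
  funext a
  refine Equiv.ext fun b ↦ ?_
  have := congrArg (fun w ↦ w (blockEquiv μ ⟨a, b⟩)) h
  simpa [young_blockEquiv] using this

theorem young_one : young μ 1 = 1 := by
  have := young_mul (μ := μ) 1 1
  rwa [mul_one, left_eq_mul] at this

/-- The Young subgroup is the stabilizer of the distinguished character. -/
theorem exists_young_eq {w : Equiv.Perm (Fin n)} (h : act w (firstChar μ) = firstChar μ) :
    ∃ x, young μ x = w := by
  have key : ∀ a (b : Fin (μ.1 a)), ∃ b' : Fin (μ.1 a),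
      w (blockEquiv μ ⟨a, b⟩) = blockEquiv μ ⟨a, b'⟩ := by
    intro a b
    obtain ⟨⟨a', b'⟩, h'⟩ := (blockEquiv μ).surjective (w (blockEquiv μ ⟨a, b⟩))
    have ha : a' = a := by
      rw [← firstChar_blockEquiv a' b', h', ← congrFun h, act_apply_apply, firstChar_blockEquiv]
    subst ha
    exact ⟨b', h'.symm⟩
  choose g hg using key
  have hinj : ∀ a, Function.Injective (g a) := by
    intro a b b' hb
    have : w (blockEquiv μ ⟨a, b⟩) = w (blockEquiv μ ⟨a, b'⟩) := by rw [hg, hg, hb]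
    simpa using this
  refine ⟨fun a ↦ Equiv.ofBijective (g a) (Finite.injective_iff_bijective.1 (hinj a)), ?_⟩
  refine perm_ext_block (μ := μ) fun a b ↦ ?_
  rw [young_blockEquiv, hg]
  rfl

theorem act_young (x : ∀ a, Equiv.Perm (Fin (μ.1 a))) :
    act (young μ x) (firstChar μ) = firstChar μ := by
  funext j
  obtain ⟨k, rfl⟩ := (young μ x).surjective j
  obtain ⟨⟨a, b⟩, rfl⟩ := (blockEquiv μ).surjective k
  rw [act_apply_apply, young_blockEquiv, firstChar_blockEquiv, firstChar_blockEquiv]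

theorem act_minRep (χ : Orb μ) : act (minRep χ) (firstChar μ) = χ.1 :=
  (exists_minRep χ).choose_spec.1

theorem len_minRep_le (χ : Orb μ) {w : Equiv.Perm (Fin n)} (h : act w (firstChar μ) = χ.1) :
    len (minRep χ) ≤ len w := (exists_minRep χ).choose_spec.2 w h

theorem apply_minRep (χ : Orb μ) (a : Fin d) (b : Fin (μ.1 a)) :
    χ.1 (minRep χ (blockEquiv μ ⟨a, b⟩)) = a := by
  rw [← act_minRep, act_apply_apply, firstChar_blockEquiv]

/-- The distinguished coset representative is increasing on each block. -/
theorem strictMono_minRep (χ : Orb μ) (a : Fin d) :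
    StrictMono fun b : Fin (μ.1 a) ↦ minRep χ (blockEquiv μ ⟨a, b⟩) := by
  refine strictMono_of_lt_succ fun b ↦ ?_
  have hval := blockEquiv_val_lo_hi b
  have hlt := (blockEquiv μ ⟨a, hi b⟩).2
  let i : Fin (n - 1) := ⟨(blockEquiv μ ⟨a, lo b⟩).1, by omega⟩
  have h₁ : blockEquiv μ ⟨a, lo b⟩ = lo i := rfl
  have h₂ : blockEquiv μ ⟨a, hi b⟩ = hi i := Fin.ext hval
  have hχ : firstChar μ (lo i) = firstChar μ (hi i) := by
    rw [← h₁, ← h₂, firstChar_blockEquiv, firstChar_blockEquiv]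
  by_contra hcon
  have hdesc : IsDesc i (minRep χ)⁻¹ := by
    by_contra hnd
    rw [not_isDesc_iff, inv_inv, ← h₁, ← h₂] at hnd
    exact hcon hnd
  have hlen := len_of_isDesc hdesc
  rw [len_inv, ← len_inv (adjSwap i * _), mul_inv_rev, inv_inv, adjSwap_inv] at hlen
  have := len_minRep_le χ (w := minRep χ * adjSwap i) (by
    rw [act_mul, act_adjSwap_of_eq hχ, act_minRep])
  omega

/-- A coset representative increasing on each block is the distinguished one. -/
theorem eq_minRep {χ : Orb μ} {σ : Equiv.Perm (Fin n)} (hσ : act σ (firstChar μ) = χ.1)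
    (hmono : ∀ a, StrictMono fun b : Fin (μ.1 a) ↦ σ (blockEquiv μ ⟨a, b⟩)) : σ = minRep χ := by
  obtain ⟨x, hx⟩ := exists_young_eq (μ := μ) (w := (minRep χ)⁻¹ * σ) (by
    rw [act_mul, hσ, ← act_minRep χ, ← act_mul, inv_mul_cancel, act_one])
  have hσx : σ = minRep χ * young μ x := by rw [hx, mul_inv_cancel_left]
  have h1 : x = 1 := by
    funext a
    refine perm_eq_one_of_strictMono fun b b' hb ↦ ?_
    have := hmono a hb
    simp only [hσx, Equiv.Perm.mul_apply, young_blockEquiv] at this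
    exact (strictMono_minRep χ a).lt_iff_lt.1 this
  rw [hσx, h1, young_one, mul_one]

/-- If `χ` takes different values at `i` and `i + 1`, no block meets both of these entries, so
`s_i π` is still increasing on each block. -/
theorem minRep_actOrb_of_ne {i : Fin (n - 1)} {χ : Orb μ} (h : χ.1 (lo i) ≠ χ.1 (hi i)) :
    minRep (actOrb (adjSwap i) χ) = adjSwap i * minRep χ := by
  refine (eq_minRep ?_ fun a b b' hb ↦ ?_).symm
  · rw [act_mul, act_minRep]
    rfl
  · refine adjSwap_lt (strictMono_minRep χ a hb) ?_
    rintro ⟨h₁, h₂⟩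
    rw [← h₁, ← h₂, apply_minRep, apply_minRep] at h
    exact h rfl

/-- If `χ` takes the same value at `i` and `i + 1`, these are the images of adjacent positions of a
block under the distinguished representative. -/
theorem exists_block_of_eq {i : Fin (n - 1)} {χ : Orb μ} (h : χ.1 (lo i) = χ.1 (hi i)) :
    ∃ (a : Fin d) (b : Fin (μ.1 a - 1)), minRep χ (blockEquiv μ ⟨a, lo b⟩) = lo i ∧
      minRep χ (blockEquiv μ ⟨a, hi b⟩) = hi i := by
  obtain ⟨⟨a, b⟩, hb⟩ := (blockEquiv μ).surjective ((minRep χ)⁻¹ (lo i))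
  obtain ⟨⟨a', b'⟩, hb'⟩ := (blockEquiv μ).surjective ((minRep χ)⁻¹ (hi i))
  have e : minRep χ (blockEquiv μ ⟨a, b⟩) = lo i := by rw [hb, perm_apply_inv_self]
  have e' : minRep χ (blockEquiv μ ⟨a', b'⟩) = hi i := by rw [hb', perm_apply_inv_self]
  have ha : a = a' := by rw [← apply_minRep χ a b, ← apply_minRep χ a' b', e, e', h]
  subst ha
  have hmono := strictMono_minRep χ a
  have hlt : b < b' := by
    refine hmono.lt_iff_lt.1 ?_
    rw [e, e']
    exact lo_lt_hi i
  have hlt' : b.1 < b'.1 := hlt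
  have hb'μ := b'.2
  have hsucc : b'.1 = b.1 + 1 := by
    by_contra hne
    let c : Fin (μ.1 a) := ⟨b.1 + 1, by omega⟩
    have h₁ := hmono (show b < c from Nat.lt_succ_self b.1)
    have h₂ := hmono (show c < b' from show b.1 + 1 < b'.1 by omega)
    simp only [e, e'] at h₁ h₂
    have h₁' : i.1 < _ := h₁
    have h₂' : _ < i.1 + 1 := h₂
    omega
  refine ⟨a, ⟨b.1, by omega⟩, e, ?_⟩
  rw [← e']
  congr 3
  exact Fin.ext hsucc.symm

theorem exists_youngPart (w : Equiv.Perm (Fin n)) (χ : Orb μ) :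
    ∃ x, young μ x = (minRep (actOrb w χ))⁻¹ * w * minRep χ :=
  exists_young_eq (by
    rw [act_mul, act_minRep, act_mul]
    change act _ (actOrb w χ).1 = _
    rw [← act_minRep (actOrb w χ), ← act_mul, inv_mul_cancel, act_one])

/-- The component `π⁻¹ w π'` in the Young subgroup of a permutation `w` carrying the character `χ'`
to `χ`, where `π` and `π'` are the distinguished representatives attached to `χ` and `χ'`. -/
def youngPart (w : Equiv.Perm (Fin n)) (χ : Orb μ) : ∀ a, Equiv.Perm (Fin (μ.1 a)) :=
  (exists_youngPart w χ).choose

theorem young_youngPart (w : Equiv.Perm (Fin n)) (χ : Orb μ) :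
    young μ (youngPart w χ) = (minRep (actOrb w χ))⁻¹ * w * minRep χ :=
  (exists_youngPart w χ).choose_spec

/-- `youngPart` is a cocycle for the action on the orbit. -/
theorem youngPart_mul (v w : Equiv.Perm (Fin n)) (χ : Orb μ) :
    youngPart (v * w) χ = youngPart v (actOrb w χ) * youngPart w χ := by
  apply young_injective
  rw [young_mul, young_youngPart, young_youngPart, young_youngPart, actOrb_mul]
  group

@[simp] theorem youngPart_one (χ : Orb μ) : youngPart 1 χ = 1 := by
  apply young_injective
  rw [young_youngPart, young_one, actOrb_one, mul_one, inv_mul_cancel]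

theorem youngPart_adjSwap_of_ne {i : Fin (n - 1)} {χ : Orb μ} (h : χ.1 (lo i) ≠ χ.1 (hi i)) :
    youngPart (adjSwap i) χ = 1 := by
  apply young_injective
  rw [young_youngPart, young_one, minRep_actOrb_of_ne h]
  group

theorem youngPart_adjSwap_of_eq {i : Fin (n - 1)} {χ : Orb μ} (h : χ.1 (lo i) = χ.1 (hi i))
    {a : Fin d} {b : Fin (μ.1 a - 1)} (h₁ : minRep χ (blockEquiv μ ⟨a, lo b⟩) = lo i)
    (h₂ : minRep χ (blockEquiv μ ⟨a, hi b⟩) = hi i) :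
    youngPart (adjSwap i) χ = Pi.mulSingle a (adjSwap b) := by
  apply young_injective
  rw [young_youngPart, actOrb_adjSwap_of_eq h, mul_assoc, inv_mul_eq_iff_eq_mul]
  refine perm_ext_block (μ := μ) fun a' b' ↦ ?_
  rw [Equiv.Perm.mul_apply, Equiv.Perm.mul_apply, young_blockEquiv]
  by_cases ha : a' = a
  · subst ha
    rw [Pi.mulSingle_eq_same]
    by_cases hb : b' = lo b
    · rw [hb, h₁, adjSwap_lo, adjSwap_lo, h₂]
    · by_cases hb' : b' = hi b
      · rw [hb', h₂, adjSwap_hi, adjSwap_hi, h₁]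
      · rw [adjSwap_of_ne hb hb', adjSwap_of_ne]
        · rw [← h₁]
          simpa using hb
        · rw [← h₂]
          simpa using hb'
  · rw [Pi.mulSingle_eq_of_ne ha, Equiv.Perm.one_apply, adjSwap_of_ne]
    · rw [← h₁]
      intro hc
      simp only [EmbeddingLike.apply_eq_iff_eq, Sigma.mk.injEq] at hc
      exact ha hc.1
    · rw [← h₂]
      intro hc
      simp only [EmbeddingLike.apply_eq_iff_eq, Sigma.mk.injEq] at hc
      exact ha hc.1

/-- Descents inside a block correspond to descents of the whole permutation. -/
theorem isDesc_youngPart_iff {i : Fin (n - 1)} {w : Equiv.Perm (Fin n)} {χ : Orb μ}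
    {a : Fin d} {b : Fin (μ.1 a - 1)} (h₁ : minRep (actOrb w χ) (blockEquiv μ ⟨a, lo b⟩) = lo i)
    (h₂ : minRep (actOrb w χ) (blockEquiv μ ⟨a, hi b⟩) = hi i) :
    IsDesc b (youngPart w χ a) ↔ IsDesc i w := by
  have key : ∀ c : Fin (μ.1 a), w⁻¹ (minRep (actOrb w χ) (blockEquiv μ ⟨a, c⟩)) =
      minRep χ (blockEquiv μ ⟨a, (youngPart w χ a)⁻¹ c⟩) := by
    intro c
    have h := young_blockEquiv (youngPart w χ) a ((youngPart w χ a)⁻¹ c)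
    rw [perm_apply_inv_self, young_youngPart, Equiv.Perm.mul_apply,
      Equiv.Perm.mul_apply] at h
    rw [← h, perm_apply_inv_self, perm_inv_apply_self]
  rw [IsDesc, IsDesc, ← h₁, ← h₂, key, key]
  exact (strictMono_minRep χ a).lt_iff_lt.symm

end Young

/-! ### Roots of unity -/

section RootsOfUnity

variable {d : ℕ}

theorem exists_root_eq {ξ : Fin d → ℂ} (hd : 0 < d) (hξ : Function.Injective ξ)
    (hξd : ∀ a, ξ a ^ d = 1) {z : ℂ} (hz : z ^ d = 1) : ∃ a, ξ a = z := by
  have hsub : Finset.univ.image ξ ⊆ Polynomial.nthRootsFinset d (1 : ℂ) := by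
    intro x hx
    obtain ⟨a, -, rfl⟩ := Finset.mem_image.1 hx
    exact (Polynomial.mem_nthRootsFinset hd _).2 (hξd a)
  have hcard : (Polynomial.nthRootsFinset d (1 : ℂ)).card ≤ (Finset.univ.image ξ).card := by
    rw [Finset.card_image_of_injective _ hξ, Finset.card_univ, Fintype.card_fin,
      (Complex.isPrimitiveRoot_exp d hd.ne').card_nthRootsFinset]
  have := Finset.eq_of_subset_of_card_le hsub hcard
  have hmem : z ∈ Finset.univ.image ξ := by
    rw [this]
    exact (Polynomial.mem_nthRootsFinset hd _).2 hz
  obtain ⟨a, -, ha⟩ := Finset.mem_image.1 hmem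
  exact ⟨a, ha⟩

theorem sum_root_pow {ξ : Fin d → ℂ} (hd : 0 < d) (hξ : Function.Injective ξ)
    (hξd : ∀ a, ξ a ^ d = 1) {s : ℕ} (hs : s < d) :
    ∑ a, ξ a ^ s = if s = 0 then (d : ℂ) else 0 := by
  split_ifs with h
  · simp [h]
  · have hζ := Complex.isPrimitiveRoot_exp d hd.ne'
    generalize Complex.exp (2 * Real.pi * Complex.I / d) = ζ at hζ
    -- multiplication by a primitive root permutes the roots
    have hex : ∀ a, ∃ b, ξ b = ζ * ξ a := fun a ↦ exists_root_eq hd hξ hξd (by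
      rw [mul_pow, hζ.pow_eq_one, hξd, one_mul])
    choose σ hσ using hex
    have hζ0 : ζ ≠ 0 := hζ.ne_zero hd.ne'
    have hinj : Function.Injective σ := by
      intro a b hab
      apply hξ
      have := hσ a
      rw [hab, hσ b] at this
      exact (mul_left_cancel₀ hζ0 this).symm
    have hsum := (Finite.injective_iff_bijective.1 hinj).sum_comp fun a ↦ ξ a ^ s
    simp only [hσ, mul_pow] at hsum
    rw [← Finset.mul_sum] at hsum
    have hne : ζ ^ s ≠ 1 := hζ.pow_ne_one_of_pos_of_lt h hs
    have h0 : (ζ ^ s - 1) * ∑ a, ξ a ^ s = 0 := by rw [sub_mul, one_mul, hsum, sub_self]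
    exact (mul_eq_zero.1 h0).resolve_left (sub_ne_zero.2 hne)

/-- Orthogonality of the powers of two `d`-th roots of unity, `z'⁻¹` being written `z' ^ (d - 1)`. -/
theorem mean_pow {z z' : ℂ} (hd : 0 < d) (hz : z ^ d = 1) (hz' : z' ^ d = 1) :
    1 / (d : ℂ) * ∑ s ∈ Finset.range d, z ^ s * (z' ^ (d - 1)) ^ s = if z = z' then 1 else 0 := by
  have hd0 : (d : ℂ) ≠ 0 := Nat.cast_ne_zero.2 hd.ne'
  have hinv : z' * z' ^ (d - 1) = 1 := by rw [mul_pow_sub_one hd.ne', hz']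
  simp only [← mul_pow]
  split_ifs with h
  · subst h
    simp [hinv, hd0]
  · have hne : z * z' ^ (d - 1) ≠ 1 := by
      intro h1
      apply h
      have hz'0 : z' ^ (d - 1) ≠ 0 := right_ne_zero_of_mul_eq_one hinv
      exact mul_right_cancel₀ hz'0 (h1.trans hinv.symm)
    have hg := geom_sum_mul (z * z' ^ (d - 1)) d
    rw [mul_pow, hz, ← pow_mul, mul_comm (d - 1), pow_mul, hz', one_pow, one_mul, sub_self] at hg
    rw [(mul_eq_zero.1 hg).resolve_right (sub_ne_zero.2 hne), mul_zero]

end RootsOfUnity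

/-! ### Ordered products -/

section OrderedProducts

variable {R A : Type*} [CommRing R] [Ring A] [Algebra R A]

theorem prod_ofFn_mul_of_eigen {n : ℕ} (F : Fin n → A) (c : Fin n → R) {y : A}
    (h : ∀ j, F j * y = c j • y) : (List.ofFn F).prod * y = (∏ j, c j) • y := by
  induction n with
  | zero => simp
  | succ n ih =>
    rw [List.ofFn_succ, List.prod_cons, mul_assoc, ih _ (fun j ↦ c j.succ) fun j ↦ h j.succ,
      mul_smul_comm, h, smul_smul, Fin.prod_univ_succ, mul_comm]

theorem mul_prod_ofFn_of_eigen {n : ℕ} (F : Fin n → A) {t : A} (hcomm : ∀ j, Commute t (F j))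
    {r : R} {j : Fin n} (h : t * F j = r • F j) :
    t * (List.ofFn F).prod = r • (List.ofFn F).prod := by
  induction n with
  | zero => exact j.elim0
  | succ n ih =>
    rw [List.ofFn_succ, List.prod_cons]
    induction j using Fin.cases with
    | zero => rw [← mul_assoc, h, smul_mul_assoc]
    | succ j =>
      rw [← mul_assoc, (hcomm 0).eq, mul_assoc, ih _ (fun j ↦ hcomm j.succ) h, mul_smul_comm]

theorem sum_prod_ofFn {n : ℕ} {C : Type*} [Fintype C] (F : Fin n → C → A) :
    ∑ χ : Fin n → C, (List.ofFn fun j ↦ F j (χ j)).prod = (List.ofFn fun j ↦ ∑ c, F j c).prod := by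
  induction n with
  | zero => simp
  | succ n ih =>
    rw [← (Fin.consEquiv fun _ ↦ C).sum_comp, Fintype.sum_prod_type, List.ofFn_succ,
      List.prod_cons, ← ih, Finset.sum_mul]
    refine Finset.sum_congr rfl fun c _ ↦ ?_
    rw [Finset.mul_sum]
    refine Finset.sum_congr rfl fun χ _ ↦ ?_
    rw [List.ofFn_succ, List.prod_cons]
    simp [Fin.consEquiv]

theorem pow_mul_of_eigen {t y : A} {r : R} (h : t * y = r • y) (s : ℕ) :
    t ^ s * y = r ^ s • y := by
  induction s with
  | zero => simp
  | succ s ih => rw [pow_succ, mul_assoc, h, mul_smul_comm, ih, smul_smul, pow_succ']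

end OrderedProducts

/-! ### Idempotents and weight vectors in the Yokonuma--Hecke algebra -/

section Yokonuma

variable {d n : ℕ}

theorem const_mul (x y : ℂ) : const (x * y) = const x * const y := map_mul _ x y

theorem const_pow (x : ℂ) (s : ℕ) : const (x ^ s) = const x ^ s := map_pow _ x s

theorem const_sum {X : Type*} (s : Finset X) (f : X → ℂ) :
    const (∑ i ∈ s, f i) = ∑ i ∈ s, const (f i) := map_sum _ f s

@[simp] theorem const_one : const 1 = 1 := map_one _

@[simp] theorem const_zero : const 0 = 0 := map_zero _

theorem const_natCast (k : ℕ) : const k = k := map_natCast _ k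

theorem const_prod {X : Type*} (s : Finset X) (f : X → ℂ) :
    const (∏ i ∈ s, f i) = ∏ i ∈ s, const (f i) := map_prod _ f s

theorem yMk_surjective (d n : ℕ) : Function.Surjective (yMk d n) :=
  RingQuot.mkAlgHom_surjective GroundRing (YRel d n)

/-- The normalized generator `u⁻¹ g_i`. -/
def yGen (d : ℕ) {n : ℕ} (i : Fin (n - 1)) : Yokonuma d n := uInv • yG d i

/-- The idempotent `e_i` of the quadratic relation. -/
def yE (d : ℕ) {n : ℕ} (i : Fin (n - 1)) : Yokonuma d n := yMk d n (freeE d i)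

theorem yG_eq (i : Fin (n - 1)) : yG d i = u • yGen d i := by
  rw [yGen, smul_smul, mul_comm, uInv_mul_u, one_smul]

theorem isBraided_yGen : IsBraided (yGen d (n := n)) where
  comm i j h := by
    have := RingQuot.mkAlgHom_rel GroundRing (YRel.comm (d := d) i j (Or.inl h))
    rw [map_mul, map_mul] at this
    simp only [yGen, smul_mul_smul_comm]
    exact congrArg _ this
  braid i j h := by
    have := RingQuot.mkAlgHom_rel GroundRing (YRel.braid (d := d) i j h)
    simp only [map_mul] at this
    simp only [yGen, smul_mul_smul_comm]
    exact congrArg _ this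

theorem yGen_mul_self (i : Fin (n - 1)) :
    yGen d i * yGen d i = 1 + qParam • (yE d i * yGen d i) := by
  have h := RingQuot.mkAlgHom_rel GroundRing (YRel.quad (d := d) i)
  rw [map_mul, map_add, map_smul, AlgHom.commutes, map_mul] at h
  exact normalized_quad uInv_mul_u h

theorem yT_comm (i j : Fin n) : yT d i * yT d j = yT d j * yT d i := by
  have h := RingQuot.mkAlgHom_rel GroundRing (YRel.t_comm (d := d) i j)
  rw [map_mul, map_mul] at h
  exact h

theorem yT_pow (j : Fin n) : yT d j ^ d = 1 := by
  have h := RingQuot.mkAlgHom_rel GroundRing (YRel.t_pow (d := d) j)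
  rw [map_pow, map_one] at h
  exact h

theorem yGen_mul_yT (i : Fin (n - 1)) (j : Fin n) :
    yGen d i * yT d j = yT d (adjSwap i j) * yGen d i := by
  have h := RingQuot.mkAlgHom_rel GroundRing (YRel.g_t (d := d) i j)
  rw [map_mul, map_mul] at h
  rw [yGen, smul_mul_assoc, mul_smul_comm]
  exact congrArg _ h

theorem gTilde_eq (w : Equiv.Perm (Fin n)) : gTilde d w = braidLift (yGen d) w := rfl

theorem yWord_eq {l : List (Fin (n - 1))} (hl : IsReducedWord l) :
    yWord d l = gTilde d (wordProd l) := isBraided_yGen.prod_eq hl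

@[simp] theorem gTilde_one : gTilde d (1 : Equiv.Perm (Fin n)) = 1 :=
  isBraided_yGen.braidLift_one

theorem yGen_mul_gTilde (i : Fin (n - 1)) (w : Equiv.Perm (Fin n)) :
    yGen d i * gTilde d w = gTilde d (adjSwap i * w) +
      (if IsDesc i w then qParam else 0) • (yE d i * gTilde d w) := by
  by_cases h : IsDesc i w
  · have h' : ¬IsDesc i (adjSwap i * w) := by rw [isDesc_adjSwap_mul, not_not]; exact h
    have e : yGen d i * gTilde d (adjSwap i * w) = gTilde d w := by
      rw [gTilde_eq, isBraided_yGen.mul_braidLift h', adjSwap_mul_cancel, gTilde_eq]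
    rw [if_pos h, ← e, ← mul_assoc, yGen_mul_self, add_mul, one_mul, smul_mul_assoc, mul_assoc, e]
  · rw [if_neg h, zero_smul, add_zero, gTilde_eq, isBraided_yGen.mul_braidLift h, gTilde_eq]

variable {ξ : Fin d → ℂ}

/-- The factor of the idempotent `E_χ` belonging to one generator `t`, of eigenvalue `z`. -/
def eigenIdem (d : ℕ) {A : Type*} [Ring A] [Algebra GroundRing A] (t : A) (z : ℂ) : A :=
  const (1 / (d : ℂ)) • ∑ s ∈ Finset.range d, const (z ^ s) • (t ^ (d - 1)) ^ s

theorem idem_eq (χ : Fin n → Fin d) :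
    idem ξ χ = (List.ofFn fun j ↦ eigenIdem d (yT d j) (ξ (χ j))).prod := rfl

section EigenIdem

variable {A : Type*} [Ring A] [Algebra GroundRing A] {t y : A} {z z' : ℂ}

theorem eigenIdem_mul (hd : 0 < d) (hz : z ^ d = 1) (hz' : z' ^ d = 1)
    (h : t * y = const z' • y) :
    eigenIdem d t z * y = (if z = z' then 1 else 0 : GroundRing) • y := by
  have h₁ : ∀ s, (const (z ^ s) • (t ^ (d - 1)) ^ s) * y = const (z ^ s * (z' ^ (d - 1)) ^ s) • y := by
    intro s
    rw [smul_mul_assoc, pow_mul_of_eigen (pow_mul_of_eigen h (d - 1)) s, smul_smul, const_mul,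
      const_pow (z' ^ (d - 1)), const_pow z']
  rw [eigenIdem, smul_mul_assoc, Finset.sum_mul]
  simp only [h₁]
  rw [← Finset.sum_smul, smul_smul, ← const_sum, ← const_mul, mean_pow hd hz hz']
  split_ifs <;> simp

theorem mean_mul (hd : 0 < d) (hz : z ^ d = 1) (hz' : z' ^ d = 1) {t' : A}
    (h : t * y = const z • y) (h' : t' * y = const z' • y) :
    (const (1 / (d : ℂ)) • ∑ s ∈ Finset.range d, t ^ s * (t' ^ (d - 1)) ^ s) * y =
      if z = z' then y else 0 := by
  have h₁ : ∀ s, t ^ s * (t' ^ (d - 1)) ^ s * y = const (z ^ s * (z' ^ (d - 1)) ^ s) • y := by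
    intro s
    rw [mul_assoc, pow_mul_of_eigen (pow_mul_of_eigen h' (d - 1)) s, mul_smul_comm,
      pow_mul_of_eigen h, smul_smul, const_mul, const_pow, const_pow _ s, const_pow, mul_comm]
  rw [smul_mul_assoc, Finset.sum_mul]
  simp only [h₁]
  rw [← Finset.sum_smul, smul_smul, ← const_sum, ← const_mul, mean_pow hd hz hz']
  split_ifs <;> simp

theorem mul_eigenIdem (hd : 0 < d) (ht : t ^ d = 1) (hz : z ^ d = 1) :
    t * eigenIdem d t z = const z • eigenIdem d t z := by
  have hinv : t * t ^ (d - 1) = 1 := by rw [mul_pow_sub_one hd.ne', ht]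
  let y : A := const z • t ^ (d - 1)
  have hy : y ^ d = 1 := by
    rw [smul_pow, ← const_pow, hz, const_one, one_smul, ← pow_mul, mul_comm, pow_mul, ht, one_pow]
  have hE : eigenIdem d t z = const (1 / (d : ℂ)) • ∑ s ∈ Finset.range d, y ^ s := by
    simp only [eigenIdem, y, smul_pow, const_pow]
  have hyE : y * eigenIdem d t z = eigenIdem d t z := by
    rw [hE, mul_smul_comm]
    congr 1
    have := mul_geom_sum y d
    rw [hy, sub_self, sub_mul, one_mul, sub_eq_zero] at this
    exact this
  conv_lhs => rw [← hyE]
  rw [← mul_assoc, mul_smul_comm, hinv, smul_mul_assoc, one_mul]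

theorem sum_eigenIdem (hd : 0 < d) (hξ : Function.Injective ξ) (hξd : ∀ a, ξ a ^ d = 1) :
    ∑ a, eigenIdem d t (ξ a) = 1 := by
  have hd0 : (d : ℂ) ≠ 0 := Nat.cast_ne_zero.2 hd.ne'
  simp only [eigenIdem, ← Finset.smul_sum]
  rw [Finset.sum_comm]
  have : ∀ s ∈ Finset.range d, ∑ a, const (ξ a ^ s) • (t ^ (d - 1)) ^ s =
      const (if s = 0 then (d : ℂ) else 0) • (t ^ (d - 1)) ^ s := by
    intro s hs
    rw [← Finset.sum_smul, ← const_sum, sum_root_pow hd hξ hξd (Finset.mem_range.1 hs)]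
  rw [Finset.sum_congr rfl this, Finset.sum_eq_single 0]
  · rw [if_pos rfl, pow_zero, smul_smul, ← const_mul, one_div_mul_cancel hd0, const_one, one_smul]
  · intro s _ hs
    rw [if_neg hs, const_zero, zero_smul]
  · intro h
    exact absurd (Finset.mem_range.2 hd) h

end EigenIdem

/-- The vector `y` of an algebra over `Y_{d,n}` is an eigenvector of the `t_j`, with eigenvalues
given by the character `ψ`. -/
def IsWeight {A : Type*} [Ring A] [Algebra GroundRing A] (ξ : Fin d → ℂ)
    (π : Yokonuma d n →ₐ[GroundRing] A) (ψ : Fin n → Fin d) (y : A) : Prop :=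
  ∀ j, π (yT d j) * y = const (ξ (ψ j)) • y

section Weights

variable {A : Type*} [Ring A] [Algebra GroundRing A] {π : Yokonuma d n →ₐ[GroundRing] A}
  {ψ : Fin n → Fin d} {y : A}

theorem IsWeight.idem_mul (hd : 0 < d) (hξ : Function.Injective ξ) (hξd : ∀ a, ξ a ^ d = 1)
    (h : IsWeight ξ π ψ y) (χ : Fin n → Fin d) :
    π (idem ξ χ) * y = if χ = ψ then y else 0 := by
  have hF : ∀ j, π (eigenIdem d (yT d j) (ξ (χ j))) = eigenIdem d (π (yT d j)) (ξ (χ j)) := by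
    intro j
    simp only [eigenIdem, map_smul, map_sum, map_pow]
  rw [idem_eq, map_list_prod, List.map_ofFn]
  rw [prod_ofFn_mul_of_eigen _ (fun j ↦ if χ j = ψ j then (1 : GroundRing) else 0)]
  · rw [Finset.prod_ite_zero]
    simp [funext_iff]
  · intro j
    rw [Function.comp_apply, hF, eigenIdem_mul hd (hξd _) (hξd _) (h j)]
    simp only [hξ.eq_iff]

theorem IsWeight.yE_mul (hd : 0 < d) (hξ : Function.Injective ξ) (hξd : ∀ a, ξ a ^ d = 1)
    (h : IsWeight ξ π ψ y) (i : Fin (n - 1)) :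
    π (yE d i) * y = if ψ (lo i) = ψ (hi i) then y else 0 := by
  have hE : π (yE d i) = const (1 / (d : ℂ)) • ∑ s ∈ Finset.range d,
      π (yT d (lo i)) ^ s * (π (yT d (hi i)) ^ (d - 1)) ^ s := by
    simp only [yE, freeE, map_smul, map_sum, map_mul, map_pow]
    rfl
  rw [hE, mean_mul hd (hξd _) (hξd _) (h (lo i)) (h (hi i))]
  simp only [hξ.eq_iff]

theorem IsWeight.tMonomial_mul (h : IsWeight ξ π ψ y) (k : Fin n → Fin d) :
    π (tMonomial d k) * y = const (∏ j, ξ (ψ j) ^ (k j).1) • y := by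
  rw [tMonomial, map_list_prod, List.map_ofFn]
  rw [prod_ofFn_mul_of_eigen _ (fun j ↦ const (ξ (ψ j)) ^ (k j).1)]
  · simp only [const_prod, const_pow]
  · intro j
    rw [Function.comp_apply, map_pow]
    exact pow_mul_of_eigen (h j) _

theorem IsWeight.yGen_mul (h : IsWeight ξ π ψ y) (i : Fin (n - 1)) :
    IsWeight ξ π (act (adjSwap i) ψ) (π (yGen d i) * y) := by
  intro j
  have e : yT d j * yGen d i = yGen d i * yT d (adjSwap i j) := by
    rw [yGen_mul_yT, adjSwap_adjSwap]
  rw [← mul_assoc, ← map_mul, e, map_mul, mul_assoc, h, mul_smul_comm, act_adjSwap]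

theorem IsWeight.gTilde_mul (h : IsWeight ξ π ψ y) (w : Equiv.Perm (Fin n)) :
    IsWeight ξ π (act w ψ) (π (gTilde d w) * y) := by
  induction w using perm_induction with
  | one => rwa [gTilde_one, map_one, one_mul, act_one]
  | step i w hw ih =>
    rw [gTilde_eq, ← isBraided_yGen.mul_braidLift hw, map_mul, mul_assoc, act_mul]
    exact ih.yGen_mul i

/-- Right multiplication by a weight vector turns left multiplication by the generators into the
deformed action on the symmetric group, with colours given by the weight. -/
theorem IsWeight.yGen_mul_gTilde_mul (hd : 0 < d) (hξ : Function.Injective ξ)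
    (hξd : ∀ a, ξ a ^ d = 1) (h : IsWeight ξ π ψ y) (i : Fin (n - 1)) (w : Equiv.Perm (Fin n)) :
    π (yGen d i) * (π (gTilde d w) * y) = π (gTilde d (adjSwap i * w)) * y +
      descCoeff qParam ψ (w⁻¹ (lo i)) (w⁻¹ (hi i)) • (π (gTilde d w) * y) := by
  rw [← mul_assoc, ← map_mul, yGen_mul_gTilde, map_add, add_mul, map_smul, smul_mul_assoc, map_mul,
    mul_assoc, (h.gTilde_mul w).yE_mul hd hξ hξd]
  congr 1
  change _ • (if ψ (w⁻¹ (lo i)) = ψ (w⁻¹ (hi i)) then _ else _) = _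
  rw [descCoeff]
  by_cases h₁ : IsDesc i w
  · have h₁' : w⁻¹ (hi i) < w⁻¹ (lo i) := h₁
    rw [if_pos h₁]
    by_cases h₂ : ψ (w⁻¹ (lo i)) = ψ (w⁻¹ (hi i))
    · rw [if_pos h₂, if_pos ⟨h₁', h₂⟩]
    · rw [if_neg h₂, if_neg (fun hc ↦ h₂ hc.2), smul_zero, zero_smul]
  · have h₁' : ¬w⁻¹ (hi i) < w⁻¹ (lo i) := h₁
    rw [if_neg h₁, zero_smul, if_neg (fun hc ↦ h₁' hc.1), zero_smul]

end Weights

variable (hd : 0 < d) (hξ : Function.Injective ξ) (hξd : ∀ a, ξ a ^ d = 1)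
include hd hξ hξd

omit hξ in
theorem isWeight_idem (χ : Fin n → Fin d) :
    IsWeight ξ (AlgHom.id GroundRing (Yokonuma d n)) χ (idem ξ χ) := by
  intro j
  rw [AlgHom.id_apply, idem_eq]
  refine mul_prod_ofFn_of_eigen _ (fun k ↦ ?_) (mul_eigenIdem hd (yT_pow j) (hξd _))
  rw [eigenIdem]
  refine Commute.smul_right (Commute.sum_right _ _ _ fun s _ ↦ Commute.smul_right ?_ _) _
  exact ((show Commute (yT d j) (yT d k) from yT_comm j k).pow_right _).pow_right _

theorem sum_idem : ∑ χ : Fin n → Fin d, idem ξ χ = 1 := by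
  simp only [idem_eq]
  rw [sum_prod_ofFn fun j c ↦ eigenIdem d (yT d j) (ξ c)]
  simp only [sum_eigenIdem hd hξ hξd]
  simp

omit hξ in
theorem isWeight_gTilde_mul_idem (w : Equiv.Perm (Fin n)) (χ : Fin n → Fin d) :
    IsWeight ξ (AlgHom.id GroundRing (Yokonuma d n)) (act w χ) (gTilde d w * idem ξ χ) :=
  (isWeight_idem hd hξd χ).gTilde_mul w

/-- `g̃_w E_χ = E_{w(χ)} g̃_w`. -/
theorem gTilde_mul_idem (w : Equiv.Perm (Fin n)) (χ : Fin n → Fin d) :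
    gTilde d w * idem ξ χ = idem ξ (act w χ) * gTilde d w := by
  have h₁ : ∀ χ', idem ξ (act w χ) * (gTilde d w * idem ξ χ') =
      if χ = χ' then gTilde d w * idem ξ χ' else 0 := by
    intro χ'
    have h := (isWeight_gTilde_mul_idem hd hξd w χ').idem_mul hd hξ hξd (act w χ)
    rw [AlgHom.id_apply] at h
    rw [h]
    have hinj : act w χ = act w χ' ↔ χ = χ' := by
      constructor
      · intro h
        rw [← act_one χ, ← act_one χ', ← inv_mul_cancel w, act_mul, act_mul, h]
      · rintro rfl; rfl
    simp only [hinj]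
  rw [← mul_one (idem ξ (act w χ) * gTilde d w), ← sum_idem hd hξ hξd, Finset.mul_sum]
  simp only [mul_assoc, h₁]
  simp

theorem yGen_mul_gTilde_mul_idem (i : Fin (n - 1)) (w : Equiv.Perm (Fin n)) (χ : Fin n → Fin d) :
    yGen d i * (gTilde d w * idem ξ χ) = gTilde d (adjSwap i * w) * idem ξ χ +
      descCoeff qParam χ (w⁻¹ (lo i)) (w⁻¹ (hi i)) • (gTilde d w * idem ξ χ) :=
  (isWeight_idem hd hξd χ).yGen_mul_gTilde_mul hd hξ hξd i w

/-- The elements `g̃_w E_χ` span the Yokonuma--Hecke algebra. -/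
theorem span_gTilde_mul_idem : Submodule.span GroundRing (Set.range
    fun p : (Fin n → Fin d) × Equiv.Perm (Fin n) ↦ gTilde d p.2 * idem ξ p.1) = ⊤ := by
  rw [eq_top_iff]
  rintro x -
  rw [← mul_one x]
  refine mul_mem_of_generators (yMk_surjective d n) ?_ x 1 ?_
  · intro i a ha
    induction ha using Submodule.span_induction with
    | mem a ha =>
      obtain ⟨⟨χ, w⟩, rfl⟩ := ha
      cases i with
      | g i =>
        change yG d i * _ ∈ _
        rw [yG_eq, smul_mul_assoc, yGen_mul_gTilde_mul_idem hd hξ hξd]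
        exact Submodule.smul_mem _ _ (Submodule.add_mem _
          (Submodule.subset_span ⟨(χ, adjSwap i * w), rfl⟩)
          (Submodule.smul_mem _ _ (Submodule.subset_span ⟨(χ, w), rfl⟩)))
      | t j =>
        change yT d j * _ ∈ _
        have := isWeight_gTilde_mul_idem hd hξd w χ j
        rw [AlgHom.id_apply] at this
        rw [this]
        exact Submodule.smul_mem _ _ (Submodule.subset_span ⟨(χ, w), rfl⟩)
    | zero => rw [mul_zero]; exact Submodule.zero_mem _
    | add a b _ _ ha hb => rw [mul_add]; exact Submodule.add_mem _ ha hb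
    | smul r a _ ha => rw [mul_smul_comm]; exact Submodule.smul_mem _ _ ha
  · rw [← sum_idem hd hξ hξd]
    exact Submodule.sum_mem _ fun χ _ ↦ Submodule.subset_span ⟨(χ, 1), by simp⟩

/-- `t^k = ∑_χ χ(t^k) E_χ`. -/
theorem tMonomial_eq_sum (k : Fin n → Fin d) :
    tMonomial d k = ∑ χ : Fin n → Fin d, const (∏ j, ξ (χ j) ^ (k j).1) • idem ξ χ := by
  rw [← mul_one (tMonomial d k), ← sum_idem hd hξ hξd, Finset.mul_sum]
  exact Finset.sum_congr rfl fun χ _ ↦ (isWeight_idem hd hξd χ).tMonomial_mul k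

/-- Fourier inversion: the idempotents are combinations of the monomials in the `t_j`. -/
theorem idem_eq_sum (χ : Fin n → Fin d) :
    idem ξ χ = ∑ k : Fin n → Fin d,
      const (∏ j, 1 / (d : ℂ) * (ξ (χ j) ^ (d - 1)) ^ (k j).1) • tMonomial d k := by
  have key : ∀ ψ : Fin n → Fin d, ∑ k : Fin n → Fin d,
      (∏ j, 1 / (d : ℂ) * (ξ (χ j) ^ (d - 1)) ^ (k j).1) * ∏ j, ξ (ψ j) ^ (k j).1 =
        if ψ = χ then 1 else 0 := by
    intro ψ
    have h : ∀ j, ∑ k : Fin d, 1 / (d : ℂ) * (ξ (χ j) ^ (d - 1)) ^ k.1 * ξ (ψ j) ^ k.1 =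
        if ψ j = χ j then 1 else 0 := by
      intro j
      rw [Fin.sum_univ_eq_sum_range
        (fun s ↦ 1 / (d : ℂ) * (ξ (χ j) ^ (d - 1)) ^ s * ξ (ψ j) ^ s) d]
      have h' := mean_pow hd (hξd (ψ j)) (hξd (χ j))
      simp only [hξ.eq_iff] at h'
      rw [← h', Finset.mul_sum]
      exact Finset.sum_congr rfl fun s _ ↦ by ring
    simp only [← Finset.prod_mul_distrib]
    rw [← Fintype.prod_sum fun j (k : Fin d) ↦
      1 / (d : ℂ) * (ξ (χ j) ^ (d - 1)) ^ k.1 * ξ (ψ j) ^ k.1]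
    simp only [h]
    rw [Finset.prod_ite_zero]
    simp [funext_iff]
  simp only [tMonomial_eq_sum hd hξ hξd, Finset.smul_sum, smul_smul, ← const_mul]
  rw [Finset.sum_comm]
  simp only [← Finset.sum_smul, ← const_sum, key]
  rw [Finset.sum_eq_single χ]
  · simp
  · intro ψ _ hψ
    simp [hψ]
  · simp

/-- The elements `t^k g̃_w` span the Yokonuma--Hecke algebra. -/
theorem span_tMonomial_mul_gTilde : Submodule.span GroundRing (Set.range
    fun p : (Fin n → Fin d) × Equiv.Perm (Fin n) ↦ tMonomial d p.1 * gTilde d p.2) = ⊤ := by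
  rw [eq_top_iff, ← span_gTilde_mul_idem hd hξ hξd, Submodule.span_le]
  rintro _ ⟨⟨χ, w⟩, rfl⟩
  simp only [gTilde_mul_idem hd hξ hξd, SetLike.mem_coe]
  rw [idem_eq_sum hd hξ hξd, Finset.sum_mul]
  refine Submodule.sum_mem _ fun k _ ↦ ?_
  rw [smul_mul_assoc]
  exact Submodule.smul_mem _ _ (Submodule.subset_span ⟨(k, w), rfl⟩)

end Yokonuma

/-! ### Dual families in matrix algebras, direct products and tensor products -/

section Transfer

variable {R K : Type*} [CommRing R] [Field K] [Algebra R K]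

section AlgEquiv

variable {A B X : Type*} [Ring A] [Algebra R A] [Ring B] [Algebra R B] [Fintype X]
  {f : B →ₗ[R] R} {b b' : X → B}

theorem IsSymmDual.comp_algEquiv (h : IsSymmDual f b b') (e : A ≃ₐ[R] B) :
    IsSymmDual (f.comp e.toLinearMap) (fun i ↦ e.symm (b i)) (fun i ↦ e.symm (b' i)) where
  trace x y := by
    change f (e (x * y)) = f (e (y * x))
    rw [map_mul e, map_mul e, h.trace]
  sum_left x := by
    apply e.injective
    conv_rhs => rw [← h.sum_left (e x)]
    simp

theorem CasimirInvertible.comp_algEquiv (h : CasimirInvertible R K b b') (e : A ≃ₐ[R] B) :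
    CasimirInvertible R K (fun i ↦ e.symm (b i)) (fun i ↦ e.symm (b' i)) := by
  obtain ⟨z', r, hr, hz⟩ := h
  refine ⟨e.symm z', r, hr, e.injective ?_⟩
  simp [casimir, ← hz]

end AlgEquiv

section Matrix

variable {B X O : Type*} [Ring B] [Algebra R B] [Fintype X] [Fintype O] [DecidableEq O]
  {f : B →ₗ[R] R} {b b' : X → B}

theorem trace_mul_single (x : Matrix O O B) (p q : O) (c : B) :
    Matrix.trace (x * Matrix.single q p c) = x p q * c := by
  rw [Matrix.trace, Finset.sum_eq_single p]
  · simp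
  · intro i _ hi
    simp [Matrix.diag_apply, Matrix.mul_single_apply_of_ne, hi]
  · simp

/-- The form `f ∘ Tr` on a matrix algebra. -/
def matrixForm (O : Type*) [Fintype O] (f : B →ₗ[R] R) : Matrix O O B →ₗ[R] R :=
  f.comp (Matrix.traceLinearMap O R B)

theorem IsSymmDual.matrix (h : IsSymmDual f b b') :
    IsSymmDual (matrixForm O f) (fun i : O × O × X ↦ Matrix.single i.1 i.2.1 (b i.2.2))
      (fun i ↦ Matrix.single i.2.1 i.1 (b' i.2.2)) where
  trace x y := by
    change f (Matrix.trace (x * y)) = f (Matrix.trace (y * x))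
    simp only [Matrix.trace, Matrix.diag_apply, Matrix.mul_apply, map_sum]
    rw [Finset.sum_comm]
    simp only [h.trace]
  sum_left x := by
    have e : ∀ i : O × O × X, matrixForm O f (x * Matrix.single i.2.1 i.1 (b' i.2.2)) •
        Matrix.single i.1 i.2.1 (b i.2.2) =
          Matrix.single i.1 i.2.1 (f (x i.1 i.2.1 * b' i.2.2) • b i.2.2) := by
      intro i
      change f (Matrix.trace _) • _ = _
      rw [trace_mul_single, Matrix.smul_single]
    simp only [e, Fintype.sum_prod_type]
    conv_rhs => rw [Matrix.matrix_eq_sum_single x]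
    refine Finset.sum_congr rfl fun p _ ↦ Finset.sum_congr rfl fun q _ ↦ ?_
    conv_rhs => rw [← h.sum_left (x p q)]
    ext p' q'
    simp [Matrix.sum_apply, Matrix.single_apply]

/-- The Casimir element of a matrix algebra is the scalar matrix `card O • casimir b b'`; hence the
assumption on the characteristic. -/
theorem CasimirInvertible.matrix [CharZero K] [Nonempty O]
    (h : CasimirInvertible R K b b') :
    CasimirInvertible R K (fun i : O × O × X ↦ Matrix.single i.1 i.2.1 (b i.2.2))
      (fun i ↦ Matrix.single i.2.1 i.1 (b' i.2.2)) := by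
  obtain ⟨z', r, hr, hz⟩ := h
  refine ⟨Matrix.diagonal fun _ ↦ z', Fintype.card O * r, ?_, ?_⟩
  · rw [map_mul, map_natCast]
    exact mul_ne_zero (Nat.cast_ne_zero.2 Fintype.card_ne_zero) hr
  · have hc : casimir (fun i : O × O × X ↦ Matrix.single i.1 i.2.1 (b i.2.2))
        (fun i ↦ Matrix.single i.2.1 i.1 (b' i.2.2)) =
          (Fintype.card O : R) • Matrix.diagonal fun _ ↦ casimir b b' := by
      ext p q
      simp only [casimir, Matrix.single_mul_single_same, Fintype.sum_prod_type, Matrix.sum_apply,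
        Matrix.smul_apply, Matrix.diagonal_apply, Matrix.single_apply]
      by_cases hpq : p = q
      · subst hpq
        rw [Finset.sum_eq_single p]
        · simp [Nat.cast_smul_eq_nsmul]
        · intro p' _ hp'
          simp [hp']
        · simp
      · rw [if_neg hpq, smul_zero]
        refine Finset.sum_eq_zero fun p' _ ↦ Finset.sum_eq_zero fun q' _ ↦
          Finset.sum_eq_zero fun i _ ↦ if_neg ?_
        rintro ⟨rfl, rfl⟩
        exact hpq rfl
    rw [hc, smul_mul_assoc, Matrix.diagonal_mul_diagonal, mul_smul]
    simp only [hz]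
    rw [← Matrix.smul_one_eq_diagonal, Matrix.smul_one_eq_diagonal]
    congr 1
    ext p q
    simp [Matrix.diagonal_apply, Matrix.one_apply]

end Matrix

section Pi

variable {J : Type*} [Fintype J] [DecidableEq J] {B X : J → Type*} [∀ j, Ring (B j)]
  [∀ j, Algebra R (B j)] [∀ j, Fintype (X j)] {f : ∀ j, B j →ₗ[R] R} {b b' : ∀ j, X j → B j}

/-- The form `⊕ f_j` on a direct product of algebras. -/
def piForm (f : ∀ j, B j →ₗ[R] R) : (∀ j, B j) →ₗ[R] R := ∑ j, (f j).comp (LinearMap.proj j)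

omit [DecidableEq J] in
theorem piForm_apply (x : ∀ j, B j) : piForm f x = ∑ j, f j (x j) := by
  simp [piForm]

theorem IsSymmDual.pi (h : ∀ j, IsSymmDual (f j) (b j) (b' j)) :
    IsSymmDual (piForm f) (fun i : Σ j, X j ↦ Pi.single i.1 (b i.1 i.2))
      (fun i ↦ Pi.single i.1 (b' i.1 i.2)) where
  trace x y := by
    simp only [piForm_apply, Pi.mul_apply, (h _).trace]
  sum_left x := by
    have e : ∀ i : Σ j, X j, piForm f (x * Pi.single i.1 (b' i.1 i.2)) • Pi.single i.1 (b i.1 i.2) =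
        Pi.single (M := B) i.1 (f i.1 (x i.1 * b' i.1 i.2) • b i.1 i.2) := by
      rintro ⟨j, i⟩
      rw [piForm_apply, Finset.sum_eq_single j]
      · simp [Pi.single_smul]
      · intro j' _ hj'
        simp [hj']
      · simp
    simp only [e, Fintype.sum_sigma]
    conv_rhs => rw [← Finset.univ_sum_single x]
    refine Finset.sum_congr rfl fun j _ ↦ ?_
    conv_rhs => rw [← (h j).sum_left (x j)]
    exact (map_sum (AddMonoidHom.single B j) _ _).symm

theorem casimir_pi : casimir (fun i : Σ j, X j ↦ Pi.single i.1 (b i.1 i.2))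
    (fun i ↦ Pi.single i.1 (b' i.1 i.2)) = fun j ↦ casimir (b j) (b' j) := by
  rw [← Finset.univ_sum_single fun j ↦ casimir (b j) (b' j), casimir, Fintype.sum_sigma]
  refine Finset.sum_congr rfl fun j _ ↦ ?_
  simp only [← Pi.single_mul]
  exact (map_sum (AddMonoidHom.single B j) _ _).symm

theorem CasimirInvertible.pi (h : ∀ j, CasimirInvertible R K (b j) (b' j)) :
    CasimirInvertible R K (fun i : Σ j, X j ↦ Pi.single i.1 (b i.1 i.2))
      (fun i ↦ Pi.single i.1 (b' i.1 i.2)) := by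
  choose z' r hr hz using h
  refine ⟨fun j ↦ (∏ k ∈ Finset.univ.erase j, r k) • z' j, ∏ j, r j, ?_, ?_⟩
  · rw [map_prod]
    exact Finset.prod_ne_zero_iff.2 fun j _ ↦ hr j
  · rw [casimir_pi]
    funext j
    rw [Pi.mul_apply, mul_smul_comm, hz, smul_smul, Finset.prod_erase_mul _ _ (Finset.mem_univ j)]
    rfl

end Pi

section Tensor

variable {d : ℕ} {B X : Fin d → Type*} [∀ a, Ring (B a)] [∀ a, Algebra R (B a)]
  [∀ a, Fintype (X a)] {f : ∀ a, B a →ₗ[R] R} {b b' : ∀ a, X a → B a}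

/-- The form `f_1 ⊗ ⋯ ⊗ f_d` on a tensor product of algebras. -/
def piTensorForm (f : ∀ a, B a →ₗ[R] R) : (⨂[R] a, B a) →ₗ[R] R :=
  PiTensorProduct.lift
    ((MultilinearMap.mkPiAlgebra R (Fin d) R).compLinearMap fun a ↦ f a)

theorem piTensorForm_tprod (x : ∀ a, B a) :
    piTensorForm f (PiTensorProduct.tprod R x) = ∏ a, f a (x a) := by
  simp [piTensorForm]

theorem IsSymmDual.piTensor (h : ∀ a, IsSymmDual (f a) (b a) (b' a)) :
    IsSymmDual (piTensorForm f)
      (fun i : ∀ a, X a ↦ PiTensorProduct.tprod R fun a ↦ b a (i a))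
      (fun i ↦ PiTensorProduct.tprod R fun a ↦ b' a (i a)) where
  trace x y := by
    have e : (LinearMap.mul R (⨂[R] a, B a)).compr₂ (piTensorForm f) =
        ((LinearMap.mul R (⨂[R] a, B a)).compr₂ (piTensorForm f)).flip := by
      ext x y
      simp only [LinearMap.compMultilinearMap_apply, LinearMap.compr₂_apply, LinearMap.mul_apply',
        LinearMap.flip_apply, PiTensorProduct.tprod_mul_tprod, piTensorForm_tprod, Pi.mul_apply,
        (h _).trace]
    exact LinearMap.congr_fun₂ e x y
  sum_left x := by
    have e : ∑ i : ∀ a, X a, (((piTensorForm f).comp (LinearMap.mulRight R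
        (PiTensorProduct.tprod R fun a ↦ b' a (i a)))).smulRight
          (PiTensorProduct.tprod R fun a ↦ b a (i a))) = LinearMap.id := by
      ext x
      have hx : (fun a ↦ ∑ i, f a (x a * b' a i) • b a i) = x :=
        funext fun a ↦ (h a).sum_left (x a)
      simp only [LinearMap.compMultilinearMap_apply, LinearMap.sum_apply,
        LinearMap.smulRight_apply, LinearMap.comp_apply, LinearMap.mulRight_apply,
        PiTensorProduct.tprod_mul_tprod, piTensorForm_tprod, Pi.mul_apply, LinearMap.id_apply]
      conv_rhs => rw [← hx]
      rw [MultilinearMap.map_sum]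
      exact Finset.sum_congr rfl fun i _ ↦ (MultilinearMap.map_smul_univ _ _ _).symm
    simpa using LinearMap.congr_fun e x

theorem CasimirInvertible.piTensor (h : ∀ a, CasimirInvertible R K (b a) (b' a)) :
    CasimirInvertible R K
      (fun i : ∀ a, X a ↦ PiTensorProduct.tprod R fun a ↦ b a (i a))
      (fun i ↦ PiTensorProduct.tprod R fun a ↦ b' a (i a)) := by
  choose z' r hr hz using h
  refine ⟨PiTensorProduct.tprod R z', ∏ a, r a, ?_, ?_⟩
  · rw [map_prod]
    exact Finset.prod_ne_zero_iff.2 fun a _ ↦ hr a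
  · have hc : casimir (fun i : ∀ a, X a ↦ PiTensorProduct.tprod R fun a ↦ b a (i a))
        (fun i ↦ PiTensorProduct.tprod R fun a ↦ b' a (i a)) =
          PiTensorProduct.tprod R fun a ↦ casimir (b a) (b' a) := by
      simp only [casimir, PiTensorProduct.tprod_mul_tprod]
      rw [MultilinearMap.map_sum]
      rfl
    rw [hc, PiTensorProduct.tprod_mul_tprod]
    have e : (fun a ↦ casimir (b a) (b' a)) * z' = fun a ↦ r a • (1 : ∀ a, B a) a :=
      funext fun a ↦ hz a
    rw [e, MultilinearMap.map_smul_univ]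
    rfl

variable {I : Fin d → Type*} {ι : ∀ a, I a → Type*} [∀ a k, Fintype (ι a k)]
  [∀ a k, DecidableEq (ι a k)] {φ : ∀ a k, B a →ₐ[R] Matrix (ι a k) (ι a k) K}
  {c : ∀ a, I a → K}

theorem tensorRep_tprod {ι : Fin d → Type*} [∀ a, Fintype (ι a)] [∀ a, DecidableEq (ι a)]
    (φ : ∀ a, B a →ₐ[R] Matrix (ι a) (ι a) K) (x : ∀ a, B a) (p q : ∀ a, ι a) :
    tensorRep φ (PiTensorProduct.tprod R x) p q = ∏ a, φ a (x a) (p a) (q a) := by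
  rw [tensorRep, PiTensorProduct.liftAlgHom_apply, PiTensorProduct.lift.tprod]
  rfl

/-- Schur orthogonality passes to outer tensor products. -/
theorem IsSchurOrthogonal.piTensor (h : ∀ a, IsSchurOrthogonal (b a) (b' a) (φ a) (c a)) :
    IsSchurOrthogonal
      (fun i : ∀ a, X a ↦ PiTensorProduct.tprod R fun a ↦ b a (i a))
      (fun i ↦ PiTensorProduct.tprod R fun a ↦ b' a (i a))
      (fun k : ∀ a, I a ↦ tensorRep fun a ↦ φ a (k a)) (fun k ↦ ∏ a, c a (k a)) where
  same k p q r s := by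
    simp only [tensorRep_tprod, ← Finset.prod_mul_distrib]
    rw [← Fintype.prod_sum fun a (i : X a) ↦
      φ a (k a) (b a i) (p a) (q a) * φ a (k a) (b' a i) (r a) (s a)]
    simp only [(h _).same]
    by_cases hc : p = s ∧ q = r
    · obtain ⟨rfl, rfl⟩ := hc
      simp
    · rw [if_neg hc]
      have : ∃ a, ¬(p a = s a ∧ q a = r a) := by
        by_contra! hcon
        exact hc ⟨funext fun a ↦ (hcon a).1, funext fun a ↦ (hcon a).2⟩
      obtain ⟨a, ha⟩ := this
      exact Finset.prod_eq_zero (Finset.mem_univ a) (if_neg ha)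
  diff k l hkl p q r s := by
    simp only [tensorRep_tprod, ← Finset.prod_mul_distrib]
    rw [← Fintype.prod_sum fun a (i : X a) ↦
      φ a (k a) (b a i) (p a) (q a) * φ a (l a) (b' a i) (r a) (s a)]
    obtain ⟨a, ha⟩ := Function.ne_iff.1 hkl
    exact Finset.prod_eq_zero (Finset.mem_univ a) ((h a).diff _ _ ha _ _ _ _)

/-- Expansions of forms in irreducible characters pass to outer tensor products. -/
theorem expansion_piTensor [∀ a, Fintype (I a)]
    (h : ∀ a x, algebraMap R K (f a x) = ∑ k, (c a k)⁻¹ * Matrix.trace (φ a k x))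
    (x : ⨂[R] a, B a) :
    algebraMap R K (piTensorForm f x) =
      ∑ k : ∀ a, I a, (∏ a, c a (k a))⁻¹ * Matrix.trace (tensorRep (fun a ↦ φ a (k a)) x) := by
  have e : (Algebra.linearMap R K).comp (piTensorForm f) =
      ∑ k : ∀ a, I a, (∏ a, c a (k a))⁻¹ • ((Matrix.traceLinearMap _ R K).comp
        (tensorRep fun a ↦ φ a (k a)).toLinearMap) := by
    ext x
    simp only [LinearMap.compMultilinearMap_apply, LinearMap.comp_apply, LinearMap.sum_apply,
      LinearMap.smul_apply, Algebra.linearMap_apply, Matrix.traceLinearMap_apply,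
      AlgHom.toLinearMap_apply, piTensorForm_tprod, map_prod, h, smul_eq_mul]
    rw [Fintype.prod_sum]
    refine Finset.sum_congr rfl fun k _ ↦ ?_
    rw [Finset.prod_mul_distrib, Finset.prod_inv_distrib]
    congr 1
    simp only [Matrix.trace, Matrix.diag_apply, tensorRep_tprod]
    exact Fintype.prod_sum _
  have := LinearMap.congr_fun e x
  simpa using this

end Tensor

end Transfer

/-! ### The isomorphism with the sum of matrix algebras -/

section Psi

variable {d n : ℕ}

theorem tensorTilde_one (μ : Comp d n) : tensorTilde μ 1 = 1 := by
  simp only [tensorTilde, Pi.one_apply, heckeTilde_one]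
  rfl

/-- Left multiplication by one generator of one tensor factor. -/
theorem tensorTilde_mulSingle_mul {μ : Comp d n} {a : Fin d} (b : Fin (μ.1 a - 1))
    (x : ∀ a, Equiv.Perm (Fin (μ.1 a))) :
    tensorTilde μ (Pi.mulSingle a (adjSwap b)) * tensorTilde μ x =
      tensorTilde μ (Pi.mulSingle a (adjSwap b) * x) +
        (if IsDesc b (x a) then qParam else 0) • tensorTilde μ x := by
  have h₁ : (fun c ↦ heckeTilde ((Pi.mulSingle a (adjSwap b) :
      ∀ a, Equiv.Perm (Fin (μ.1 a))) c)) * (fun c ↦ heckeTilde (x c)) =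
      Function.update (fun c ↦ heckeTilde (x c)) a (heckeTilde (adjSwap b * x a) +
        (if IsDesc b (x a) then qParam else 0) • heckeTilde (x a)) := by
    funext c
    rw [Pi.mul_apply]
    by_cases hc : c = a
    · subst hc
      rw [Function.update_self, Pi.mulSingle_eq_same, heckeTilde_adjSwap, heckeGen_mul_heckeTilde]
    · rw [Function.update_of_ne hc, Pi.mulSingle_eq_of_ne hc, heckeTilde_one, one_mul]
  have h₂ : Function.update (fun c ↦ heckeTilde (x c)) a (heckeTilde (adjSwap b * x a)) =
      fun c ↦ heckeTilde ((Pi.mulSingle a (adjSwap b) * x : ∀ a, Equiv.Perm (Fin (μ.1 a))) c) := by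
    funext c
    rw [Pi.mul_apply]
    by_cases hc : c = a
    · subst hc
      rw [Function.update_self, Pi.mulSingle_eq_same]
    · rw [Function.update_of_ne hc, Pi.mulSingle_eq_of_ne hc, one_mul]
  refine (PiTensorProduct.tprod_mul_tprod _ _).trans ?_
  rw [h₁, MultilinearMap.map_update_add, MultilinearMap.map_update_smul,
    Function.update_eq_self a (fun c ↦ heckeTilde (x c)), h₂]
  rfl

/-- The image of `g̃_w E_χ` in the sum of matrix algebras: the matrix unit at `(w(χ), χ)` times
the standard basis element of the Young component of `w`. -/
def blockElem {μ : Comp d n} (χ : Orb μ) (w : Equiv.Perm (Fin n)) : BlockAlgebra d n :=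
  Pi.single μ (Matrix.single (actOrb w χ) χ (tensorTilde μ (youngPart w χ)))

/-- The image of the normalized generator `u⁻¹ g_i` in the sum of matrix algebras. -/
def psiGen (i : Fin (n - 1)) : BlockAlgebra d n := fun μ ↦
  ∑ χ : Orb μ, Matrix.single (actOrb (adjSwap i) χ) χ (tensorTilde μ (youngPart (adjSwap i) χ))

/-- The image of the generator `t_j` in the sum of matrix algebras. -/
def psiT (ξ : Fin d → ℂ) (j : Fin n) : BlockAlgebra d n := fun μ ↦
  Matrix.diagonal fun χ : Orb μ ↦ const (ξ (χ.1 j)) • 1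

theorem sum_blockElem_one : ∑ p : Σ μ : Comp d n, Orb μ, blockElem p.2 1 = 1 := by
  rw [Fintype.sum_sigma, ← Finset.univ_sum_single (1 : BlockAlgebra d n)]
  refine Finset.sum_congr rfl fun μ _ ↦ ?_
  simp only [blockElem, actOrb_one, youngPart_one, tensorTilde_one]
  rw [Pi.one_apply, ← Matrix.diagonal_one, ← Matrix.sum_single_eq_diagonal]
  exact (map_sum (AddMonoidHom.single (fun μ : Comp d n ↦
    Matrix (Orb μ) (Orb μ) (HeckeTensor μ)) μ) _ _).symm

/-- Elements of the sum of matrix algebras can be compared on the images of the idempotents `E_χ`. -/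
theorem block_ext {x y : BlockAlgebra d n}
    (h : ∀ (μ : Comp d n) (χ : Orb μ), x * blockElem χ 1 = y * blockElem χ 1) : x = y := by
  rw [← mul_one x, ← mul_one y, ← sum_blockElem_one, Finset.mul_sum, Finset.mul_sum]
  exact Finset.sum_congr rfl fun p _ ↦ h p.1 p.2

theorem psiT_mul_blockElem (ξ : Fin d → ℂ) (j : Fin n) {μ : Comp d n} (χ : Orb μ)
    (w : Equiv.Perm (Fin n)) :
    psiT ξ j * blockElem χ w = const (ξ (act w χ.1 j)) • blockElem χ w := by
  have : psiT ξ j * blockElem χ w = Pi.single μ (psiT ξ j μ *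
      Matrix.single (actOrb w χ) χ (tensorTilde μ (youngPart w χ))) := by
    funext ν
    by_cases hν : ν = μ
    · subst hν
      simp [blockElem]
    · simp [blockElem, hν]
  rw [this, blockElem, ← Pi.single_smul]
  congr 1
  ext χ' χ''
  rw [psiT, Matrix.diagonal_mul, Matrix.smul_apply]
  by_cases h : actOrb w χ = χ'
  · subst h
    rw [smul_mul_assoc, one_mul]
    rfl
  · rw [Matrix.single_apply, if_neg (fun hc ↦ h hc.1), mul_zero, smul_zero]

/-- The generators act on the elements `blockElem χ w` as on the standard basis of a Hecke algebra
deformed only where the character `χ` takes equal values. -/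
theorem psiGen_mul_blockElem (i : Fin (n - 1)) {μ : Comp d n} (χ : Orb μ)
    (w : Equiv.Perm (Fin n)) :
    psiGen i * blockElem χ w = blockElem χ (adjSwap i * w) +
      descCoeff qParam χ.1 (w⁻¹ (lo i)) (w⁻¹ (hi i)) • blockElem χ w := by
  have h₁ : psiGen i * blockElem χ w = Pi.single μ (psiGen i μ *
      Matrix.single (actOrb w χ) χ (tensorTilde μ (youngPart w χ))) := by
    funext ν
    by_cases hν : ν = μ
    · subst hν
      simp [blockElem]
    · simp [blockElem, hν]
  have h₂ : psiGen i μ * Matrix.single (actOrb w χ) χ (tensorTilde μ (youngPart w χ)) =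
      Matrix.single (actOrb (adjSwap i) (actOrb w χ)) χ
        (tensorTilde μ (youngPart (adjSwap i) (actOrb w χ)) * tensorTilde μ (youngPart w χ)) := by
    rw [psiGen, Finset.sum_mul, Finset.sum_eq_single (actOrb w χ)]
    · rw [Matrix.single_mul_single_same]
    · intro χ' _ hχ'
      rw [Matrix.single_mul_single_of_ne _ _ _ _ hχ']
    · simp
  have hcol : ∀ j, (actOrb w χ).1 j = χ.1 (w⁻¹ j) := fun _ ↦ rfl
  rw [h₁, h₂]
  by_cases hχ : (actOrb w χ).1 (lo i) = (actOrb w χ).1 (hi i)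
  · obtain ⟨a, b, e₁, e₂⟩ := exists_block_of_eq hχ
    have hy := youngPart_adjSwap_of_eq hχ e₁ e₂
    have hc : descCoeff qParam χ.1 (w⁻¹ (lo i)) (w⁻¹ (hi i)) =
        if IsDesc b (youngPart w χ a) then qParam else 0 := by
      rw [descCoeff]
      refine if_congr ?_ rfl rfl
      rw [isDesc_youngPart_iff e₁ e₂, IsDesc]
      exact and_iff_left hχ
    rw [hy, tensorTilde_mulSingle_mul, ← hy, ← youngPart_mul, hc, blockElem, blockElem, actOrb_mul,
      Matrix.single_add, Pi.single_add, ← Pi.single_smul, Matrix.smul_single,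
      actOrb_adjSwap_of_eq hχ]
  · have hc : descCoeff qParam χ.1 (w⁻¹ (lo i)) (w⁻¹ (hi i)) = 0 := if_neg fun h ↦ hχ h.2
    rw [hc, zero_smul, add_zero, blockElem, actOrb_mul, youngPart_mul,
      youngPart_adjSwap_of_ne hχ, tensorTilde_one, one_mul, one_mul]

theorem psiGen_actsAs (i : Fin (n - 1)) {μ : Comp d n} (χ : Orb μ) :
    ActsAs qParam χ.1 (blockElem χ) i (LinearMap.mulLeft GroundRing (psiGen i)) :=
  psiGen_mul_blockElem i χ

/-- The images of the generators under `Ψ`. -/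
def psiFun (ξ : Fin d → ℂ) : YGen n → BlockAlgebra d n
  | YGen.g i => u • psiGen i
  | YGen.t j => psiT ξ j

variable {ξ : Fin d → ℂ} (hd : 0 < d) (hξ : Function.Injective ξ) (hξd : ∀ a, ξ a ^ d = 1)

section Relations

theorem psiGen_comm {i j : Fin (n - 1)} (h : i.1 + 1 < j.1) :
    psiGen i * psiGen j = (psiGen j * psiGen i : BlockAlgebra d n) :=
  block_ext fun μ χ ↦ by
    rw [mul_assoc, mul_assoc]
    exact (psiGen_actsAs i χ).comm h (psiGen_actsAs j χ) 1

theorem psiGen_braid {i j : Fin (n - 1)} (h : i.1 + 1 = j.1) :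
    psiGen i * psiGen j * psiGen i = (psiGen j * psiGen i * psiGen j : BlockAlgebra d n) :=
  block_ext fun μ χ ↦ by
    simp only [mul_assoc]
    exact (psiGen_actsAs i χ).braid h (psiGen_actsAs j χ) 1

theorem psiT_comm (ξ : Fin d → ℂ) (i j : Fin n) :
    psiT ξ i * psiT ξ j = psiT ξ j * psiT ξ i := by
  refine block_ext fun μ χ ↦ ?_
  rw [mul_assoc, mul_assoc, psiT_mul_blockElem, psiT_mul_blockElem, mul_smul_comm, mul_smul_comm,
    psiT_mul_blockElem, psiT_mul_blockElem, smul_comm]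

theorem psiGen_mul_psiT (ξ : Fin d → ℂ) (i : Fin (n - 1)) (j : Fin n) :
    psiGen i * psiT ξ j = psiT ξ (adjSwap i j) * psiGen i := by
  refine block_ext fun μ χ ↦ ?_
  have h₁ : psiT ξ j * blockElem χ 1 = const (ξ (χ.1 j)) • blockElem χ 1 :=
    psiT_mul_blockElem ξ j χ 1
  have h₂ : psiT ξ (adjSwap i j) * blockElem χ 1 = const (ξ (χ.1 (adjSwap i j))) • blockElem χ 1 :=
    psiT_mul_blockElem ξ (adjSwap i j) χ 1
  have h₃ : psiT ξ (adjSwap i j) * blockElem χ (adjSwap i) =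
      const (ξ (χ.1 j)) • blockElem χ (adjSwap i) := by
    rw [psiT_mul_blockElem, act_adjSwap, adjSwap_adjSwap]
  have h₄ : psiGen i * blockElem χ 1 = blockElem χ (adjSwap i) +
      descCoeff qParam χ.1 (lo i) (hi i) • blockElem χ 1 := by
    have := psiGen_mul_blockElem i χ 1
    rwa [mul_one] at this
  -- the colours of `j` and `s_i(j)` agree when the coefficient does not vanish
  have h₅ : const (ξ (χ.1 j)) * descCoeff qParam χ.1 (lo i) (hi i) =
      descCoeff qParam χ.1 (lo i) (hi i) * const (ξ (χ.1 (adjSwap i j))) := by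
    by_cases hc : χ.1 (lo i) = χ.1 (hi i)
    · rw [← act_adjSwap i χ.1 j, act_adjSwap_of_eq hc, mul_comm]
    · have h0 : descCoeff qParam χ.1 (lo i) (hi i) = 0 := if_neg fun h ↦ hc h.2
      rw [h0, mul_zero, zero_mul]
  rw [mul_assoc, mul_assoc, h₁, mul_smul_comm, h₄, mul_add, h₃, mul_smul_comm, h₂, smul_add,
    smul_smul, smul_smul, h₅]

include hξd in
theorem psiT_pow (j : Fin n) : psiT ξ j ^ d = (1 : BlockAlgebra d n) := by
  refine block_ext fun μ χ ↦ ?_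
  rw [pow_mul_of_eigen (psiT_mul_blockElem ξ j χ 1), ← const_pow, hξd, const_one, one_smul,
    one_mul]

/-- The image of the idempotent `e_i` in the sum of matrix algebras. -/
def psiE (ξ : Fin d → ℂ) (i : Fin (n - 1)) : BlockAlgebra d n :=
  const (1 / (d : ℂ)) • ∑ s ∈ Finset.range d, psiT ξ (lo i) ^ s * (psiT ξ (hi i) ^ (d - 1)) ^ s

include hd hξ hξd

theorem psiE_mul_blockElem (i : Fin (n - 1)) {μ : Comp d n} (χ : Orb μ)
    (w : Equiv.Perm (Fin n)) : psiE ξ i * blockElem χ w =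
      if χ.1 (w⁻¹ (lo i)) = χ.1 (w⁻¹ (hi i)) then blockElem χ w else 0 := by
  have := mean_mul hd (hξd (act w χ.1 (lo i))) (hξd (act w χ.1 (hi i)))
    (psiT_mul_blockElem ξ (lo i) χ w) (psiT_mul_blockElem ξ (hi i) χ w)
  simp only [hξ.eq_iff] at this
  exact this

theorem psiGen_mul_self (i : Fin (n - 1)) : psiGen i * psiGen i =
    (1 + (uInv * v) • (psiE ξ i * psiGen i) : BlockAlgebra d n) := by
  refine block_ext fun μ χ ↦ ?_
  have h := (psiGen_actsAs i χ).quad 1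
  simp only [LinearMap.mulLeft_apply] at h
  rw [mul_assoc, h, add_mul, one_mul, smul_mul_assoc, mul_assoc, psiGen_mul_blockElem, mul_add,
    mul_smul_comm, psiE_mul_blockElem hd hξ hξd, psiE_mul_blockElem hd hξ hξd, inv_adjSwap_mul,
    inv_adjSwap_mul, adjSwap_lo, adjSwap_hi]
  congr 1
  simp only [inv_one, Equiv.Perm.one_apply, eq_comm (a := χ.1 (hi i))]
  split_ifs
  · rfl
  · simp

theorem psi_rel {x y : FreeAlgebra GroundRing (YGen n)} (h : YRel d n x y) :
    FreeAlgebra.lift GroundRing (psiFun ξ) x = FreeAlgebra.lift GroundRing (psiFun ξ) y := by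
  have hg : ∀ i : Fin (n - 1), FreeAlgebra.lift GroundRing (psiFun ξ) (freeG i) = u • psiGen i :=
    fun i ↦ FreeAlgebra.lift_ι_apply _ _
  have ht : ∀ j : Fin n, FreeAlgebra.lift GroundRing (psiFun ξ) (freeT j) = psiT ξ j :=
    fun j ↦ FreeAlgebra.lift_ι_apply _ _
  cases h with
  | comm i j h =>
    rw [map_mul, map_mul, hg, hg, smul_mul_smul_comm, smul_mul_smul_comm]
    rcases h with h | h
    · rw [psiGen_comm h]
    · rw [psiGen_comm h]
  | braid i j h => simp only [map_mul, hg, smul_mul_smul_comm, psiGen_braid h]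
  | t_comm i j => rw [map_mul, map_mul, ht, ht, psiT_comm]
  | g_t i j =>
    rw [map_mul, map_mul, hg, ht, ht, smul_mul_assoc, mul_smul_comm, psiGen_mul_psiT]
  | t_pow j => rw [map_pow, map_one, ht, psiT_pow hξd]
  | quad i =>
    have he : FreeAlgebra.lift GroundRing (psiFun ξ) (freeE d i) = psiE ξ i := by
      simp only [freeE, map_smul, map_sum, map_mul, map_pow, ht]
      rfl
    rw [map_mul, map_add, map_smul, map_mul, hg, he, AlgHom.commutes]
    exact unnormalized_quad uInv_mul_u (psiGen_mul_self hd hξ hξd i)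

end Relations

/-- The homomorphism `Ψ`. -/
def psi : Yokonuma d n →ₐ[GroundRing] BlockAlgebra d n :=
  RingQuot.liftAlgHom GroundRing ⟨FreeAlgebra.lift GroundRing (psiFun ξ),
    fun _ _ ↦ psi_rel hd hξ hξd⟩

theorem psi_yT (j : Fin n) : psi hd hξ hξd (yT d j) = psiT ξ j :=
  (RingQuot.liftAlgHom_mkAlgHom_apply GroundRing _ _ _).trans (FreeAlgebra.lift_ι_apply _ _)

theorem psi_yGen (i : Fin (n - 1)) : psi hd hξ hξd (yGen d i) = psiGen i := by
  have : psi hd hξ hξd (yG d i) = u • psiGen i :=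
    (RingQuot.liftAlgHom_mkAlgHom_apply GroundRing _ _ _).trans (FreeAlgebra.lift_ι_apply _ _)
  rw [yGen, map_smul, this, smul_smul, uInv_mul_u, one_smul]

theorem psi_idem {μ : Comp d n} (χ : Orb μ) : psi hd hξ hξd (idem ξ χ.1) = blockElem χ 1 := by
  have hw : ∀ p : Σ μ : Comp d n, Orb μ,
      psi hd hξ hξd (idem ξ χ.1) * blockElem p.2 1 = if χ.1 = p.2.1 then blockElem p.2 1 else 0 := by
    intro p
    have h : IsWeight ξ (psi hd hξ hξd) p.2.1 (blockElem p.2 1) := fun j ↦ by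
      rw [psi_yT, psiT_mul_blockElem, act_one]
    exact h.idem_mul hd hξ hξd _
  rw [← mul_one (psi hd hξ hξd _), ← sum_blockElem_one, Finset.mul_sum,
    Finset.sum_eq_single ⟨μ, χ⟩]
  · rw [hw, if_pos rfl]
  · rintro ⟨ν, χ'⟩ _ hne
    rw [hw, if_neg]
    intro h
    apply hne
    have hμ : μ = ν := Subtype.ext (funext fun a ↦ by
      rw [← χ.2 a, ← χ'.2 a]
      simp only [h])
    subst hμ
    rw [Subtype.ext h]
  · simp

theorem psi_gTilde_mul_idem {μ : Comp d n} (χ : Orb μ) (w : Equiv.Perm (Fin n)) :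
    psi hd hξ hξd (gTilde d w * idem ξ χ.1) = blockElem χ w := by
  induction w using perm_induction with
  | one => rw [gTilde_one, one_mul, psi_idem]
  | step i w h ih =>
    rw [gTilde_eq, ← isBraided_yGen.mul_braidLift h, mul_assoc, map_mul, ← gTilde_eq, ih, psi_yGen,
      psiGen_mul_blockElem, descCoeff, if_neg fun hc ↦ h hc.1, zero_smul, add_zero]

/-- The permutation `w` carrying `χ'` to `χ` with prescribed component `x` in the Young
subgroup. -/
def blockPerm {μ : Comp d n} (χ χ' : Orb μ) (x : ∀ a, Equiv.Perm (Fin (μ.1 a))) :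
    Equiv.Perm (Fin n) := minRep χ * young μ x * (minRep χ')⁻¹

theorem actOrb_blockPerm {μ : Comp d n} (χ χ' : Orb μ) (x : ∀ a, Equiv.Perm (Fin (μ.1 a))) :
    actOrb (blockPerm χ χ' x) χ' = χ := by
  apply Subtype.ext
  change act _ χ'.1 = χ.1
  rw [blockPerm, act_mul, act_mul, ← act_minRep χ', ← act_mul (minRep χ')⁻¹, inv_mul_cancel, act_one,
    act_young, act_minRep]

theorem youngPart_blockPerm {μ : Comp d n} (χ χ' : Orb μ) (x : ∀ a, Equiv.Perm (Fin (μ.1 a))) :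
    youngPart (blockPerm χ χ' x) χ' = x := by
  apply young_injective
  rw [young_youngPart, actOrb_blockPerm, blockPerm]
  group

/-- A permutation is determined by its source, its target and its component in the Young subgroup. -/
theorem blockPerm_youngPart {μ : Comp d n} (χ : Orb μ) (w : Equiv.Perm (Fin n)) :
    blockPerm (actOrb w χ) χ (youngPart w χ) = w := by
  rw [blockPerm, young_youngPart]
  group

theorem blockElem_blockPerm {μ : Comp d n} (χ χ' : Orb μ)
    (x : ∀ a, Equiv.Perm (Fin (μ.1 a))) :
    blockElem χ' (blockPerm χ χ' x) = Pi.single μ (Matrix.single χ χ' (tensorTilde μ x)) := by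
  rw [blockElem, actOrb_blockPerm, youngPart_blockPerm]

/-! ### The forms on the sum of matrix algebras and on the Yokonuma--Hecke algebra -/

/-- The form `⊕ τ^μ ∘ Tr` on the sum of matrix algebras. -/
def blockForm (d n : ℕ) : BlockAlgebra d n →ₗ[GroundRing] GroundRing :=
  piForm fun μ : Comp d n ↦ matrixForm (Orb μ) (tensorForm canonicalForm μ)

/-- The index set of the standard basis of `⊕ Mat(H^μ)`: a summand, a row, a column and an element
of the Young subgroup. -/
abbrev BlockIndex (d n : ℕ) : Type :=
  Σ μ : Comp d n, Orb μ × Orb μ × (∀ a, Equiv.Perm (Fin (μ.1 a)))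

/-- The standard basis of `⊕ Mat(H^μ)`. -/
def blockBasis (k : BlockIndex d n) : BlockAlgebra d n :=
  Pi.single k.1 (Matrix.single k.2.1 k.2.2.1 (tensorTilde k.1 k.2.2.2))

/-- The basis of `⊕ Mat(H^μ)` dual to the standard one. -/
def blockDual (k : BlockIndex d n) : BlockAlgebra d n :=
  Pi.single k.1 (Matrix.single k.2.2.1 k.2.1 (tensorTilde k.1 fun a ↦ (k.2.2.2 a)⁻¹))

theorem isSymmDual_tensorForm (μ : Comp d n) :
    IsSymmDual (tensorForm canonicalForm μ) (tensorTilde μ)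
      (fun x ↦ tensorTilde μ fun a ↦ (x a)⁻¹) :=
  IsSymmDual.piTensor fun a ↦ isSymmDual_canonicalForm (μ.1 a)

theorem isSymmDual_blockForm :
    IsSymmDual (blockForm d n) blockBasis blockDual :=
  IsSymmDual.pi (B := fun μ : Comp d n ↦ Matrix (Orb μ) (Orb μ) (HeckeTensor μ))
    (X := fun μ ↦ Orb μ × Orb μ × (∀ a, Equiv.Perm (Fin (μ.1 a))))
    (f := fun μ ↦ matrixForm (Orb μ) (tensorForm canonicalForm μ))
    fun μ ↦ (isSymmDual_tensorForm μ).matrix (O := Orb μ)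

theorem tensorForm_tensorTilde (μ : Comp d n) (x : ∀ a, Equiv.Perm (Fin (μ.1 a))) :
    tensorForm canonicalForm μ (tensorTilde μ x) = if x = 1 then 1 else 0 := by
  refine (piTensorForm_tprod _).trans ?_
  simp only [canonicalForm_heckeTilde]
  rw [Finset.prod_ite_zero]
  simp [funext_iff]

theorem tensorForm_mul (μ : Comp d n) (x y : ∀ a, Equiv.Perm (Fin (μ.1 a))) :
    tensorForm canonicalForm μ (tensorTilde μ x * tensorTilde μ fun a ↦ (y a)⁻¹) =
      if x = y then 1 else 0 := by
  refine (congrArg _ (PiTensorProduct.tprod_mul_tprod _ _)).trans ?_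
  refine (piTensorForm_tprod _).trans ?_
  have : ∀ a, canonicalForm (μ.1 a) (heckeTilde (x a) * heckeTilde (y a)⁻¹) =
      if x a = y a then 1 else 0 := fun a ↦ by
    rw [(isSymmDual_canonicalForm _).trace, canonicalForm_mul]
    simp only [eq_comm]
  simp only [Pi.mul_apply, this]
  rw [Finset.prod_ite_zero]
  simp [funext_iff]

theorem blockForm_single (μ : Comp d n) (x : Matrix (Orb μ) (Orb μ) (HeckeTensor μ)) :
    blockForm d n (Pi.single μ x) = tensorForm canonicalForm μ (Matrix.trace x) := by
  rw [blockForm, piForm_apply, Finset.sum_eq_single μ]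
  · rw [Pi.single_eq_same]
    rfl
  · intro ν _ hν
    rw [Pi.single_eq_of_ne hν, map_zero]
  · simp

theorem blockForm_mul (j k : BlockIndex d n) :
    blockForm d n (blockBasis j * blockDual k) = if j = k then 1 else 0 := by
  obtain ⟨μ, p, q, x⟩ := j
  obtain ⟨ν, p', q', y⟩ := k
  by_cases hμ : μ = ν
  · subst hμ
    rw [blockBasis, blockDual, ← Pi.single_mul, blockForm_single, trace_mul_single,
      Matrix.single_apply]
    by_cases hpq : p = p' ∧ q = q'
    · obtain ⟨rfl, rfl⟩ := hpq
      rw [if_pos ⟨rfl, rfl⟩, tensorForm_mul]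
      simp
    · rw [if_neg hpq, zero_mul, map_zero, if_neg]
      intro h
      simp only [Sigma.mk.injEq, heq_eq_eq, Prod.mk.injEq, true_and] at h
      exact hpq ⟨h.1, h.2.1⟩
  · have : blockBasis ⟨μ, p, q, x⟩ * blockDual ⟨ν, p', q', y⟩ = 0 := by
      funext κ
      rw [Pi.mul_apply, blockBasis, blockDual]
      by_cases hκ : κ = μ
      · subst hκ
        simp [hμ]
      · simp [hκ]
    rw [this, map_zero, if_neg]
    intro h
    exact hμ (congrArg Sigma.fst h)

theorem psi_surjective : Function.Surjective (psi (n := n) hd hξ hξd) := by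
  intro x
  refine ⟨∑ k : BlockIndex d n, blockForm d n (x * blockDual k) •
    (gTilde d (blockPerm k.2.1 k.2.2.1 k.2.2.2) * idem ξ k.2.2.1.1), ?_⟩
  conv_rhs => rw [← isSymmDual_blockForm.sum_left x]
  simp only [map_sum, map_smul, psi_gTilde_mul_idem, blockElem_blockPerm]
  rfl

/-- The elements `g̃_w E_χ` span `Y_{d,n}`, and their images are distinct elements of the standard
basis; a left inverse of `psi` is read off from the dual basis. -/
theorem psi_injective : Function.Injective (psi (n := n) hd hξ hξd) := by
  let θ : BlockAlgebra d n →ₗ[GroundRing] Yokonuma d n := ∑ k : BlockIndex d n,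
    ((blockForm d n).comp (LinearMap.mulRight GroundRing (blockDual k))).smulRight
    (gTilde d (blockPerm k.2.1 k.2.2.1 k.2.2.2) * idem ξ k.2.2.1.1)
  have hθ : ∀ x, θ x = ∑ k : BlockIndex d n, blockForm d n (x * blockDual k) •
      (gTilde d (blockPerm k.2.1 k.2.2.1 k.2.2.2) * idem ξ k.2.2.1.1) := fun x ↦ by
    simp [θ]
  have h : θ.comp (psi (n := n) hd hξ hξd).toLinearMap = LinearMap.id := by
    refine LinearMap.ext_on (span_gTilde_mul_idem hd hξ hξd) ?_
    rintro _ ⟨⟨χ, w⟩, rfl⟩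
    let χ' : Orb (charComp χ) := ⟨χ, fun _ ↦ rfl⟩
    have hk : psi hd hξ hξd (gTilde d w * idem ξ χ) =
        blockBasis ⟨charComp χ, actOrb w χ', χ', youngPart w χ'⟩ :=
      psi_gTilde_mul_idem hd hξ hξd χ' w
    rw [LinearMap.comp_apply, AlgHom.toLinearMap_apply, hk, hθ]
    simp only [blockForm_mul, ite_smul, one_smul, zero_smul, Finset.sum_ite_eq, Finset.mem_univ,
      if_true, blockPerm_youngPart, LinearMap.id_apply]
    rfl
  intro x y hxy
  have := congrArg θ hxy
  rw [← LinearMap.id_apply (R := GroundRing) x, ← LinearMap.id_apply (R := GroundRing) y, ← h]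
  exact this

/-- The isomorphism `Ψ`, the map `psi` carrying the elements `g̃_w E_χ` to the standard basis. -/
def psiEquiv : Yokonuma d n ≃ₐ[GroundRing] BlockAlgebra d n :=
  AlgEquiv.ofBijective (psi hd hξ hξd) ⟨psi_injective hd hξ hξd, psi_surjective hd hξ hξd⟩

theorem psiEquiv_gTilde_mul_idem {μ : Comp d n} (χ : Orb μ) (w : Equiv.Perm (Fin n)) :
    psiEquiv hd hξ hξd (gTilde d w * idem ξ χ.1) = blockElem χ w :=
  psi_gTilde_mul_idem hd hξ hξd χ w

theorem isPsi_iff (F : Yokonuma d n →ₗ[GroundRing] BlockAlgebra d n) :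
    IsPsi ξ F ↔ F = (psiEquiv hd hξ hξd).toLinearMap := by
  have key : ∀ {μ : Comp d n} (χ χ' : Orb μ) (w : Equiv.Perm (Fin n)), act w χ'.1 = χ.1 →
      ∀ x : (∀ a, Equiv.Perm (Fin (μ.1 a))), young μ x = (minRep χ)⁻¹ * w * minRep χ' →
      psiEquiv hd hξ hξd (gTilde d w * idem ξ χ'.1) =
        Pi.single μ (Matrix.single χ χ' (tensorTilde μ x)) := by
    intro μ χ χ' w hw x hx
    obtain rfl : actOrb w χ' = χ := Subtype.ext hw
    rw [psiEquiv_gTilde_mul_idem, blockElem,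
      young_injective (hx.trans (young_youngPart w χ').symm)]
  constructor
  · intro hF
    refine LinearMap.ext_on (span_gTilde_mul_idem hd hξ hξd) ?_
    rintro _ ⟨⟨χ, w⟩, rfl⟩
    let χ' : Orb (charComp χ) := ⟨χ, fun _ ↦ rfl⟩
    have h₁ := hF _ (actOrb w χ') χ' w rfl _ (young_youngPart w χ')
    have h₂ := key (actOrb w χ') χ' w rfl _ (young_youngPart w χ')
    refine (congrArg F (gTilde_mul_idem hd hξ hξd w χ)).trans (h₁.trans h₂.symm)
  · rintro rfl μ χ χ' w hw x hx
    rw [← hw, ← gTilde_mul_idem hd hξ hξd]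
    exact key χ χ' w hw x hx

/-- The form `ρ_n` on the Yokonuma--Hecke algebra, transported from the sum of matrix algebras. -/
def yokonumaForm : Yokonuma d n →ₗ[GroundRing] GroundRing :=
  (blockForm d n).comp (psiEquiv hd hξ hξd).toLinearMap

theorem rho_eq (y : Yokonuma d n) :
    rho canonicalForm (psiEquiv hd hξ hξd) y = yokonumaForm hd hξ hξd y := by
  change _ = blockForm d n _
  rw [blockForm, piForm_apply]
  rfl

/-- The trace of the matrix unit at `(w(χ), χ)` picks out `w(χ) = χ`, and `τ^μ` picks out a trivial
component in the Young subgroup; together these force `w = 1`. -/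
theorem yokonumaForm_idem_mul_gTilde (χ : Fin n → Fin d) (w : Equiv.Perm (Fin n)) :
    yokonumaForm hd hξ hξd (idem ξ χ * gTilde d w) = if w = 1 then 1 else 0 := by
  obtain ⟨χ₀, rfl⟩ : ∃ χ₀, act w χ₀ = χ := ⟨act w⁻¹ χ, by
    rw [← act_mul, mul_inv_cancel, act_one]⟩
  let χ' : Orb (charComp χ₀) := ⟨χ₀, fun _ ↦ rfl⟩
  rw [← gTilde_mul_idem hd hξ hξd]
  change blockForm d n (psiEquiv hd hξ hξd (gTilde d w * idem ξ χ'.1)) = _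
  rw [psiEquiv_gTilde_mul_idem, blockElem, blockForm_single]
  by_cases hχ : actOrb w χ' = χ'
  · rw [hχ, Matrix.trace_single_eq_same, tensorForm_tensorTilde]
    refine if_congr ⟨fun h ↦ ?_, ?_⟩ rfl rfl
    · rw [← blockPerm_youngPart χ' w, h, hχ, blockPerm, young_one]
      group
    · rintro rfl
      exact youngPart_one _
  · rw [Matrix.trace_single_eq_of_ne _ _ _ hχ, map_zero, if_neg]
    rintro rfl
    exact hχ rfl

/-- The form `ρ_n` has the defining values of the form of Chlouveraki and Poulain d'Andecy, by
expanding `t^k` in the idempotents `E_χ`. -/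
theorem yokonumaForm_tMonomial_mul_gTilde (k : Fin n → Fin d) (w : Equiv.Perm (Fin n)) :
    yokonumaForm hd hξ hξd (tMonomial d k * gTilde d w) =
      if (∀ j, (k j).1 = 0) ∧ w = 1 then (d : GroundRing) ^ n else 0 := by
  rw [tMonomial_eq_sum hd hξ hξd, Finset.sum_mul, map_sum]
  simp only [smul_mul_assoc, map_smul, yokonumaForm_idem_mul_gTilde, smul_eq_mul]
  rw [← Finset.sum_mul, ← const_sum, ← Fintype.prod_sum fun j a ↦ ξ a ^ (k j).1]
  simp only [sum_root_pow hd hξ hξd (k _).2]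
  by_cases hw : w = 1
  · by_cases hk : ∀ j, (k j).1 = 0
    · simp only [hk, hw, if_true, and_self, mul_one, Finset.prod_const, Finset.card_univ,
        Fintype.card_fin, const_pow, const_natCast, implies_true]
    · obtain ⟨j, hj⟩ := not_forall.1 hk
      rw [Finset.prod_eq_zero (Finset.mem_univ j) (if_neg hj), const_zero, zero_mul,
        if_neg fun h ↦ hk h.1]
  · rw [if_neg hw, if_neg fun h ↦ hw h.2, mul_zero]

theorem isCPAForm_iff (f : Yokonuma d n →ₗ[GroundRing] GroundRing) :
    IsCPAForm f ↔ f = yokonumaForm hd hξ hξd := by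
  constructor
  · intro h
    refine LinearMap.ext_on (span_tMonomial_mul_gTilde hd hξ hξd) ?_
    rintro _ ⟨⟨k, w⟩, rfl⟩
    exact (h k w).trans (yokonumaForm_tMonomial_mul_gTilde hd hξ hξd k w).symm
  · rintro rfl
    exact yokonumaForm_tMonomial_mul_gTilde hd hξ hξd

end Psi

/-! ### Transfer of the Schur relations -/

section SchurTransfer

variable {R K : Type*} [CommRing R] [Field K] [Algebra R K]

section AlgEquiv

variable {A B X I : Type*} [Ring A] [Algebra R A] [Ring B] [Algebra R B] [Fintype X]
  {b b' : X → B} {ι : I → Type*} [∀ k, Fintype (ι k)] [∀ k, DecidableEq (ι k)]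
  {φ : ∀ k, B →ₐ[R] Matrix (ι k) (ι k) K} {c : I → K}

theorem IsSchurOrthogonal.comp_algEquiv (h : IsSchurOrthogonal b b' φ c) (e : A ≃ₐ[R] B) :
    IsSchurOrthogonal (fun i ↦ e.symm (b i)) (fun i ↦ e.symm (b' i))
      (fun k ↦ (φ k).comp e.toAlgHom) c where
  same k p q r s := by
    simpa using h.same k p q r s
  diff k l hkl p q r s := by
    simpa using h.diff k l hkl p q r s

end AlgEquiv

section Matrix

variable {B X I O : Type*} [Ring B] [Algebra R B] [Fintype X] [Fintype O] [DecidableEq O]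
  {f : B →ₗ[R] R} {b b' : X → B} {ι : I → Type*} [∀ k, Fintype (ι k)] [∀ k, DecidableEq (ι k)]
  {φ : ∀ k, B →ₐ[R] Matrix (ι k) (ι k) K} {c : I → K}

/-- The module of columns with entries in a given module, over a matrix algebra. -/
def columnRep (O : Type*) [Fintype O] [DecidableEq O] {ι : Type*} [Fintype ι] [DecidableEq ι]
    (φ : B →ₐ[R] Matrix ι ι K) : Matrix O O B →ₐ[R] Matrix (O × ι) (O × ι) K :=
  (Matrix.compAlgEquiv O ι K R).toAlgHom.comp φ.mapMatrix

theorem columnRep_apply {ι : Type*} [Fintype ι] [DecidableEq ι]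
    (φ : B →ₐ[R] Matrix ι ι K) (x : Matrix O O B) (p q : O × ι) :
    columnRep O φ x p q = φ (x p.1 q.1) p.2 q.2 := rfl

theorem columnRep_single {ι : Type*} [Fintype ι] [DecidableEq ι]
    (φ : B →ₐ[R] Matrix ι ι K) (o o' : O) (x : B) (p q : O × ι) :
    columnRep O φ (Matrix.single o o' x) p q =
      if o = p.1 ∧ o' = q.1 then φ x p.2 q.2 else 0 := by
  rw [columnRep_apply, Matrix.single_apply]
  split_ifs
  · rfl
  · rw [map_zero, Matrix.zero_apply]

theorem trace_columnRep {ι : Type*} [Fintype ι] [DecidableEq ι]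
    (φ : B →ₐ[R] Matrix ι ι K) (x : Matrix O O B) :
    Matrix.trace (columnRep O φ x) = Matrix.trace (φ (Matrix.trace x)) := by
  simp only [Matrix.trace, Matrix.diag_apply, Fintype.sum_prod_type, columnRep_apply, map_sum,
    Matrix.sum_apply]
  exact Finset.sum_comm

theorem sum_columnRep_mul_columnRep {ι κ : Type*} [Fintype ι] [DecidableEq ι] [Fintype κ]
    [DecidableEq κ] (φ : B →ₐ[R] Matrix ι ι K) (ψ : B →ₐ[R] Matrix κ κ K) (p q : O × ι)
    (r s : O × κ) :
    ∑ i : O × O × X, columnRep O φ (Matrix.single i.1 i.2.1 (b i.2.2)) p q *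
        columnRep O ψ (Matrix.single i.2.1 i.1 (b' i.2.2)) r s =
      if p.1 = s.1 ∧ q.1 = r.1 then ∑ x, φ (b x) p.2 q.2 * ψ (b' x) r.2 s.2 else 0 := by
  simp only [Fintype.sum_prod_type, columnRep_single]
  rw [Finset.sum_eq_single p.1, Finset.sum_eq_single q.1]
  · by_cases h : p.1 = s.1 ∧ q.1 = r.1
    · rw [if_pos h]
      simp [h.1, h.2]
    · rw [if_neg h]
      refine Finset.sum_eq_zero fun x _ ↦ ?_
      rw [if_neg fun h' : q.1 = r.1 ∧ p.1 = s.1 ↦ h h'.symm, mul_zero]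
  · intro o _ ho
    simp [ho]
  · simp
  · intro o _ ho
    simp [ho]
  · simp

/-- The Schur constants are unchanged on passing to matrices: the row and column indices contribute
a single term. -/
theorem IsSchurOrthogonal.matrix (h : IsSchurOrthogonal b b' φ c) :
    IsSchurOrthogonal (fun i : O × O × X ↦ Matrix.single i.1 i.2.1 (b i.2.2))
      (fun i ↦ Matrix.single i.2.1 i.1 (b' i.2.2)) (fun k ↦ columnRep O (φ k)) c where
  same k p q r s := by
    rw [sum_columnRep_mul_columnRep, h.same, ← ite_and]
    refine if_congr ?_ rfl rfl
    simp only [Prod.ext_iff]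
    tauto
  diff k l hkl p q r s := by
    rw [sum_columnRep_mul_columnRep, h.diff k l hkl, ite_self]

omit [Fintype X] in
theorem expansion_matrix [Fintype I]
    (h : ∀ x, algebraMap R K (f x) = ∑ k, (c k)⁻¹ * Matrix.trace (φ k x)) (x : Matrix O O B) :
    algebraMap R K (matrixForm O f x) = ∑ k, (c k)⁻¹ * Matrix.trace (columnRep O (φ k) x) := by
  simp only [trace_columnRep]
  exact h _

end Matrix

section Pi

variable {J : Type*} [Fintype J] [DecidableEq J] {B X I : J → Type*} [∀ j, Ring (B j)]
  [∀ j, Algebra R (B j)] [∀ j, Fintype (X j)] {f : ∀ j, B j →ₗ[R] R} {b b' : ∀ j, X j → B j}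
  {ι : ∀ j, I j → Type*} [∀ j k, Fintype (ι j k)] [∀ j k, DecidableEq (ι j k)]
  {φ : ∀ j k, B j →ₐ[R] Matrix (ι j k) (ι j k) K} {c : ∀ j, I j → K}

theorem IsSchurOrthogonal.pi (h : ∀ j, IsSchurOrthogonal (b j) (b' j) (φ j) (c j)) :
    IsSchurOrthogonal (fun i : Σ j, X j ↦ Pi.single i.1 (b i.1 i.2))
      (fun i ↦ Pi.single i.1 (b' i.1 i.2))
      (fun k : Σ j, I j ↦ (φ k.1 k.2).comp (Pi.evalAlgHom R B k.1)) (fun k ↦ c k.1 k.2) where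
  same k p q r s := by
    obtain ⟨j, k⟩ := k
    rw [Fintype.sum_sigma, Finset.sum_eq_single j]
    · simpa using (h j).same k p q r s
    · intro l _ hl
      simp [hl.symm]
    · simp
  diff k l hkl p q r s := by
    obtain ⟨j, k⟩ := k
    obtain ⟨j', l⟩ := l
    rw [Fintype.sum_sigma, Finset.sum_eq_single j]
    · by_cases hj : j = j'
      · subst hj
        simpa using (h j).diff k l (fun e ↦ hkl (by rw [e])) p q r s
      · simp [Ne.symm hj]
    · intro l _ hl
      simp [hl.symm]
    · simp

omit [DecidableEq J] in
theorem expansion_pi [∀ j, Fintype (I j)]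
    (h : ∀ j x, algebraMap R K (f j x) = ∑ k, (c j k)⁻¹ * Matrix.trace (φ j k x)) (x : ∀ j, B j) :
    algebraMap R K (piForm f x) = ∑ k : Σ j, I j,
      (c k.1 k.2)⁻¹ * Matrix.trace ((φ k.1 k.2).comp (Pi.evalAlgHom R B k.1) x) := by
  rw [piForm_apply, map_sum, Fintype.sum_sigma]
  exact Finset.sum_congr rfl fun j _ ↦ h j (x j)

end Pi

end SchurTransfer

/-! ### Schur elements of the Yokonuma--Hecke algebra -/

section YokonumaSchur

instance : Algebra ℚ GroundRing :=
  inferInstanceAs (Algebra ℚ (Polynomial (LaurentPolynomial ℂ)))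

variable {d n : ℕ} {K : Type*} [Field K] [Algebra GroundRing K]

theorem charZero_of_injective (hK : Function.Injective (algebraMap GroundRing K)) : CharZero K :=
  have : Nontrivial GroundRing := inferInstanceAs (Nontrivial (Polynomial (LaurentPolynomial ℂ)))
  have : CharZero GroundRing := algebraRat.charZero GroundRing
  ⟨fun a b h ↦ Nat.cast_injective (R := GroundRing) (hK (by
    rwa [map_natCast, map_natCast]))⟩

/-- Over a field containing the ground ring the Casimir element of the Iwahori--Hecke algebra is
invertible. -/
theorem casimirInvertible_hecke (hK : Function.Injective (algebraMap GroundRing K)) (m : ℕ) :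
    CasimirInvertible GroundRing K heckeTilde (fun w : Equiv.Perm (Fin m) ↦ heckeTilde w⁻¹) := by
  obtain ⟨z', r, hr, hz⟩ := exists_casimir_mul_eq m
  exact ⟨z', r, (map_ne_zero_iff _ hK).2 hr, hz⟩

theorem casimirInvertible_tensor (hK : Function.Injective (algebraMap GroundRing K))
    (μ : Comp d n) : CasimirInvertible GroundRing K (tensorTilde μ)
      (fun x ↦ tensorTilde μ fun a ↦ (x a)⁻¹) :=
  CasimirInvertible.piTensor (B := fun a ↦ Hecke (μ.1 a)) (b := fun _ ↦ heckeTilde)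
    (b' := fun _ w ↦ heckeTilde w⁻¹) fun a ↦ casimirInvertible_hecke hK (μ.1 a)

theorem casimirInvertible_matrix (hK : Function.Injective (algebraMap GroundRing K))
    (μ : Comp d n) : CasimirInvertible GroundRing K
      (fun i : Orb μ × Orb μ × (∀ a, Equiv.Perm (Fin (μ.1 a))) ↦
        Matrix.single i.1 i.2.1 (tensorTilde μ i.2.2))
      (fun i ↦ Matrix.single i.2.1 i.1 (tensorTilde μ fun a ↦ (i.2.2 a)⁻¹)) :=
  have := charZero_of_injective hK
  (casimirInvertible_tensor hK μ).matrix

theorem casimirInvertible_block (hK : Function.Injective (algebraMap GroundRing K)) :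
    CasimirInvertible GroundRing K (blockBasis (d := d) (n := n)) blockDual := by
  have h := CasimirInvertible.pi
    (B := fun μ : Comp d n ↦ Matrix (Orb μ) (Orb μ) (HeckeTensor μ))
    (X := fun μ ↦ Orb μ × Orb μ × (∀ a, Equiv.Perm (Fin (μ.1 a))))
    (b := fun μ i ↦ Matrix.single i.1 i.2.1 (tensorTilde μ i.2.2))
    (b' := fun μ i ↦ Matrix.single i.2.1 i.1 (tensorTilde μ fun a ↦ (i.2.2 a)⁻¹))
    (casimirInvertible_matrix hK)
  exact h

variable {ξ : Fin d → ℂ} (hd : 0 < d) (hξ : Function.Injective ξ) (hξd : ∀ a, ξ a ^ d = 1)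

theorem isSymmDual_yokonumaForm : IsSymmDual (yokonumaForm (n := n) hd hξ hξd)
    (fun k ↦ (psiEquiv hd hξ hξd).symm (blockBasis k))
    (fun k ↦ (psiEquiv hd hξ hξd).symm (blockDual k)) :=
  isSymmDual_blockForm.comp_algEquiv _

variable {Λ : ℕ → Type*} {deg : ∀ m, Λ m → ℕ}
  {M : ∀ m (x : Λ m), Hecke m →ₐ[GroundRing] Matrix (Fin (deg m x)) (Fin (deg m x)) K}
  {c : ∀ m, Λ m → K}

theorem comp_le (μ : Comp d n) (a : Fin d) : μ.1 a ≤ n :=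
  (Finset.single_le_sum (fun _ _ ↦ Nat.zero_le _) (Finset.mem_univ a)).trans_eq μ.2

/-- The Schur constants of the modules `(M_{λ^1} ⊗ ⋯ ⊗ M_{λ^d})^{m_μ}` are the products of those
of the factors. -/
theorem isSchurOrthogonal_yokonumaRep (ho : ∀ m ≤ n, IsSchurOrthogonal heckeTilde
      (fun w : Equiv.Perm (Fin m) ↦ heckeTilde w⁻¹) (M m) (c m)) :
    IsSchurOrthogonal (fun k ↦ (psiEquiv (n := n) hd hξ hξd).symm (blockBasis k))
      (fun k ↦ (psiEquiv hd hξ hξd).symm (blockDual k))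
      (fun p : Σ μ : Comp d n, ∀ a, Λ (μ.1 a) ↦
        yokonumaRep (psiEquiv hd hξ hξd) p.1 fun a ↦ M (p.1.1 a) (p.2 a))
      (fun p ↦ ∏ a, c (p.1.1 a) (p.2 a)) := by
  have h : ∀ μ : Comp d n, IsSchurOrthogonal (tensorTilde μ)
      (fun x ↦ tensorTilde μ fun a ↦ (x a)⁻¹)
      (fun k : ∀ a, Λ (μ.1 a) ↦ heckeTensorRep μ fun a ↦ M (μ.1 a) (k a))
      (fun k ↦ ∏ a, c (μ.1 a) (k a)) := fun μ ↦
    IsSchurOrthogonal.piTensor fun a ↦ ho (μ.1 a) (comp_le μ a)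
  exact (IsSchurOrthogonal.pi
    (B := fun μ : Comp d n ↦ Matrix (Orb μ) (Orb μ) (HeckeTensor μ))
    (X := fun μ ↦ Orb μ × Orb μ × (∀ a, Equiv.Perm (Fin (μ.1 a))))
    fun μ ↦ (h μ).matrix (O := Orb μ)).comp_algEquiv (psiEquiv hd hξ hξd)

/-- The expansion of `ρ_n` in characters, blockwise from those of the forms `τ_m`. -/
theorem yokonumaForm_expansion [∀ m, Fintype (Λ m)]
    (h : ∀ m ≤ n, ∀ x : Hecke m, algebraMap GroundRing K (canonicalForm m x) =
      ∑ k, (c m k)⁻¹ * Matrix.trace (M m k x)) (y : Yokonuma d n) :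
    algebraMap GroundRing K (yokonumaForm hd hξ hξd y) =
      ∑ p : Σ μ : Comp d n, ∀ a, Λ (μ.1 a), (∏ a, c (p.1.1 a) (p.2 a))⁻¹ *
        Matrix.trace (yokonumaRep (psiEquiv hd hξ hξd) p.1 (fun a ↦ M (p.1.1 a) (p.2 a)) y) := by
  have h' : ∀ (μ : Comp d n) (x : HeckeTensor μ),
      algebraMap GroundRing K (tensorForm canonicalForm μ x) = ∑ k : ∀ a, Λ (μ.1 a),
        (∏ a, c (μ.1 a) (k a))⁻¹ *
          Matrix.trace (heckeTensorRep μ (fun a ↦ M (μ.1 a) (k a)) x) := fun μ ↦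
    expansion_piTensor fun a ↦ h (μ.1 a) (comp_le μ a)
  exact expansion_pi
    (B := fun μ : Comp d n ↦ Matrix (Orb μ) (Orb μ) (HeckeTensor μ))
    (fun μ ↦ expansion_matrix (O := Orb μ) (h' μ)) (psiEquiv hd hξ hξd y)

end YokonumaSchur

end

end YokonumaHecke

open YokonumaHecke
theorem proposition4p4 (d n : ℕ) (hd : 0 < d) (ξ : Fin d → ℂ) (hξ : Function.Injective ξ)
    (hξd : ∀ a, ξ a ^ d = 1) :
    -- `T̃_w` and `g̃_w` can be computed from any reduced expression
    (∀ (m : ℕ) (l : List (Fin (m - 1))), IsReducedWord l → heckeWord l = heckeTilde (wordProd l)) ∧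
    (∀ l : List (Fin (n - 1)), IsReducedWord l → yWord d l = gTilde d (wordProd l)) ∧
    -- the forms `τ_m`, the form `ρ'` of Chlouveraki and Poulain d'Andecy and the isomorphism `Ψ`
    -- exist and are the unique linear maps with their defining values
    ∃ (τ : ∀ m, Hecke m →ₗ[GroundRing] GroundRing)
      (ρ' : Yokonuma d n →ₗ[GroundRing] GroundRing)
      (Ψ : Yokonuma d n ≃ₐ[GroundRing] BlockAlgebra d n),
      (∀ m (f : Hecke m →ₗ[GroundRing] GroundRing), IsCanonicalForm f ↔ f = τ m) ∧
      (∀ f : Yokonuma d n →ₗ[GroundRing] GroundRing, IsCPAForm f ↔ f = ρ') ∧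
      (∀ F : Yokonuma d n →ₗ[GroundRing] BlockAlgebra d n, IsPsi ξ F ↔ F = Ψ.toLinearMap) ∧
      (∀ m, IsSymmetrizing (τ m)) ∧ IsSymmetrizing ρ' ∧
      -- the two forms on `Y_{d,n}` coincide
      (∀ y, rho τ Ψ y = ρ' y) ∧
      -- the values of the form on the basis `E_χ g̃_w`
      (∀ (χ : Fin n → Fin d) (w : Equiv.Perm (Fin n)),
        ρ' (idem ξ χ * gTilde d w) = if w = 1 then 1 else 0) ∧
      -- the Schur elements, over any field `K ⊇ ℂ[u^{±1}, v]` which splits `H_0, …, H_n`, the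
      -- simple modules of `K H_m` being labelled as `M m x` with `x : Λ m`
      ∀ (K : Type*) [Field K] [Algebra GroundRing K],
        Function.Injective (algebraMap GroundRing K) →
        ∀ (Λ : ℕ → Type*) [∀ m, Fintype (Λ m)] (deg : ∀ m, Λ m → ℕ)
          (M : ∀ m (x : Λ m),
            Hecke m →ₐ[GroundRing] Matrix (Fin (deg m x)) (Fin (deg m x)) K),
          (∀ m ≤ n, IsSplitIrrList (M m)) →
          (∀ m ≤ n, IsSemisimpleRing (K ⊗[GroundRing] Hecke m) ∧
            ∃! s : Λ m → K, IsSchurFamily (τ m) (M m) s) ∧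
          IsSemisimpleRing (K ⊗[GroundRing] Yokonuma d n) ∧
          IsSplitIrrList (fun p : Σ μ : Comp d n, ∀ a, Λ (μ.1 a) ↦
            yokonumaRep Ψ p.1 fun a ↦ M (p.1.1 a) (p.2 a)) ∧
          ∀ s : ∀ m, Λ m → K, (∀ m ≤ n, IsSchurFamily (τ m) (M m) (s m)) →
            ∀ s' : (Σ μ : Comp d n, ∀ a, Λ (μ.1 a)) → K,
              IsSchurFamily ρ' (fun p : Σ μ : Comp d n, ∀ a, Λ (μ.1 a) ↦
                yokonumaRep Ψ p.1 fun a ↦ M (p.1.1 a) (p.2 a)) s' ↔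
              s' = fun p ↦ ∏ a, s (p.1.1 a) (p.2 a) := by
  refine ⟨fun m l hl ↦ heckeWord_eq hl, fun l hl ↦ yWord_eq hl, canonicalForm,
    yokonumaForm hd hξ hξd, psiEquiv hd hξ hξd, fun m f ↦ isCanonicalForm_iff f,
    isCPAForm_iff hd hξ hξd, isPsi_iff hd hξ hξd,
    fun m ↦ (isSymmDual_canonicalForm m).isSymmetrizing,
    (isSymmDual_yokonumaForm hd hξ hξd).isSymmetrizing, rho_eq hd hξ hξd,
    yokonumaForm_idem_mul_gTilde hd hξ hξd, ?_⟩
  intro K _ _ hK Λ _ deg M hM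
  have hH : ∀ m, IsSemisimpleRing (K ⊗[GroundRing] Hecke m) := fun m ↦
    (isSymmDual_canonicalForm m).isSemisimpleRing (casimirInvertible_hecke hK m)
  -- the Schur constants of the Hecke algebras, extended arbitrarily to `m > n`
  have hex : ∀ m, ∃ c : Λ m → K, m ≤ n → IsSchurOrthogonal heckeTilde
      (fun w : Equiv.Perm (Fin m) ↦ heckeTilde w⁻¹) (M m) c := by
    intro m
    by_cases hm : m ≤ n
    · obtain ⟨c, hc⟩ := (isSymmDual_canonicalForm m).exists_isSchurOrthogonal (hM m hm)
      exact ⟨c, fun _ ↦ hc⟩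
    · exact ⟨0, fun h ↦ absurd h hm⟩
  choose c ho using hex
  have hne : ∀ m ≤ n, ∀ k, Nonempty (Fin (deg m k)) := fun m hm k ↦ ((hM m hm).irreducible k).1
  have hc0 : ∀ m (hm : m ≤ n), ∀ k, c m k ≠ 0 := fun m hm ↦
    (ho m hm).ne_zero (hne m hm) (casimirInvertible_hecke hK m)
  have hexp : ∀ m ≤ n, ∀ x : Hecke m, algebraMap GroundRing K (canonicalForm m x) =
      ∑ k, (c m k)⁻¹ * Matrix.trace (M m k x) := fun m hm ↦
    (ho m hm).expansion (isSymmDual_canonicalForm m) (hM m hm) (hc0 m hm)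
  have hY := isSymmDual_yokonumaForm (n := n) hd hξ hξd
  have hoY := isSchurOrthogonal_yokonumaRep hd hξ hξd ho
  have hexpY := yokonumaForm_expansion hd hξ hξd hexp
  have hneY : ∀ p : Σ μ : Comp d n, ∀ a, Λ (μ.1 a),
      Nonempty (Orb p.1 × ∀ a, Fin (deg (p.1.1 a) (p.2 a))) := by
    intro p
    have := fun a ↦ hne _ (comp_le p.1 a) (p.2 a)
    infer_instance
  have hcY : ∀ p : Σ μ : Comp d n, ∀ a, Λ (μ.1 a), ∏ a, c (p.1.1 a) (p.2 a) ≠ 0 := fun p ↦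
    Finset.prod_ne_zero_iff.2 fun a _ ↦ hc0 _ (comp_le p.1 a) _
  refine ⟨fun m hm ↦ ⟨hH m, (isSymmDual_canonicalForm m).existsUnique_schurFamily
    (casimirInvertible_hecke hK m) (hM m hm)⟩,
    hY.isSemisimpleRing ((casimirInvertible_block hK).comp_algEquiv _),
    hoY.isSplitIrrList hY hneY hcY hexpY, fun s hs s' ↦ ?_⟩
  have hsc : ∀ m ≤ n, s m = c m := fun m hm ↦
    (ho m hm).eq_of_expansion (isSymmDual_canonicalForm m) (hne m hm) (hs m hm).ne_zero
      (hs m hm).expansion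
  have hprod : (fun p : Σ μ : Comp d n, ∀ a, Λ (μ.1 a) ↦ ∏ a, s (p.1.1 a) (p.2 a)) =
      fun p ↦ ∏ a, c (p.1.1 a) (p.2 a) :=
    funext fun p ↦ Finset.prod_congr rfl fun a _ ↦ congrFun (hsc _ (comp_le p.1 a)) _
  rw [hprod]
  constructor
  · intro h
    exact hoY.eq_of_expansion hY hneY h.ne_zero h.expansion
  · rintro rfl
    exact ⟨hoY.isIntegral hY hneY, hcY, hexpY⟩
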